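/- All objects are smooth. Let $R,T$ be functions on an open subset $\mathcal J$ of $\mathbb R^6$ with coordinates $(x,y,z,p,q,s)$, satisfying $1-R_sT_s\neq 0$ everywhere, and consider the pair of equations $$z_{xx}=R(x,y,z,z_x,z_y,z_{xy}),\qquad z_{yy}=T(x,y,z,z_x,z_y,z_{xy}).$$ Let $D_x=\partial_x+p\,\partial_z+R\,\partial_p+s\,\partial_q+(D_yR)\,\partial_s$ and $D_y=\partial_y+q\,\partial_z+s\,\partial_p+T\,\partial_q+(D_xT)\,\partial_s$; since $R_sT_s\ne1$, these implicit formulas determine $D_yR$, $D_xT$ and hence $D_x,D_y$ uniquely. Call the pair admissible if moreover $D_x^2T=D_y^2R$ on $\mathcal J$, and generic if $R_sT_s=4$ holds identically on no nonempty open subset of $\mathcal J$ (this is automatic if $1-R_sT_s>0$). Put $$\begin{aligned} J_1={}&(R_sT_s-4)D_xR_s+R_s(2D_yR_s-R_sD_xT_s)+8R_q-6R_qR_sT_s+4R_pR_s+2R_s^2T_q-2R_pR_s^2T_s+2R_s^3T_p,\\ J_2={}&(R_sT_s-4)D_yT_s+T_s(2D_xT_s-T_sD_yR_s)+8T_p-6R_sT_pT_s+4T_qT_s+2R_pT_s^2-2R_sT_qT_s^2+2R_qT_s^3,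 \end{aligned}$$ $$\lambda=dz-p\,dx-q\,dy,\quad \nu_1=dp-R\,dx-s\,dy,\quad \nu_2=dq-s\,dx-T\,dy,\quad \nu_3=ds-(D_yR)\,dx-(D_xT)\,dy .$$ A (local) general solution is a smooth function $z=\psi(x,y,a_0,a_1,a_2,a_3)$ on an open set $W\subset\mathbb R^2\times\mathbb R^4$ whose slices $\{a=\mathrm{const}\}$ are connected, which solves the pair of equations for each fixed $a$, and for which $(x,y,a)\mapsto(x,y,\psi,\psi_x,\psi_y,\psi_{xy})$ is a diffeomorphism onto an open subset of $\mathcal J$; the $a_i$ are then local coordinates on the solution space. A contact transformation of one pair into another is a diffeomorphism $\varphi$ between open sets of the space of first jets $(x,y,z,p,q)$ with $\varphi^*(dz'-p'dx'-q'dy')=\rho\,(dz-p\,dx-q\,dy)$, $\rho\neq0$, whose prolongation to second jets maps the jet space $\mathcal J$ of the first pair diffeomorphically onto the jet space $\mathcal J'$ of the second. Let the pair $(R,T)$ be admissible and generic. (1) If $J_1\equiv J_2\equiv0$ for $(R,T)$, then $J_1\equiv J_2\equiv 0$ for every admissible pair into which $(R,T)$ is transformed by a contact transformation. (2) The solution space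 is 4-dimensional: through every point of $\mathcal J$ there passes a local general solution. (3) If $J_1\equiv J_2\equiv0$, the solution space is equipped with a conformal class $[g]$ (metrics up to multiplication by nowhere vanishing smooth functions, of either sign): for every local general solution, the metrics on its parameter space whose pullback to $\mathcal J$ is conformal to (A) where $R_sT_s\neq4$ and conformal to (B) where $R_sT_s\ne0$ exist and form exactly one conformal class. Here $$g=2\lambda\omega+2(R_sT_s-4)(T_s\nu_1^2-2\nu_1\nu_2+R_s\nu_2^2),\tag{A}$$ $$\begin{aligned} \omega={}&(4D_xT_s-2T_sD_yR_s+4R_pT_s-2R_s^2T_pT_s-2R_sT_qT_s+4R_qT_s^2)\,\nu_1\\ &+(4D_yR_s-2R_sD_xT_s+4R_sT_q-2R_qR_sT_s^2-2R_pR_sT_s+4R_s^2T_p)\,\nu_2\\ &+2(4-R_sT_s)(R_sT_s-1)\,\nu_3+v\,\lambda, \end{aligned}$$ $$\begin{aligned} 2v={}&8\,(D_xT_q)-4\,D_y^2R_s+4\,(D_xT_s)\,(D_yR_s)+4\,R_s\,(D_xT_p)-4\,R_s\,(D_yT_q)\\ &-4\,R_s^2\,(D_yT_p)+8\,R_q\,T_p-14\,R_s\,T_p\,(D_yR_s)+4\,R_p\,R_s\,T_p+3\,R_s^2\,T_p\,(D_xT_s)\\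 &-6\,R_s^3\,T_p^2-4\,T_q\,(D_yR_s)+4\,R_s\,T_q\,(D_xT_s)-6\,R_s^2\,T_p\,T_q+8\,T_s\,(D_yR_q)\\ &-2\,(D_yR_s)^2\,T_s+4\,R_p\,T_s\,(D_yR_s)-2\,R_s\,T_s\,(D_xT_q)+R_s\,T_s\,D_y^2R_s+4\,R_s\,T_s\,(D_yR_p)\\ &-R_s^2\,T_s\,(D_xT_p)+R_s^2\,T_s\,(D_yT_q)+R_s^3\,T_s\,(D_yT_p)+8\,R_z\,T_s+2\,R_q\,R_s\,T_p\,T_s\\ &+2\,R_p\,R_s^2\,T_p\,T_s+8\,R_q\,T_q\,T_s-3\,R_s\,T_q\,T_s\,(D_yR_s)+4\,R_p\,R_s\,T_q\,T_s-2\,R_s^3\,T_p\,T_q\,T_s\\ &-2\,R_s^2\,T_q^2\,T_s+4\,R_q\,T_s^2\,(D_yR_s)-2\,R_s\,T_s^2\,(D_yR_q)-R_s^2\,T_s^2\,(D_yR_p)-2\,R_s\,R_z\,T_s^2\\ &+2\,R_q\,R_s^2\,T_p\,T_s^2+2\,R_q\,R_s\,T_q\,T_s^2+8\,R_s\,T_z-2\,R_s^2\,T_s\,T_z,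 \end{aligned}$$ and $$g=2\lambda\omega'+T_s\nu_1^2-2\nu_1\nu_2+R_s\nu_2^2,\tag{B}$$ $$\begin{aligned} \omega'={}&\frac{-D_yT_s+2T_p-R_sT_pT_s+T_qT_s}{T_s}\,\nu_1+\frac{-D_xR_s+2R_q-R_qR_sT_s+R_pR_s}{R_s}\,\nu_2\\ &+(1-R_sT_s)\,\nu_3-\frac{v'}{2R_s^3T_s}\,\lambda, \end{aligned}$$ $$\begin{aligned} v'={}&2\,R_s^2\,(D_xR_s)\,(D_yT_s)-4\,R_q\,R_s^2\,(D_yT_s)-R_p\,R_s^3\,(D_yT_s)-4\,R_s^2\,T_p\,(D_xR_s)+8\,R_q\,R_s^2\,T_p\\ &+2\,R_p\,R_s^3\,T_p+2\,(D_xR_s)^2\,T_s-8\,R_q\,T_s\,(D_xR_s)+8\,R_q^2\,T_s-2\,R_p\,R_s\,T_s\,(D_xR_s)\\ &+4\,R_p\,R_q\,R_s\,T_s-R_s^2\,T_s\,(D_xD_yR_s)+2\,R_s^2\,T_s\,(D_yR_q)+R_s^3\,T_s\,(D_xT_q)+R_s^3\,T_s\,(D_yR_p)\\ &-R_q\,R_s^3\,T_p\,T_s-3\,R_s^2\,T_q\,T_s\,(D_xR_s)+6\,R_q\,R_s^2\,T_q\,T_s+R_p\,R_s^3\,T_q\,T_s+2\,R_q\,R_s\,T_s^2\,(D_xR_s)\\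 &-4\,R_q^2\,R_s\,T_s^2+R_s^3\,R_z\,T_s^2+R_s^4\,T_s\,T_z. \end{aligned}$$ (4) If $J_1\equiv J_2\equiv 0$, the metrics of $[g]$ have split signature $(+,+,-,-)$ where $1-R_sT_s>0$ and Lorentzian signature ($(+,+,+,-)$ or $(-,-,-,+)$) where $1-R_sT_s<0$. (5) If $J_1\equiv J_2\equiv0$, the class $[g]$ is invariant under contact transformations: if a contact transformation takes $(R,T)$ into another admissible generic pair, the map it induces between the solution spaces (expressed in parameters of local general solutions, each transformed solution being contained in a solution of the second family) is smooth and pulls back the conformal class of the second pair to that of $(R,T)$. -/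

import Mathlib

open Set
open scoped ContDiff

noncomputable section

namespace PDEPairs

/-- Coordinates `(x, y, z, p, q, s)` on the space of jets `𝒥`, with `p = z_x`, `q = z_y`,
`s = z_xy`. -/
abbrev Jet : Type := Fin 6 → ℝ

/-- Coordinates `(x, y, z, p, q)` on the space of first jets. -/
abbrev Jet₁ : Type := Fin 5 → ℝ

/-- Independent variables `(x, y)`. -/
abbrev Plane : Type := Fin 2 → ℝ

/-- Parameters `(a₀, a₁, a₂, a₃)` of a general solution. -/
abbrev Param : Type := Fin 4 → ℝ

/-- The projection `(x, y, z, p, q, s) ↦ (x, y, z, p, q)`. -/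
def toFirst (u : Jet) : Jet₁ := ![u 0, u 1, u 2, u 3, u 4]

/-- Partial derivative of a function on the jet space with respect to the `i`-th coordinate. -/
def pd (i : Fin 6) (f : Jet → ℝ) (u : Jet) : ℝ := fderiv ℝ f u (Pi.single i 1)

/-! ### Bilinear forms -/

/-- Bilinear forms on `V`. -/
abbrev Bil (V : Type*) [NormedAddCommGroup V] [NormedSpace ℝ V] : Type _ := V →L[ℝ] V →L[ℝ] ℝ

/-- The symmetric product `α β = (α ⊗ β + β ⊗ α) / 2` of two covectors. -/
def symProd {V : Type*} [NormedAddCommGroup V] [NormedSpace ℝ V] (α β : V →L[ℝ] ℝ) : Bil V :=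
  (1 / 2 : ℝ) • (α.smulRight β + β.smulRight α)

/-- The pullback `F^* g` of a field of bilinear forms. -/
def pullback {V V' : Type*} [NormedAddCommGroup V] [NormedSpace ℝ V]
    [NormedAddCommGroup V'] [NormedSpace ℝ V'] (F : V → V') (g : V' → Bil V') (w : V) : Bil V :=
  (g (F w)).bilinearComp (fderiv ℝ F w) (fderiv ℝ F w)

/-- `g = c g'` on `s` for a smooth nowhere vanishing function `c`. -/
def ConformalOn {V : Type*} [NormedAddCommGroup V] [NormedSpace ℝ V] (s : Set V)
    (g g' : V → Bil V) : Prop :=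
  ∃ c : V → ℝ, ContDiffOn ℝ ∞ c s ∧ ∀ w ∈ s, c w ≠ 0 ∧ g w = c w • g' w

/-- The form `B` is diagonal, with diagonal entries `σ`, in some basis. -/
def IsDiagonalizableTo (B : Bil Param) (σ : Fin 4 → ℝ) : Prop :=
  ∃ b : Module.Basis (Fin 4) ℝ Param, ∀ i j, B (b i) (b j) = if i = j then σ i else 0

/-- Signature `(+,+,-,-)`. -/
def IsSplit (B : Bil Param) : Prop := IsDiagonalizableTo B ![1, 1, -1, -1]

/-- Signature `(+,+,+,-)` or `(-,-,-,+)`; a conformal factor may be negative. -/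
def IsLorentzian (B : Bil Param) : Prop :=
  IsDiagonalizableTo B ![1, 1, 1, -1] ∨ IsDiagonalizableTo B ![-1, -1, -1, 1]

/-- A pseudo-Riemannian metric on an open set of parameters. -/
structure IsMetricOn (A : Set Param) (h : Param → Bil Param) : Prop where
  smooth : ContDiffOn ℝ ∞ h A
  symm : ∀ a ∈ A, ∀ v w, h a v w = h a w v
  nondegenerate : ∀ a ∈ A, ∀ v, (∀ w, h a v w = 0) → v = 0

/-! ### Pairs of equations `z_xx = R(x,y,z,z_x,z_y,z_xy)`, `z_yy = T(x,y,z,z_x,z_y,z_xy)` -/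

/-- The right-hand sides of the pair of equations `z_xx = R`, `z_yy = T`, on a domain of
the jet space. -/
structure PDEPair where
  domain : Set Jet
  R : Jet → ℝ
  T : Jet → ℝ

namespace PDEPair

variable (E : PDEPair)

def Rz : Jet → ℝ := pd 2 E.R
def Rp : Jet → ℝ := pd 3 E.R
def Rq : Jet → ℝ := pd 4 E.R
def Rs : Jet → ℝ := pd 5 E.R
def Tz : Jet → ℝ := pd 2 E.T
def Tp : Jet → ℝ := pd 3 E.T
def Tq : Jet → ℝ := pd 4 E.T
def Ts : Jet → ℝ := pd 5 E.T

/-- `T_x + p T_z + R T_p + s T_q`. -/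
def truncDxT (u : Jet) : ℝ :=
  pd 0 E.T u + u 3 * E.Tz u + E.R u * E.Tp u + u 5 * E.Tq u

/-- `R_y + q R_z + s R_p + T R_q`. -/
def truncDyR (u : Jet) : ℝ :=
  pd 1 E.R u + u 4 * E.Rz u + u 5 * E.Rp u + E.T u * E.Rq u

/-- The coefficient `D_y R`: the value obtained by solving
`D_x T = T_x + p T_z + R T_p + s T_q + T_s D_y R`,
`D_y R = R_y + q R_z + s R_p + T R_q + R_s D_x T`. -/
def coeffDyR (u : Jet) : ℝ :=
  (E.truncDyR u + E.Rs u * E.truncDxT u) / (1 - E.Rs u * E.Ts u)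

/-- The coefficient `D_x T`, solution of the same linear system. -/
def coeffDxT (u : Jet) : ℝ :=
  (E.truncDxT u + E.Ts u * E.truncDyR u) / (1 - E.Rs u * E.Ts u)

/-- The vector field `D_x = ∂_x + p ∂_z + R ∂_p + s ∂_q + (D_y R) ∂_s`. -/
def fieldX (u : Jet) : Jet := ![1, 0, u 3, E.R u, u 5, E.coeffDyR u]

/-- The vector field `D_y = ∂_y + q ∂_z + s ∂_p + T ∂_q + (D_x T) ∂_s`. -/
def fieldY (u : Jet) : Jet := ![0, 1, u 4, u 5, E.T u, E.coeffDxT u]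

/-- The derivative `D_x f`. -/
def Dx (f : Jet → ℝ) (u : Jet) : ℝ := fderiv ℝ f u (E.fieldX u)

/-- The derivative `D_y f`. -/
def Dy (f : Jet → ℝ) (u : Jet) : ℝ := fderiv ℝ f u (E.fieldY u)

theorem fderiv_eq_sum_pd (f : Jet → ℝ) (u v : Jet) :
    fderiv ℝ f u v = ∑ i, v i * pd i f u := by
  conv_lhs => rw [← Finset.univ_sum_single v, map_sum]
  refine Finset.sum_congr rfl fun i _ => ?_
  have : (Pi.single i (v i) : Jet) = v i • (Pi.single i (1 : ℝ) : Jet) := by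
    rw [← Pi.single_smul]; simp
  rw [this, map_smul, smul_eq_mul, pd]

theorem coeffDxT_mul {u : Jet} (hu : 1 - E.Rs u * E.Ts u ≠ 0) :
    E.coeffDxT u * (1 - E.Rs u * E.Ts u) = E.truncDxT u + E.Ts u * E.truncDyR u :=
  div_mul_cancel₀ _ hu

theorem coeffDyR_mul {u : Jet} (hu : 1 - E.Rs u * E.Ts u ≠ 0) :
    E.coeffDyR u * (1 - E.Rs u * E.Ts u) = E.truncDyR u + E.Rs u * E.truncDxT u :=
  div_mul_cancel₀ _ hu

/-- The last component of the field `D_x` is the derivative of `R` along the field `D_y`. -/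
theorem Dy_R {u : Jet} (hu : 1 - E.Rs u * E.Ts u ≠ 0) : E.Dy E.R u = E.coeffDyR u := by
  have h : E.Dy E.R u = E.truncDyR u + E.Rs u * E.coeffDxT u := by
    rw [Dy, fderiv_eq_sum_pd]
    simp only [Fin.sum_univ_six, fieldY, truncDyR, Matrix.cons_val, Rz, Rp, Rq, Rs]
    ring
  rw [h]
  refine mul_right_cancel₀ hu ?_
  linear_combination E.Rs u * E.coeffDxT_mul hu - E.coeffDyR_mul hu

/-- The last component of the field `D_y` is the derivative of `T` along the field `D_x`. -/
theorem Dx_T {u : Jet} (hu : 1 - E.Rs u * E.Ts u ≠ 0) : E.Dx E.T u = E.coeffDxT u := by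
  have h : E.Dx E.T u = E.truncDxT u + E.Ts u * E.coeffDyR u := by
    rw [Dx, fderiv_eq_sum_pd]
    simp only [Fin.sum_univ_six, fieldX, truncDxT, Matrix.cons_val, Tz, Tp, Tq, Ts]
    ring
  rw [h]
  refine mul_right_cancel₀ hu ?_
  linear_combination E.Ts u * E.coeffDyR_mul hu - E.coeffDxT_mul hu

/-- Smooth right-hand sides on an open domain with `1 - R_s T_s ≠ 0` and
`D_x² T = D_y² R`. -/
structure Admissible : Prop where
  isOpen : IsOpen E.domain
  smooth_R : ContDiffOn ℝ ∞ E.R E.domain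
  smooth_T : ContDiffOn ℝ ∞ E.T E.domain
  nondegenerate : ∀ u ∈ E.domain, 1 - E.Rs u * E.Ts u ≠ 0
  integrable : ∀ u ∈ E.domain, E.Dx (E.Dx E.T) u = E.Dy (E.Dy E.R) u

/-- There is no nonempty open subset of the domain on which `R_s T_s = 4` identically. -/
def Generic : Prop := interior {u ∈ E.domain | E.Rs u * E.Ts u = 4} = ∅

def J1 (u : Jet) : ℝ :=
  (E.Rs u * E.Ts u - 4) * E.Dx E.Rs u
    + E.Rs u * (2 * E.Dy E.Rs u - E.Rs u * E.Dx E.Ts u)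
    + 8 * E.Rq u - 6 * E.Rq u * E.Rs u * E.Ts u + 4 * E.Rp u * E.Rs u
    + 2 * E.Rs u ^ 2 * E.Tq u - 2 * E.Rp u * E.Rs u ^ 2 * E.Ts u
    + 2 * E.Rs u ^ 3 * E.Tp u

def J2 (u : Jet) : ℝ :=
  (E.Rs u * E.Ts u - 4) * E.Dy E.Ts u
    + E.Ts u * (2 * E.Dx E.Ts u - E.Ts u * E.Dy E.Rs u)
    + 8 * E.Tp u - 6 * E.Rs u * E.Tp u * E.Ts u + 4 * E.Tq u * E.Ts u
    + 2 * E.Rp u * E.Ts u ^ 2 - 2 * E.Rs u * E.Tq u * E.Ts u ^ 2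
    + 2 * E.Rq u * E.Ts u ^ 3

/-- The metricity conditions `J₁ ≡ J₂ ≡ 0`. -/
def Metricity : Prop := ∀ u ∈ E.domain, E.J1 u = 0 ∧ E.J2 u = 0

/-! ### The coframe and the bilinear forms on the jet space -/

/-- The differential of the `i`-th coordinate. -/
def dcoord (i : Fin 6) : Jet →L[ℝ] ℝ := ContinuousLinearMap.proj i

/-- `λ = dz - p dx - q dy`. -/
def lam (u : Jet) : Jet →L[ℝ] ℝ := dcoord 2 - u 3 • dcoord 0 - u 4 • dcoord 1

/-- `ν₁ = dp - R dx - s dy`. -/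
def nu1 (u : Jet) : Jet →L[ℝ] ℝ := dcoord 3 - E.R u • dcoord 0 - u 5 • dcoord 1

/-- `ν₂ = dq - s dx - T dy`. -/
def nu2 (u : Jet) : Jet →L[ℝ] ℝ := dcoord 4 - u 5 • dcoord 0 - E.T u • dcoord 1

/-- `ν₃ = ds - D_y R dx - D_x T dy`. -/
def nu3 (u : Jet) : Jet →L[ℝ] ℝ := dcoord 5 - E.Dy E.R u • dcoord 0 - E.Dx E.T u • dcoord 1

/-- The quadratic form `T_s ν₁² - 2 ν₁ ν₂ + R_s ν₂²`. -/
def nuForm (u : Jet) : Bil Jet :=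
  E.Ts u • symProd (E.nu1 u) (E.nu1 u) - (2 : ℝ) • symProd (E.nu1 u) (E.nu2 u)
    + E.Rs u • symProd (E.nu2 u) (E.nu2 u)

/-- Twice the coefficient of `λ` in `ω`. -/
def twoV (u : Jet) : ℝ :=
  8 * E.Dx E.Tq u - 4 * E.Dy (E.Dy E.Rs) u + 4 * E.Dx E.Ts u * E.Dy E.Rs u
    + 4 * E.Rs u * E.Dx E.Tp u - 4 * E.Rs u * E.Dy E.Tq u - 4 * E.Rs u ^ 2 * E.Dy E.Tp u
    + 8 * E.Rq u * E.Tp u - 14 * E.Rs u * E.Tp u * E.Dy E.Rs u + 4 * E.Rp u * E.Rs u * E.Tp u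
    + 3 * E.Rs u ^ 2 * E.Tp u * E.Dx E.Ts u - 6 * E.Rs u ^ 3 * E.Tp u ^ 2
    - 4 * E.Tq u * E.Dy E.Rs u + 4 * E.Rs u * E.Tq u * E.Dx E.Ts u
    - 6 * E.Rs u ^ 2 * E.Tp u * E.Tq u + 8 * E.Ts u * E.Dy E.Rq u
    - 2 * (E.Dy E.Rs u) ^ 2 * E.Ts u + 4 * E.Rp u * E.Ts u * E.Dy E.Rs u
    - 2 * E.Rs u * E.Ts u * E.Dx E.Tq u + E.Rs u * E.Ts u * E.Dy (E.Dy E.Rs) u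
    + 4 * E.Rs u * E.Ts u * E.Dy E.Rp u - E.Rs u ^ 2 * E.Ts u * E.Dx E.Tp u
    + E.Rs u ^ 2 * E.Ts u * E.Dy E.Tq u + E.Rs u ^ 3 * E.Ts u * E.Dy E.Tp u
    + 8 * E.Rz u * E.Ts u + 2 * E.Rq u * E.Rs u * E.Tp u * E.Ts u
    + 2 * E.Rp u * E.Rs u ^ 2 * E.Tp u * E.Ts u + 8 * E.Rq u * E.Tq u * E.Ts u
    - 3 * E.Rs u * E.Tq u * E.Ts u * E.Dy E.Rs u + 4 * E.Rp u * E.Rs u * E.Tq u * E.Ts u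
    - 2 * E.Rs u ^ 3 * E.Tp u * E.Tq u * E.Ts u - 2 * E.Rs u ^ 2 * E.Tq u ^ 2 * E.Ts u
    + 4 * E.Rq u * E.Ts u ^ 2 * E.Dy E.Rs u - 2 * E.Rs u * E.Ts u ^ 2 * E.Dy E.Rq u
    - E.Rs u ^ 2 * E.Ts u ^ 2 * E.Dy E.Rp u - 2 * E.Rs u * E.Rz u * E.Ts u ^ 2
    + 2 * E.Rq u * E.Rs u ^ 2 * E.Tp u * E.Ts u ^ 2 + 2 * E.Rq u * E.Rs u * E.Tq u * E.Ts u ^ 2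
    + 8 * E.Rs u * E.Tz u - 2 * E.Rs u ^ 2 * E.Ts u * E.Tz u

/-- The form `ω`. -/
def omega (u : Jet) : Jet →L[ℝ] ℝ :=
  (4 * E.Dx E.Ts u - 2 * E.Ts u * E.Dy E.Rs u + 4 * E.Rp u * E.Ts u
      - 2 * E.Rs u ^ 2 * E.Tp u * E.Ts u - 2 * E.Rs u * E.Tq u * E.Ts u
      + 4 * E.Rq u * E.Ts u ^ 2) • E.nu1 u
    + (4 * E.Dy E.Rs u - 2 * E.Rs u * E.Dx E.Ts u + 4 * E.Rs u * E.Tq u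
      - 2 * E.Rq u * E.Rs u * E.Ts u ^ 2 - 2 * E.Rp u * E.Rs u * E.Ts u
      + 4 * E.Rs u ^ 2 * E.Tp u) • E.nu2 u
    + (2 * (4 - E.Rs u * E.Ts u) * (E.Rs u * E.Ts u - 1)) • E.nu3 u
    + (E.twoV u / 2) • lam u

/-- The bilinear form
`g = 2 λ ω + 2 (R_s T_s - 4) (T_s ν₁² - 2 ν₁ ν₂ + R_s ν₂²)`, meant where `R_s T_s ≠ 4`. -/
def g1 (u : Jet) : Bil Jet :=
  (2 : ℝ) • symProd (lam u) (E.omega u) + (2 * (E.Rs u * E.Ts u - 4)) • E.nuForm u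

/-- The function `v'`. -/
def vPrime (u : Jet) : ℝ :=
  2 * E.Rs u ^ 2 * E.Dx E.Rs u * E.Dy E.Ts u - 4 * E.Rq u * E.Rs u ^ 2 * E.Dy E.Ts u
    - E.Rp u * E.Rs u ^ 3 * E.Dy E.Ts u - 4 * E.Rs u ^ 2 * E.Tp u * E.Dx E.Rs u
    + 8 * E.Rq u * E.Rs u ^ 2 * E.Tp u + 2 * E.Rp u * E.Rs u ^ 3 * E.Tp u
    + 2 * (E.Dx E.Rs u) ^ 2 * E.Ts u - 8 * E.Rq u * E.Ts u * E.Dx E.Rs u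
    + 8 * E.Rq u ^ 2 * E.Ts u - 2 * E.Rp u * E.Rs u * E.Ts u * E.Dx E.Rs u
    + 4 * E.Rp u * E.Rq u * E.Rs u * E.Ts u - E.Rs u ^ 2 * E.Ts u * E.Dx (E.Dy E.Rs) u
    + 2 * E.Rs u ^ 2 * E.Ts u * E.Dy E.Rq u + E.Rs u ^ 3 * E.Ts u * E.Dx E.Tq u
    + E.Rs u ^ 3 * E.Ts u * E.Dy E.Rp u - E.Rq u * E.Rs u ^ 3 * E.Tp u * E.Ts u
    - 3 * E.Rs u ^ 2 * E.Tq u * E.Ts u * E.Dx E.Rs u + 6 * E.Rq u * E.Rs u ^ 2 * E.Tq u * E.Ts u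
    + E.Rp u * E.Rs u ^ 3 * E.Tq u * E.Ts u + 2 * E.Rq u * E.Rs u * E.Ts u ^ 2 * E.Dx E.Rs u
    - 4 * E.Rq u ^ 2 * E.Rs u * E.Ts u ^ 2 + E.Rs u ^ 3 * E.Rz u * E.Ts u ^ 2
    + E.Rs u ^ 4 * E.Ts u * E.Tz u

/-- The form `ω'`, meant where `R_s T_s ≠ 0`. -/
def omegaPrime (u : Jet) : Jet →L[ℝ] ℝ :=
  ((-E.Dy E.Ts u + 2 * E.Tp u - E.Rs u * E.Tp u * E.Ts u + E.Tq u * E.Ts u) / E.Ts u) • E.nu1 u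
    + ((-E.Dx E.Rs u + 2 * E.Rq u - E.Rq u * E.Rs u * E.Ts u + E.Rp u * E.Rs u) / E.Rs u)
      • E.nu2 u
    + (1 - E.Rs u * E.Ts u) • E.nu3 u
    - (E.vPrime u / (2 * E.Rs u ^ 3 * E.Ts u)) • lam u

/-- The bilinear form `g = 2 λ ω' + T_s ν₁² - 2 ν₁ ν₂ + R_s ν₂²`, meant where
`R_s T_s ≠ 0`. -/
def g2 (u : Jet) : Bil Jet := (2 : ℝ) • symProd (lam u) (E.omegaPrime u) + E.nuForm u

end PDEPair

/-! ### The solution space -/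

/-- `∂f/∂x` (for `i = 0`) or `∂f/∂y` (for `i = 1`) of a function of `((x, y), a)`. -/
def pdPlane (i : Fin 2) (f : Plane × Param → ℝ) (w : Plane × Param) : ℝ :=
  fderiv ℝ f w (Pi.single i 1, 0)

/-- The map `(x, y, a) ↦ (x, y, ψ, ψ_x, ψ_y, ψ_xy)`. -/
def jetMap (ψ : Plane × Param → ℝ) (w : Plane × Param) : Jet :=
  ![w.1 0, w.1 1, ψ w, pdPlane 0 ψ w, pdPlane 1 ψ w, pdPlane 1 (pdPlane 0 ψ) w]

/-- A (local) general solution `z = ψ(x, y, a₀, a₁, a₂, a₃)`: a smooth family of solutions, each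
on a connected domain of the `(x, y)`-plane, such that `(x, y, a) ↦ (x, y, ψ, ψ_x, ψ_y, ψ_xy)` is
a diffeomorphism onto its (open) image in the jet space. The parameters `a` are local coordinates
on the 4-dimensional solution space. -/
structure GeneralSolution (E : PDEPair) where
  source : Set (Plane × Param)
  ψ : Plane × Param → ℝ
  isOpen : IsOpen source
  smooth : ContDiffOn ℝ ∞ ψ source
  slice_connected : ∀ a, IsPreconnected {t : Plane | (t, a) ∈ source}
  mapsTo : ∀ w ∈ source, jetMap ψ w ∈ E.domain
  eq_xx : ∀ w ∈ source, pdPlane 0 (pdPlane 0 ψ) w = E.R (jetMap ψ w)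
  eq_yy : ∀ w ∈ source, pdPlane 1 (pdPlane 1 ψ) w = E.T (jetMap ψ w)
  injOn : InjOn (jetMap ψ) source
  immersion : ∀ w ∈ source, Function.Injective (fderiv ℝ (jetMap ψ) w)

namespace GeneralSolution

variable {E : PDEPair} (S : GeneralSolution E)

/-- The map `(x, y, a) ↦ (x, y, ψ, ψ_x, ψ_y, ψ_xy)` into the jet space. -/
def jet : Plane × Param → Jet := jetMap S.ψ

/-- The set of parameters: the coordinate range of this piece of the solution space. -/
def params : Set Param := Prod.snd '' S.source

/-- The conformal class on the solution space determined by the pair of equations: all metrics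
`h(a)` whose lift to the jet space is conformal to `g1` where `R_s T_s ≠ 4`, and conformal to
`g2` where `R_s T_s ≠ 0`. -/
def conformalClass : Set (Param → Bil Param) :=
  {h | IsMetricOn S.params h ∧
    ConformalOn {w ∈ S.source | E.Rs (S.jet w) * E.Ts (S.jet w) ≠ 4}
      (pullback S.jet E.g1) (pullback Prod.snd h) ∧
    ConformalOn {w ∈ S.source | E.Rs (S.jet w) * E.Ts (S.jet w) ≠ 0}
      (pullback S.jet E.g2) (pullback Prod.snd h)}

end GeneralSolution

/-! ### Contact transformations -/

/-- The contact form `dz - p dx - q dy` on first jets, evaluated on a tangent vector. -/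
def contactForm (m v : Jet₁) : ℝ := v 2 - m 3 * v 0 - m 4 * v 1

/-- The plane of vectors `(dx, dy, dz, dp, dq)` tangent to the first jets of functions with the
2-jet determined by `u` and the equations: `dz = p dx + q dy`, `dp = R dx + s dy`,
`dq = s dx + T dy`. -/
def jetPlane (E : PDEPair) (u : Jet) : Set Jet₁ :=
  {v | v 2 = u 3 * v 0 + u 4 * v 1 ∧ v 3 = E.R u * v 0 + u 5 * v 1 ∧
    v 4 = u 5 * v 0 + E.T u * v 1}

/-- A contact transformation of the variables `(x, y, z, p, q)` that transforms the pair of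
equations `E` into the pair of equations `E'`: a diffeomorphism `base` of first jets which preserves
the contact form up to a nonvanishing factor, and whose prolongation to second jets maps the
6-dimensional space of second jets of `E` onto that of `E'` (as the diffeomorphism `lift`). -/
structure ContactEquivalence (E E' : PDEPair) where
  base : OpenPartialHomeomorph Jet₁ Jet₁
  base_smooth : ContDiffOn ℝ ∞ base base.source
  base_symm_smooth : ContDiffOn ℝ ∞ base.symm base.target
  contact : ∀ m ∈ base.source, ∃ ρ : ℝ, ρ ≠ 0 ∧
    ∀ v, contactForm (base m) (fderiv ℝ base m v) = ρ * contactForm m v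
  lift : OpenPartialHomeomorph Jet Jet
  lift_source : lift.source = E.domain
  lift_target : lift.target = E'.domain
  lift_smooth : ContDiffOn ℝ ∞ lift lift.source
  lift_symm_smooth : ContDiffOn ℝ ∞ lift.symm lift.target
  mem_base : ∀ u ∈ E.domain, toFirst u ∈ base.source
  covers : ∀ u ∈ E.domain, toFirst (lift u) = base (toFirst u)
  prolongs : ∀ u ∈ E.domain,
    fderiv ℝ base (toFirst u) '' jetPlane E u = jetPlane E' (lift u)

/-- The map `χ` between the solution spaces (in the coordinates provided by two general solutions)
is induced by the contact transformation `Φ`: the transformed graph of the solution with parameter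
`a` is contained in the graph of the solution with parameter `χ a`. -/
def Induces {E E' : PDEPair} (Φ : ContactEquivalence E E') (S : GeneralSolution E)
    (S' : GeneralSolution E') (χ : Param → Param) : Prop :=
  ∀ w ∈ S.source, ∃ t' : Plane, (t', χ w.2) ∈ S'.source ∧
    Φ.lift (S.jet w) = S'.jet (t', χ w.2)

end PDEPairs

end

open Set
open scoped ContDiff

noncomputable section

namespace PDEPairs

open TopologicalSpace Filter Topology

/-! A tangent vector of the solution space at a solution is a solution of the linearized equations.
Along the surface it is given by four functions, the values of λ, ν₁, ν₂, ν₃. A quadratic form in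
these four functions descends to the parameter space up to scale exactly when its derivatives along
`D_x` and `D_y` are multiples of the form itself. For forms 2λ(aν₁ + bν₂ + (1 - R_sT_s)ν₃ + cλ) +
T_sν₁² - 2ν₁ν₂ + R_sν₂² this amounts first of all to four linear equations on a and b (`LowEqs`).
Two of them determine a and b when R_sT_s ≠ 4, which gives (A); the other two determine them when
R_sT_s ≠ 0, which gives (B). The four are compatible when J₁ = J₂ = 0 (`lowEqs_of_inv`). All
remaining conditions follow from the commutation of `D_x` and `D_y` (`LowEqs.remainders`), apart
from one equation, and that one fixes c.

Since 1 - R_sT_s ≠ 0, at each point at least one of R_sT_s ≠ 4 and R_sT_s ≠ 0 is secured by the sign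
of 1 - R_sT_s, so (A) and (B) glue to a form `canonForm` that is regular everywhere. For (B) at
points with R_sT_s = 4, invariance comes by continuity from nearby points, and genericity supplies
those. On a connected slice the form is then constant up to a positive factor
(`proportional_of_fderiv_eq`). Normalizing it gives a smooth metric on the parameters. Its signature
is read off by completing squares.

Contact invariance does not use the explicit formulas. A contact transformation multiplies λ by a
function, and on parameter directions λ is the differential of ψ. The metrics of the class are
forms, constant along each solution, for which this differential is null (`IsNullFor`). Conversely,
a nondegenerate symmetric form with this property on an open piece of a solution forces J₁ = J₂ = 0
there (`metricity_of_null`), and it is unique up to scale where R_sT_s ≠ 4 (`proportional_of_null`).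
Nullity is preserved by contact transformations, so the vanishing of J₁, J₂ and the conformal class
are preserved too.

General solutions exist because admissibility makes the fields `D_x`, `D_y` commute. Their joint
flow is the time-one map of a D_x + b D_y. It is obtained as a fixed point in the space of
continuous curves and depends smoothly on all data by the inverse function theorem
(`exists_smooth_integral`). -/

/-- The first derivatives of the right-hand sides of a pair of equations, as elements of a
commutative ring with two commuting derivations. -/
structure JetAlgebra (A : Type*) [CommRing A] [Algebra ℝ A] where
  dx : Derivation ℝ A A
  dy : Derivation ℝ A A
  comm : ∀ f, dx (dy f) = dy (dx f)
  rz : A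
  rp : A
  rq : A
  r : A
  tz : A
  tp : A
  tq : A
  t : A

/-! ### Differential algebra of the linearized equations along one solution. -/

namespace JetAlgebra

variable {A : Type*} [CommRing A] [Algebra ℝ A] (J : JetAlgebra A)

/-- A solution of the linearized pair of equations, with its jet. -/
structure IsVariation (f : Fin 4 → A) : Prop where
  dx0 : J.dx (f 0) = f 1
  dy0 : J.dy (f 0) = f 2
  dy1 : J.dy (f 1) = f 3
  dx1 : J.dx (f 1) = J.rz * f 0 + J.rp * f 1 + J.rq * f 2 + J.r * f 3
  dy2 : J.dy (f 2) = J.tz * f 0 + J.tp * f 1 + J.tq * f 2 + J.t * f 3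

/-- `1 - R_s T_s`. -/
def disc : A := 1 - J.r * J.t

/-- The coefficients of `(1 - R_s T_s) d(D_y R)`. -/
def kk : Fin 4 → A := ![
  (J.dy J.rz + J.tz * J.rq) + J.r * (J.dx J.tz + J.tp * J.rz),
  (J.dy J.rp + J.rq * J.tp) + J.r * (J.tz + J.dx J.tp + J.tp * J.rp),
  (J.rz + J.dy J.rq + J.rq * J.tq) + J.r * (J.dx J.tq + J.tp * J.rq),
  (J.rp + J.dy J.r + J.rq * J.t) + J.r * (J.tp * J.r + J.tq + J.dx J.t)]

/-- The coefficients of `(1 - R_s T_s) d(D_x T)`. -/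
def ll : Fin 4 → A := ![
  (J.dx J.tz + J.tp * J.rz) + J.t * (J.dy J.rz + J.tz * J.rq),
  (J.tz + J.dx J.tp + J.tp * J.rp) + J.t * (J.dy J.rp + J.rq * J.tp),
  (J.dx J.tq + J.tp * J.rq) + J.t * (J.rz + J.dy J.rq + J.rq * J.tq),
  (J.tp * J.r + J.tq + J.dx J.t) + J.t * (J.rp + J.dy J.r + J.rq * J.t)]

variable {J}

theorem IsVariation.dx2 {f : Fin 4 → A} (h : J.IsVariation f) : J.dx (f 2) = f 3 := by
  rw [← h.dy0, J.comm, h.dx0, h.dy1]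

/-- Since `f 3 = dy (f 1)`, commuting the derivations turns the left side into `dy` of the first
linearized equation, which contains `r * dy (f 3)`. The companion identity contains `t * dx (f 3)`.
Together they form a 2×2 linear system with determinant `disc`, the linearization of the implicit
definition of `D_y R` and `D_x T`. -/
theorem IsVariation.dx3_eq {f : Fin 4 → A} (h : J.IsVariation f) :
    J.dx (f 3) = (J.dy J.rz + J.tz * J.rq) * f 0 + (J.dy J.rp + J.rq * J.tp) * f 1
      + (J.rz + J.dy J.rq + J.rq * J.tq) * f 2 + (J.rp + J.dy J.r + J.rq * J.t) * f 3
      + J.r * J.dy (f 3) := by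
  conv_lhs => rw [← h.dy1, J.comm, h.dx1]
  simp only [map_add, Derivation.leibniz, smul_eq_mul, h.dy0, h.dy1, h.dy2]
  ring

theorem IsVariation.dy3_eq {f : Fin 4 → A} (h : J.IsVariation f) :
    J.dy (f 3) = (J.dx J.tz + J.tp * J.rz) * f 0 + (J.tz + J.dx J.tp + J.tp * J.rp) * f 1
      + (J.dx J.tq + J.tp * J.rq) * f 2 + (J.tp * J.r + J.tq + J.dx J.t) * f 3
      + J.t * J.dx (f 3) := by
  conv_lhs => rw [← h.dx2, ← J.comm, h.dy2]
  simp only [map_add, Derivation.leibniz, smul_eq_mul, h.dx0, h.dx1, h.dx2]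
  ring

theorem IsVariation.disc_dx3 {f : Fin 4 → A} (h : J.IsVariation f) :
    J.disc * J.dx (f 3) = J.kk 0 * f 0 + J.kk 1 * f 1 + J.kk 2 * f 2 + J.kk 3 * f 3 := by
  simp only [disc, kk, Matrix.cons_val]
  linear_combination h.dx3_eq + J.r * h.dy3_eq

theorem IsVariation.disc_dy3 {f : Fin 4 → A} (h : J.IsVariation f) :
    J.disc * J.dy (f 3) = J.ll 0 * f 0 + J.ll 1 * f 1 + J.ll 2 * f 2 + J.ll 3 * f 3 := by
  simp only [disc, ll, Matrix.cons_val]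
  linear_combination h.dy3_eq + J.t * h.dx3_eq

variable (J)

/-- `2 λ (a ν₁ + b ν₂ + (1 - R_s T_s) ν₃ + c λ) + T_s ν₁² - 2 ν₁ ν₂ + R_s ν₂²`. -/
def quad (a b c : A) (f : Fin 4 → A) : A :=
  2 * f 0 * (a * f 1 + b * f 2 + J.disc * f 3 + c * f 0) + J.t * f 1 ^ 2 - 2 * f 1 * f 2
    + J.r * f 2 ^ 2

/-- The factor of `D_x`-invariance. -/
def mux (b : A) : A := J.rp - J.t * J.rq - b

/-- The factor of `D_y`-invariance. -/
def muy (a : A) : A := J.tq - J.r * J.tp - a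

/-- The equations on the coefficients of `ω` that make the form invariant up to terms in
`λ ν₁`, `λ ν₂`, `λ²`. -/
structure LowEqs (a b : A) : Prop where
  x11 : 2 * a + J.dx J.t + 2 * J.t * J.rp = J.mux b * J.t
  x22 : J.dx J.r - 2 * J.rq = J.mux b * J.r
  y11 : J.dy J.t - 2 * J.tp = J.muy a * J.t
  y22 : 2 * b + J.dy J.r + 2 * J.r * J.tq = J.muy a * J.r

/-- Coefficients of linearly independent monomials can be read off from the values on the family
`f`. -/
def Separating {ι : Type*} (f : ι → Fin 4 → A) : Prop :=
  ∀ c00 c01 c02 c03 c11 c12 c22 : A, (∀ i, c00 * f i 0 ^ 2 + c01 * (f i 0 * f i 1)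
    + c02 * (f i 0 * f i 2) + c03 * (f i 0 * f i 3) + c11 * f i 1 ^ 2 + c12 * (f i 1 * f i 2)
    + c22 * f i 2 ^ 2 = 0) → 
    c00 = 0 ∧ c01 = 0 ∧ c02 = 0 ∧ c03 = 0 ∧ c11 = 0 ∧ c12 = 0 ∧ c22 = 0

/-- The coefficient of `2 λ ν₁` in the `D_x`-derivative of the form, modulo the form. -/
def x01 (a b c : A) : A := 2 * c + J.dx a + a * J.rp + J.kk 1 + J.t * J.rz - J.mux b * a

/-- The coefficient of `2 λ ν₂` in the `D_x`-derivative of the form, modulo the form. -/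
def x02 (a b : A) : A := J.dx b + a * J.rq + J.kk 2 - J.rz - J.mux b * b

/-- The coefficient of `λ²` in the `D_x`-derivative of the form, modulo the form. -/
def x00 (a b c : A) : A := 2 * (J.dx c + a * J.rz + J.kk 0) - 2 * J.mux b * c

/-- The coefficient of `2 λ ν₁` in the `D_y`-derivative of the form, modulo the form. -/
def y01 (a b : A) : A := J.dy a + b * J.tp + J.ll 1 - J.tz - J.muy a * a

/-- The coefficient of `2 λ ν₂` in the `D_y`-derivative of the form, modulo the form. -/
def y02 (a b c : A) : A := 2 * c + J.dy b + b * J.tq + J.ll 2 + J.r * J.tz - J.muy a * b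

/-- The coefficient of `λ²` in the `D_y`-derivative of the form, modulo the form. -/
def y00 (a b c : A) : A := 2 * (J.dy c + b * J.tz + J.ll 0) - 2 * J.muy a * c

variable {J} {a b c : A}

/-- The coefficient `disc` of λν₃ makes ν₁ν₃ cancel, and ν₂ν₃ cancels by itself. The value of `mux`
is the one that matches ν₁ν₂. The equations `x11` and `x22` match ν₁² and ν₂², and λν₃ follows from
`y22` and `x22`. Only multiples of λν₁, λν₂ and λ² are left over. -/
theorem LowEqs.dx_quad (h : J.LowEqs a b) {f : Fin 4 → A} (hf : J.IsVariation f) :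
    J.dx (J.quad a b c f) = J.mux b * J.quad a b c f
      + (2 * J.x01 a b c * (f 0 * f 1) + 2 * J.x02 a b * (f 0 * f 2)
        + J.x00 a b c * f 0 ^ 2) := by
  have hd : J.dx (J.disc * f 3) = J.disc * J.dx (f 3) - (J.r * J.dx J.t + J.t * J.dx J.r) * f 3 := by
    simp only [disc, Derivation.leibniz, map_sub, Derivation.map_one_eq_zero, smul_eq_mul]
    ring
  have h2 : J.dx (2 : A) = 0 := by exact_mod_cast J.dx.map_natCast 2
  simp only [quad, map_add, map_sub, hd, h2, hf.disc_dx3, Derivation.leibniz, smul_eq_mul, hf.dx0,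
    hf.dx1, hf.dx2, Derivation.leibniz_pow, nsmul_eq_mul, x01, x02, x00]
  have e1 := h.x11
  have e2 := h.x22
  have e3 := h.y22
  simp only [mux, muy, kk, disc, Matrix.cons_val] at *
  push_cast
  linear_combination f 1 ^ 2 * e1 + f 2 ^ 2 * e2 + 2 * f 0 * f 3 * (e3 - J.t * e2)

theorem LowEqs.dy_quad (h : J.LowEqs a b) {f : Fin 4 → A} (hf : J.IsVariation f) :
    J.dy (J.quad a b c f) = J.muy a * J.quad a b c f
      + (2 * J.y01 a b * (f 0 * f 1) + 2 * J.y02 a b c * (f 0 * f 2)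
        + J.y00 a b c * f 0 ^ 2) := by
  have hd : J.dy (J.disc * f 3) = J.disc * J.dy (f 3) - (J.r * J.dy J.t + J.t * J.dy J.r) * f 3 := by
    simp only [disc, Derivation.leibniz, map_sub, Derivation.map_one_eq_zero, smul_eq_mul]
    ring
  have h2 : J.dy (2 : A) = 0 := by exact_mod_cast J.dy.map_natCast 2
  simp only [quad, map_add, map_sub, hd, h2, hf.disc_dy3, Derivation.leibniz, smul_eq_mul, hf.dy0,
    hf.dy1, hf.dy2, Derivation.leibniz_pow, nsmul_eq_mul, y01, y02, y00]
  have e1 := h.y11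
  have e2 := h.y22
  have e3 := h.x11
  simp only [mux, muy, ll, disc, Matrix.cons_val] at *
  push_cast
  linear_combination f 1 ^ 2 * e1 + f 2 ^ 2 * e2 + 2 * f 0 * f 3 * (e3 - J.r * e1)

theorem eq_zero_of_two_mul_eq_zero {z : A} (hz : 2 * z = 0) : z = 0 := by
  have h : (2 : ℝ) • z = 0 := by rw [two_smul, ← two_mul, hz]
  rw [← inv_smul_smul₀ (two_ne_zero (α := ℝ)) z, h, smul_zero]

/-- Most of the remainders vanish because the two derivations commute. -/
theorem LowEqs.remainders (h : J.LowEqs a b) {ι : Type*} {f : ι → Fin 4 → A}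
    (hf : ∀ i, J.IsVariation (f i)) (hsep : Separating f) (hdisc : IsUnit J.disc) (c : A) :
    J.x02 a b = 0 ∧ J.y01 a b = 0 ∧ J.x01 a b c = J.y02 a b c ∧
      (J.y02 a b c = 0 → J.x00 a b c = 0 ∧ J.y00 a b c = 0) := by
  have h2x : J.dx (2 : A) = 0 := by exact_mod_cast J.dx.map_natCast 2
  have h2y : J.dy (2 : A) = 0 := by exact_mod_cast J.dy.map_natCast 2
  have cancel2 : ∀ {z : A}, 2 * z = 0 → z = 0 := eq_zero_of_two_mul_eq_zero
  obtain ⟨u, hu⟩ := hdisc.exists_left_inv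
  set κ := J.dy (J.mux b) - J.dx (J.muy a) with hκ
  -- Both orders of differentiation are expanded with the two invariance formulas. Their difference
  -- is a quadratic form in the variation, so each of its seven coefficients must vanish. Here κ is
  -- the curvature of the factors of invariance.
  have key : ∀ i, J.dx (J.dy (J.quad a b c (f i))) = J.dy (J.dx (J.quad a b c (f i))) :=
    fun i => J.comm _
  -- the coefficients of the commutator
  have hc := hsep (J.dx (J.y00 a b c) - J.dy (J.x00 a b c) - κ * (2 * c)
      - (J.mux b * J.y00 a b c - J.muy a * J.x00 a b c)
      + 2 * J.y01 a b * J.rz - 2 * J.x02 a b * J.tz)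
    (2 * J.y00 a b c + 2 * J.dx (J.y01 a b) - 2 * J.dy (J.x01 a b c) - κ * (2 * a)
      - (J.mux b * (2 * J.y01 a b) - J.muy a * (2 * J.x01 a b c))
      + 2 * J.y01 a b * J.rp - 2 * J.x02 a b * J.tp)
    (- 2 * J.x00 a b c - 2 * J.dy (J.x02 a b) + 2 * J.dx (J.y02 a b c) - κ * (2 * b)
      - (J.mux b * (2 * J.y02 a b c) - J.muy a * (2 * J.x02 a b))
      + 2 * J.y01 a b * J.rq - 2 * J.x02 a b * J.tq)
    (2 * J.y01 a b * J.r + 2 * J.y02 a b c - 2 * J.x01 a b c - 2 * J.x02 a b * J.t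
      - κ * (2 * J.disc))
    (2 * J.y01 a b - κ * J.t)
    (2 * J.y02 a b c - 2 * J.x01 a b c + 2 * κ)
    (- 2 * J.x02 a b - κ * J.r) (fun i => by
      have hk := key i
      rw [h.dx_quad (hf i), h.dy_quad (hf i)] at hk
      simp only [map_add, Derivation.leibniz, smul_eq_mul, h.dx_quad (hf i), h.dy_quad (hf i),
        Derivation.leibniz_pow, nsmul_eq_mul, h2x, h2y, (hf i).dx0, (hf i).dx1, (hf i).dx2,
        (hf i).dy0, (hf i).dy1, (hf i).dy2] at hk
      rw [hκ]
      simp only [quad] at hk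
      push_cast at hk
      linear_combination hk)
  obtain ⟨h00, h01, h02, h03, h11, h12, h22⟩ := hc
  -- In this combination of the coefficients of ν₁ν₂, λν₃, ν₁² and ν₂² the remainders cancel and 4
  -- `disc` κ survives.
  have hκ0 : κ = 0 := by
    have hκ4 : 2 * (2 * (J.disc * κ)) = 0 := by
      have hd : J.disc = 1 - J.r * J.t := rfl
      linear_combination h12 - h03 + J.r * h11 + J.t * h22 + 2 * κ * hd
    have := cancel2 (cancel2 hκ4)
    linear_combination u * this - κ * hu
  rw [hκ0] at h11 h12 h22 h00 h01 h02
  have y01 : J.y01 a b = 0 := cancel2 (by linear_combination h11)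
  have x02 : J.x02 a b = 0 := cancel2 (by linear_combination -h22)
  have x01 : J.x01 a b c = J.y02 a b c := by
    rw [← sub_eq_zero]
    exact cancel2 (by linear_combination -h12)
  refine ⟨x02, y01, x01, fun hy => ?_⟩
  -- Once all remainders in λν₁ and λν₂ vanish, the commutator coefficients of λν₁ and λν₂ reduce to
  -- 2 `y00` and -2 `x00`.
  simp only [y01, x02, x01, hy, map_zero] at h01 h02
  exact ⟨cancel2 (by linear_combination -h02), cancel2 (by linear_combination h01)⟩

theorem LowEqs.quad_parallel (h : J.LowEqs a b) {ι : Type*} {f : ι → Fin 4 → A}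
    (hf : ∀ i, J.IsVariation (f i)) (hsep : Separating f) (hdisc : IsUnit J.disc)
    (hy : J.y02 a b c = 0) (i : ι) :
    J.dx (J.quad a b c (f i)) = J.mux b * J.quad a b c (f i) ∧
      J.dy (J.quad a b c (f i)) = J.muy a * J.quad a b c (f i) := by
  obtain ⟨h1, h2, h3, h4⟩ := h.remainders hf hsep hdisc c
  rw [h.dx_quad (hf i), h.dy_quad (hf i), h3, h1, h2, (h4 hy).1, (h4 hy).2, hy]
  constructor <;> ring

variable (J) in
/-- The expression `J₁`. -/
def inv1 : A := (J.r * J.t - 4) * J.dx J.r + J.r * (2 * J.dy J.r - J.r * J.dx J.t)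
    + 8 * J.rq - 6 * J.rq * J.r * J.t + 4 * J.rp * J.r
    + 2 * J.r ^ 2 * J.tq - 2 * J.rp * J.r ^ 2 * J.t + 2 * J.r ^ 3 * J.tp

variable (J) in
/-- The expression `J₂`. -/
def inv2 : A := (J.r * J.t - 4) * J.dy J.t + J.t * (2 * J.dx J.t - J.t * J.dy J.r)
    + 8 * J.tp - 6 * J.r * J.tp * J.t + 4 * J.tq * J.t
    + 2 * J.rp * J.t ^ 2 - 2 * J.r * J.tq * J.t ^ 2 + 2 * J.rq * J.t ^ 3

variable (J) in
/-- The coefficient of `ν₁` in `ω`. -/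
def om1 : A := 4 * J.dx J.t - 2 * J.t * J.dy J.r + 4 * J.rp * J.t - 2 * J.r ^ 2 * J.tp * J.t
    - 2 * J.r * J.tq * J.t + 4 * J.rq * J.t ^ 2

variable (J) in
/-- The coefficient of `ν₂` in `ω`. -/
def om2 : A := 4 * J.dy J.r - 2 * J.r * J.dx J.t + 4 * J.r * J.tq - 2 * J.rq * J.r * J.t ^ 2
    - 2 * J.rp * J.r * J.t + 4 * J.r ^ 2 * J.tp

variable (J) in
/-- Twice the coefficient of `λ` in `ω`. -/
def twoV : A :=
  8 * J.dx J.tq - 4 * J.dy (J.dy J.r) + 4 * J.dx J.t * J.dy J.r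
    + 4 * J.r * J.dx J.tp - 4 * J.r * J.dy J.tq - 4 * J.r ^ 2 * J.dy J.tp
    + 8 * J.rq * J.tp - 14 * J.r * J.tp * J.dy J.r + 4 * J.rp * J.r * J.tp
    + 3 * J.r ^ 2 * J.tp * J.dx J.t - 6 * J.r ^ 3 * J.tp ^ 2
    - 4 * J.tq * J.dy J.r + 4 * J.r * J.tq * J.dx J.t
    - 6 * J.r ^ 2 * J.tp * J.tq + 8 * J.t * J.dy J.rq
    - 2 * (J.dy J.r) ^ 2 * J.t + 4 * J.rp * J.t * J.dy J.r
    - 2 * J.r * J.t * J.dx J.tq + J.r * J.t * J.dy (J.dy J.r)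
    + 4 * J.r * J.t * J.dy J.rp - J.r ^ 2 * J.t * J.dx J.tp
    + J.r ^ 2 * J.t * J.dy J.tq + J.r ^ 3 * J.t * J.dy J.tp
    + 8 * J.rz * J.t + 2 * J.rq * J.r * J.tp * J.t
    + 2 * J.rp * J.r ^ 2 * J.tp * J.t + 8 * J.rq * J.tq * J.t
    - 3 * J.r * J.tq * J.t * J.dy J.r + 4 * J.rp * J.r * J.tq * J.t
    - 2 * J.r ^ 3 * J.tp * J.tq * J.t - 2 * J.r ^ 2 * J.tq ^ 2 * J.t
    + 4 * J.rq * J.t ^ 2 * J.dy J.r - 2 * J.r * J.t ^ 2 * J.dy J.rq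
    - J.r ^ 2 * J.t ^ 2 * J.dy J.rp - 2 * J.r * J.rz * J.t ^ 2
    + 2 * J.rq * J.r ^ 2 * J.tp * J.t ^ 2 + 2 * J.rq * J.r * J.tq * J.t ^ 2
    + 8 * J.r * J.tz - 2 * J.r ^ 2 * J.t * J.tz

variable (J) in
/-- The numerator of the coefficient of `λ` in `ω'`. -/
def vPrime : A :=
  2 * J.r ^ 2 * J.dx J.r * J.dy J.t - 4 * J.rq * J.r ^ 2 * J.dy J.t
    - J.rp * J.r ^ 3 * J.dy J.t - 4 * J.r ^ 2 * J.tp * J.dx J.r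
    + 8 * J.rq * J.r ^ 2 * J.tp + 2 * J.rp * J.r ^ 3 * J.tp
    + 2 * (J.dx J.r) ^ 2 * J.t - 8 * J.rq * J.t * J.dx J.r
    + 8 * J.rq ^ 2 * J.t - 2 * J.rp * J.r * J.t * J.dx J.r
    + 4 * J.rp * J.rq * J.r * J.t - J.r ^ 2 * J.t * J.dx (J.dy J.r)
    + 2 * J.r ^ 2 * J.t * J.dy J.rq + J.r ^ 3 * J.t * J.dx J.tq
    + J.r ^ 3 * J.t * J.dy J.rp - J.rq * J.r ^ 3 * J.tp * J.t
    - 3 * J.r ^ 2 * J.tq * J.t * J.dx J.r + 6 * J.rq * J.r ^ 2 * J.tq * J.t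
    + J.rp * J.r ^ 3 * J.tq * J.t + 2 * J.rq * J.r * J.t ^ 2 * J.dx J.r
    - 4 * J.rq ^ 2 * J.r * J.t ^ 2 + J.r ^ 3 * J.rz * J.t ^ 2
    + J.r ^ 4 * J.t * J.tz

/-- The equations `x11` and `y22` form a linear system for a, b with determinant 4 - R_sT_s; it is
solved by `om1` and `om2` over 2(R_sT_s - 4). Substituting the solution into `x22` and `y11` leaves
multiples of J₁ and J₂. -/
theorem lowEqs_of_inv (h1 : J.inv1 = 0) (h2 : J.inv2 = 0) (hu : IsUnit (J.r * J.t - 4))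
    (ha : 2 * (J.r * J.t - 4) * a = J.om1) (hb : 2 * (J.r * J.t - 4) * b = J.om2) :
    J.LowEqs a b := by
  obtain ⟨u, hu⟩ := hu.exists_left_inv
  have key : ∀ {z : A}, (J.r * J.t - 4) * (2 * z) = 0 → z = 0 := fun {z} hz =>
    eq_zero_of_two_mul_eq_zero (by linear_combination u * hz - 2 * z * hu)
  unfold inv1 at h1
  unfold inv2 at h2
  unfold om1 at ha
  unfold om2 at hb
  constructor <;> simp only [mux, muy]
  all_goals rw [← sub_eq_zero]; apply key
  · linear_combination 2 * ha + J.t * hb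
  · linear_combination 2 * h1 + J.r * hb
  · linear_combination 2 * h2 + J.t * ha
  · linear_combination 2 * hb + J.r * ha

/-- The equation `y02 = 0` defines c once `dy b` is known. Differentiating `y22` along y gives `dy
b` in terms of `dy a`, and `y01 = 0` gives `dy a`; this is how the second derivative of R_s enters
`twoV`. -/
theorem LowEqs.y02_eq_zero (h : J.LowEqs a b) (hu : IsUnit (J.r * J.t - 4))
    (ha : 2 * (J.r * J.t - 4) * a = J.om1) (hb : 2 * (J.r * J.t - 4) * b = J.om2)
    (hc : 4 * (J.r * J.t - 4) * c = J.twoV) (hy : J.y01 a b = 0) : J.y02 a b c = 0 := by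
  obtain ⟨u, hu⟩ := hu.exists_left_inv
  have key : ∀ {z : A}, 2 * ((J.r * J.t - 4) * (2 * z)) = 0 → z = 0 := fun {z} hz => by
    have hz := eq_zero_of_two_mul_eq_zero hz
    exact eq_zero_of_two_mul_eq_zero (by linear_combination u * hz - 2 * z * hu)
  have h2y : J.dy (2 : A) = 0 := by exact_mod_cast J.dy.map_natCast 2
  have e := congrArg J.dy h.y22
  simp only [muy, map_add, map_sub, Derivation.leibniz, smul_eq_mul, h2y] at e
  apply key
  unfold y01 at hy
  unfold y02
  have e5 := h.y22
  unfold om1 at ha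
  unfold om2 at hb
  unfold twoV at hc
  simp only [muy, ll, Matrix.cons_val] at *
  linear_combination 2 * hc + 2 * (J.r * J.t - 4) * (e - J.r * hy)
    - 2 * (J.tq - J.r * J.tp - a) * (J.r * J.t - 4) * e5
    - (2 * J.dy J.r + J.r * J.tq + J.r ^ 2 * J.tp) * ha + (2 * J.tq + J.r * J.tp) * hb

/-- The same equation for c, with `dy b` now taken from the explicit formula (B) for b. The
derivative `dy (dx r)` that appears is turned into `dx (dy r)` to match `vPrime`. -/
theorem LowEqs.y02_eq_zero' (h : J.LowEqs a b) (hr : IsUnit J.r) (ht : IsUnit J.t)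
    (ha : J.t * a = -J.dy J.t + 2 * J.tp - J.r * J.tp * J.t + J.tq * J.t)
    (hb : J.r * b = -J.dx J.r + 2 * J.rq - J.rq * J.r * J.t + J.rp * J.r)
    (hc : 2 * J.r ^ 3 * J.t * c = -J.vPrime) : J.y02 a b c = 0 := by
  obtain ⟨u, hu⟩ := hr.exists_left_inv
  obtain ⟨v, hv⟩ := ht.exists_left_inv
  have key : ∀ {z : A}, J.r ^ 3 * J.t * z = 0 → z = 0 := fun {z} hz => by
    have : (u * J.r) ^ 3 * (v * J.t) * z = 0 := by linear_combination u ^ 3 * v * hz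
    simpa [hu, hv] using this
  have h2y : J.dy (2 : A) = 0 := by exact_mod_cast J.dy.map_natCast 2
  have e := congrArg J.dy hb
  simp only [map_add, map_sub, map_neg, Derivation.leibniz, smul_eq_mul, h2y, ← J.comm] at e
  apply key
  unfold y02
  have e5 := h.y22
  unfold vPrime at hc
  simp only [muy, ll, Matrix.cons_val] at *
  linear_combination hc + J.r ^ 2 * J.t * e + J.r ^ 2 * J.t * (J.rp - J.t * J.rq - b) * e5
    + (2 * J.r ^ 2 * J.t * a + 2 * J.t * (J.r * b + (-J.dx J.r + 2 * J.rq - J.rq * J.r * J.t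
        + J.rp * J.r)) + J.r * J.t * (J.r * J.tq + 2 * J.r ^ 2 * J.tp - 2 * J.rp
        + 2 * J.t * J.rq)) * hb
    + (2 * J.r ^ 2 * (-J.dx J.r + 2 * J.rq - J.rq * J.r * J.t + J.rp * J.r)
        - J.r ^ 3 * (J.rp - J.t * J.rq)) * ha

end JetAlgebra

/-! ### Inverse forms with null differential: necessity of J₁ = J₂ = 0, and uniqueness. -/

namespace JetAlgebra

variable {A : Type*} [CommRing A] [Algebra ℝ A] {ι : Type*} [Fintype ι]

/-- The pairing of covector fields given by a constant matrix. -/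
def pairing (M : Matrix ι ι ℝ) (u v : ι → A) : A := ∑ i, ∑ j, M i j • (u i * v j)

theorem pairing_comm {M : Matrix ι ι ℝ} (hM : M.IsSymm) (u v : ι → A) :
    pairing M u v = pairing M v u := by
  unfold pairing
  rw [Finset.sum_comm]
  refine Finset.sum_congr rfl fun i _ => Finset.sum_congr rfl fun j _ => ?_
  rw [hM.apply, mul_comm]

theorem derivation_pairing (d : Derivation ℝ A A) (M : Matrix ι ι ℝ) (u v : ι → A) :
    d (pairing M u v) = pairing M (fun i => d (u i)) v + pairing M u (fun i => d (v i)) := by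
  simp only [pairing, map_sum, Derivation.map_smul, Derivation.leibniz, smul_eq_mul, smul_add,
    Finset.sum_add_distrib]
  rw [add_comm]
  congr 1
  simp only [mul_comm]

theorem pairing_combination (M : Matrix ι ι ℝ) (u v : ι → A) (c : Fin 4 → A) (w : Fin 4 → ι → A)
    (h : ∀ i, v i = c 0 * w 0 i + c 1 * w 1 i + c 2 * w 2 i + c 3 * w 3 i) :
    pairing M u v = c 0 * pairing M u (w 0) + c 1 * pairing M u (w 1) + c 2 * pairing M u (w 2)
      + c 3 * pairing M u (w 3) := by
  simp only [pairing, h, Finset.mul_sum, ← Finset.sum_add_distrib, mul_smul_comm, ← smul_add]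
  refine Finset.sum_congr rfl fun i _ => Finset.sum_congr rfl fun j _ => ?_
  congr 1
  ring

theorem pairing_mul_left (M : Matrix ι ι ℝ) (u v : ι → A) (c : A) :
    pairing M u (fun i => c * v i) = c * pairing M u v := by
  simp only [pairing, Finset.mul_sum, mul_smul_comm]
  refine Finset.sum_congr rfl fun i _ => Finset.sum_congr rfl fun j _ => ?_
  congr 1
  ring

variable {J : JetAlgebra A} {f : ι → Fin 4 → A} {M : Matrix ι ι ℝ}

/-- The components of a constant symmetric pairing for which the variation of the solution is
null. -/
structure NullPairing (J : JetAlgebra A) (H : Fin 4 → Fin 4 → A) : Prop where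
  symm : ∀ i j, H i j = H j i
  h00 : H 0 0 = 0
  h01 : H 0 1 = 0
  h02 : H 0 2 = 0
  h11 : H 1 1 = -J.r * H 0 3
  h12 : H 1 2 = -H 0 3
  h22 : H 2 2 = -J.t * H 0 3
  x11 : J.r * H 1 3 - J.r ^ 2 * H 2 3
    = H 0 3 * (-J.dx J.r + J.r * J.rp - J.r * J.t * J.rq + 2 * J.rq)
  y22 : J.t * H 2 3 - J.t ^ 2 * H 1 3
    = H 0 3 * (-J.dy J.t + J.t * J.tq - J.r * J.t * J.tp + 2 * J.tp)
  x22 : (J.r * J.t - 2) * H 2 3 + J.t * H 1 3 = H 0 3 * (J.dx J.t + J.t * J.rp + J.t ^ 2 * J.rq)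
  y11 : (J.r * J.t - 2) * H 1 3 + J.r * H 2 3 = H 0 3 * (J.dy J.r + J.r ^ 2 * J.tp + J.r * J.tq)
  dx03 : J.dx (H 0 3) = (J.rp + J.t * J.rq) * H 0 3 - J.r * H 2 3 - H 1 3
  h33 : J.disc * H 3 3 = J.disc * J.dx (H 2 3) + H 0 3 * (J.kk 1 + J.t * J.kk 2) - J.kk 3 * H 2 3

/-- The matrix is constant, so the relation `H 0 0 = 0` may be differentiated along the solution
repeatedly. Two differentiations give all entries except those with a second index 3. A third gives
six relations; two of them express the derivatives of `H 0 3`, and eliminating these leaves four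
relations between `H 1 3`, `H 2 3` and `H 0 3`. Differentiating `H 2 3` gives `H 3 3`. -/
theorem nullPairing (hf : ∀ i, J.IsVariation (f i)) (hM : M.IsSymm)
    (h00 : pairing M (fun i => f i 0) (fun i => f i 0) = 0) :
    J.NullPairing (fun k l => pairing M (fun i => f i k) (fun i => f i l)) := by
  set F : Fin 4 → ι → A := fun k i => f i k with hF
  set H : Fin 4 → Fin 4 → A := fun k l => pairing M (F k) (F l) with hH
  have symm : ∀ k l, H k l = H l k := fun k l => pairing_comm hM _ _
  have expand : ∀ (d : Derivation ℝ A A) k l, d (H k l)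
      = pairing M (F l) (fun i => d (F k i)) + pairing M (F k) (fun i => d (F l i)) := by
    intro d k l
    rw [hH, derivation_pairing, pairing_comm hM (fun i => d (F k i))]
  have dx0 : (fun i => J.dx (F 0 i)) = F 1 := funext fun i => (hf i).dx0
  have dy0 : (fun i => J.dy (F 0 i)) = F 2 := funext fun i => (hf i).dy0
  have dy1 : (fun i => J.dy (F 1 i)) = F 3 := funext fun i => (hf i).dy1
  have dx2 : (fun i => J.dx (F 2 i)) = F 3 := funext fun i => (hf i).dx2
  have dx1 : ∀ k, pairing M (F k) (fun i => J.dx (F 1 i))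
      = J.rz * H k 0 + J.rp * H k 1 + J.rq * H k 2 + J.r * H k 3 := fun k =>
    pairing_combination M (F k) _ ![J.rz, J.rp, J.rq, J.r] F fun i => (hf i).dx1
  have dy2 : ∀ k, pairing M (F k) (fun i => J.dy (F 2 i))
      = J.tz * H k 0 + J.tp * H k 1 + J.tq * H k 2 + J.t * H k 3 := fun k =>
    pairing_combination M (F k) _ ![J.tz, J.tp, J.tq, J.t] F fun i => (hf i).dy2
  have dx3 : ∀ k, J.disc * pairing M (F k) (fun i => J.dx (F 3 i))
      = J.kk 0 * H k 0 + J.kk 1 * H k 1 + J.kk 2 * H k 2 + J.kk 3 * H k 3 := fun k => by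
    rw [← pairing_mul_left]
    exact pairing_combination M (F k) _ J.kk F fun i => (hf i).disc_dx3
  have p : ∀ k l, pairing M (F k) (F l) = H k l := fun k l => rfl
  have e00 : H 0 0 = 0 := h00
  have e01 : H 0 1 = 0 := eq_zero_of_two_mul_eq_zero (by
    have h := expand J.dx 0 0
    rw [e00, map_zero, dx0, p] at h
    linear_combination -h)
  have e02 : H 0 2 = 0 := eq_zero_of_two_mul_eq_zero (by
    have h := expand J.dy 0 0
    rw [e00, map_zero, dy0, p] at h
    linear_combination -h)
  have e11 : H 1 1 = -J.r * H 0 3 := by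
    have h := expand J.dx 0 1
    rw [e01, map_zero, dx0, dx1, p] at h
    linear_combination -h - J.rz * e00 - J.rp * e01 - J.rq * e02
  have e12 : H 1 2 = -H 0 3 := by
    have h := expand J.dy 0 1
    rw [e01, map_zero, dy0, dy1, p, p] at h
    linear_combination -h
  have e22 : H 2 2 = -J.t * H 0 3 := by
    have h := expand J.dy 0 2
    rw [e02, map_zero, dy0, dy2, p] at h
    linear_combination -h - J.tz * e00 - J.tp * e01 - J.tq * e02
  have x12 := expand J.dx 1 2
  rw [e12, map_neg, dx1, dx2, p, symm 2 0, symm 2 1, e02, e12, e22] at x12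
  have y12 := expand J.dy 1 2
  rw [e12, map_neg, dy1, dy2, p, symm 1 0, e01, e12, e11] at y12
  have x11 := expand J.dx 1 1
  rw [e11, dx1, symm 1 0, e01, e12, e11, Derivation.leibniz, map_neg] at x11
  have x22 := expand J.dx 2 2
  rw [e22, dx2, p, Derivation.leibniz, map_neg] at x22
  have y11 := expand J.dy 1 1
  rw [e11, dy1, p, Derivation.leibniz, map_neg] at y11
  have y22 := expand J.dy 2 2
  rw [e22, dy2, symm 2 0, symm 2 1, e02, e12, e22, Derivation.leibniz, map_neg] at y22
  have x23 := expand J.dx 2 3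
  rw [dx2, p] at x23
  have d3 := dx3 2
  rw [symm 2 0, symm 2 1, e02, e12, e22] at d3
  simp only [smul_eq_mul] at x11 x22 y11 y22
  refine ⟨symm, e00, e01, e02, e11, e12, e22, ?_, ?_, ?_, ?_, ?_, ?_⟩
  · linear_combination -x11 + J.r * x12
  · linear_combination -y22 + J.t * y12
  · linear_combination x22 - J.t * x12
  · linear_combination y11 - J.r * y12
  · linear_combination -x12
  · linear_combination -J.disc * x23 - d3

variable {H : Fin 4 → Fin 4 → A}

/-- Four linear relations constrain two unknowns `H 1 3`, `H 2 3`. Each invariant, multiplied by `H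
0 3`, is a combination of three of them in which the unknowns cancel. -/
theorem NullPairing.inv_eq_zero (h : J.NullPairing H) (hm : IsUnit (H 0 3)) :
    J.inv1 = 0 ∧ J.inv2 = 0 := by
  obtain ⟨u, hu⟩ := hm.exists_left_inv
  have key : ∀ {z : A}, H 0 3 * z = 0 → z = 0 := fun {z} hz => by
    linear_combination u * hz - z * hu
  constructor <;> apply key
  · unfold inv1
    linear_combination -(4 - J.r * J.t) * h.x11 + J.r ^ 2 * h.x22 - 2 * J.r * h.y11
  · unfold inv2
    linear_combination -(4 - J.r * J.t) * h.y22 + J.t ^ 2 * h.y11 - 2 * J.t * h.x22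

/-- Null pairings are unique up to a factor. -/
theorem exists_nullPairing_eq (J : JetAlgebra A) (hd : IsUnit J.disc)
    (hu : IsUnit (J.r * J.t - 4)) :
    ∃ N : Fin 4 → Fin 4 → A, ∀ H, J.NullPairing H → ∀ i j, H i j = H 0 3 * N i j := by
  obtain ⟨d, hd⟩ := hd.exists_left_inv
  obtain ⟨u, hu⟩ := hu.exists_left_inv
  set p : A := J.dx J.t + J.t * J.rp + J.t ^ 2 * J.rq with hp
  set q : A := J.dy J.r + J.r ^ 2 * J.tp + J.r * J.tq with hq
  -- Cramer's rule for `x22` and `y11` in the unknowns `H 1 3`, `H 2 3`. The determinant is (rt -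
  -- 2)² - rt = (rt - 1)(rt - 4), with inverse `-d * u`. The value `e` below comes from `h33`, with
  -- the derivative of `H 0 3` replaced through `dx03`.
  set b : A := - d * u * ((J.r * J.t - 2) * q - J.r * p)
    with hb
  set c : A := - d * u * ((J.r * J.t - 2) * p - J.t * q) with hc
  set e : A := J.dx c + c * (J.rp + J.t * J.rq - J.r * c - b) + d * (J.kk 1 + J.t * J.kk 2)
    - d * J.kk 3 * c with he
  refine ⟨![![0, 0, 0, 1], ![0, -J.r, -1, b], ![0, -1, -J.t, c], ![1, b, c, e]], fun H h => ?_⟩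
  have hdisc : J.disc = 1 - J.r * J.t := rfl
  have h13 : H 1 3 = H 0 3 * b := by
    rw [hb]
    linear_combination -d * u * ((J.r * J.t - 2) * h.y11 - J.r * h.x22)
      + (d * (u * (J.r * J.t - 4))) * H 1 3 * hdisc
      - H 1 3 * hd - H 1 3 * d * J.disc * hu
  have h23 : H 2 3 = H 0 3 * c := by
    rw [hc]
    linear_combination -d * u * ((J.r * J.t - 2) * h.x22 - J.t * h.y11)
      + (d * (u * (J.r * J.t - 4))) * H 2 3 * hdisc
      - H 2 3 * hd - H 2 3 * d * J.disc * hu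
  have h33 : H 3 3 = H 0 3 * e := by
    have h1 := h.h33
    have h2 := h.dx03
    rw [h23, Derivation.leibniz, smul_eq_mul, smul_eq_mul] at h1
    rw [h13, h23] at h2
    rw [he]
    linear_combination d * h1 - H 3 3 * hd + (H 0 3 * J.dx c + c * J.dx (H 0 3)) * hd + c * h2
  intro i j
  fin_cases i <;> fin_cases j <;>
    simp [h.h00, h.h01, h.h02, h.h11, h.h12, h.h22, h.symm 1 0, h.symm 2 0, h.symm 2 1,
      h.symm 3 0, h.symm 3 1, h.symm 3 2, h13, h23, h33, mul_comm]

end JetAlgebra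

/-! ### Smooth functions on an open set as a ring with commuting derivations. -/

section SecondDerivatives

variable {V F : Type*} [NormedAddCommGroup V] [NormedSpace ℝ V] [NormedAddCommGroup F]
  [NormedSpace ℝ F] {W : Set V} {g : V → F}

theorem contDiffOn_fderiv_apply (hW : IsOpen W) (hg : ContDiffOn ℝ ∞ g W) (e : V) :
    ContDiffOn ℝ ∞ (fun w => fderiv ℝ g w e) W :=
  (hg.fderiv_of_isOpen hW (by simp)).clm_apply contDiffOn_const

theorem hasFDerivAt_of_contDiffOn (hW : IsOpen W) (hg : ContDiffOn ℝ ∞ g W) {w : V} (hw : w ∈ W) :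
    HasFDerivAt g (fderiv ℝ g w) w :=
  ((hg.contDiffAt (hW.mem_nhds hw)).differentiableAt (by simp)).hasFDerivAt

theorem fderiv_fderiv_comm (hW : IsOpen W) (hg : ContDiffOn ℝ ∞ g W) {w : V} (hw : w ∈ W)
    (e e' : V) : fderiv ℝ (fun w => fderiv ℝ g w e) w e' = fderiv ℝ (fun w => fderiv ℝ g w e') w e := by
  have h := (hg.contDiffAt (hW.mem_nhds hw)).isSymmSndFDerivAt
    (by rw [minSmoothness_of_isRCLikeNormedField]; exact WithTop.coe_le_coe.2 le_top)
  have hd : DifferentiableAt ℝ (fderiv ℝ g) w :=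
    ((hg.fderiv_of_isOpen (m := ∞) hW (by simp)).contDiffAt (hW.mem_nhds hw)).differentiableAt
      (by simp)
  have key : ∀ d d' : V, fderiv ℝ (fun w => fderiv ℝ g w d) w d' = fderiv ℝ (fderiv ℝ g) w d' d := by
    intro d d'
    rw [fderiv_clm_apply hd (differentiableAt_const d)]
    simp
  rw [key, key, h.eq]

end SecondDerivatives

variable {P : Type*} [NormedAddCommGroup P] [NormedSpace ℝ P]

/-- The ring of smooth functions on an open set. -/
def smoothOn (U : Opens P) : Subalgebra ℝ (U → ℝ) where
  carrier := {f | ∃ F : P → ℝ, ContDiffOn ℝ ∞ F U ∧ ∀ x : U, f x = F x}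
  mul_mem' := by
    rintro f g ⟨F, hF, hf⟩ ⟨G, hG, hg⟩
    exact ⟨_, hF.mul hG, fun x => by simp [hf, hg]⟩
  add_mem' := by
    rintro f g ⟨F, hF, hf⟩ ⟨G, hG, hg⟩
    exact ⟨_, hF.add hG, fun x => by simp [hf, hg]⟩
  algebraMap_mem' := fun c => ⟨fun _ => c, contDiffOn_const, fun _ => rfl⟩

namespace smoothOn

variable {U : Opens P}

/-- The element of the ring given by a smooth function. -/
def of (U : Opens P) (F : P → ℝ) (hF : ContDiffOn ℝ ∞ F U) : smoothOn U :=
  ⟨fun x => F x, F, hF, fun _ => rfl⟩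

@[simp] theorem of_apply (F : P → ℝ) (hF : ContDiffOn ℝ ∞ F U) (x : U) :
    (of U F hF : U → ℝ) x = F x := rfl

theorem exists_eq_of (f : smoothOn U) : ∃ F hF, f = of U F hF := by
  obtain ⟨f, F, hF, h⟩ := f
  exact ⟨F, hF, Subtype.ext (funext h)⟩

theorem of_congr {F G : P → ℝ} {hF : ContDiffOn ℝ ∞ F U} {hG : ContDiffOn ℝ ∞ G U}
    (h : ∀ x ∈ U, F x = G x) : of U F hF = of U G hG :=
  Subtype.ext (funext fun x => h x x.2)

theorem isUnit_of {F : P → ℝ} {hF : ContDiffOn ℝ ∞ F U} (h : ∀ x ∈ U, F x ≠ 0) :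
    IsUnit (of U F hF) := by
  refine IsUnit.of_mul_eq_one (of U (fun x => (F x)⁻¹) (hF.inv h)) (Subtype.ext (funext fun x => ?_))
  exact mul_inv_cancel₀ (h x x.2)

theorem isUnit_iff {f : smoothOn U} : IsUnit f ↔ ∀ x : U, (f : U → ℝ) x ≠ 0 := by
  constructor
  · intro h x
    have : IsUnit ((f : U → ℝ) x) :=
      h.map ((Pi.evalRingHom (fun _ : U => ℝ) x).comp (smoothOn U).val.toRingHom)
    exact this.ne_zero
  · obtain ⟨F, hF, rfl⟩ := exists_eq_of f
    exact fun h => isUnit_of fun x hx => h ⟨x, hx⟩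

/-- A smooth representative of an element of the ring. -/
def rep (f : smoothOn U) : P → ℝ := f.2.choose

theorem rep_smooth (f : smoothOn U) : ContDiffOn ℝ ∞ (rep f) U := f.2.choose_spec.1

theorem of_rep (f : smoothOn U) : of U (rep f) (rep_smooth f) = f :=
  Subtype.ext (funext fun x => (f.2.choose_spec.2 x).symm)

theorem fderiv_congr {F G : P → ℝ} (h : ∀ x ∈ U, F x = G x) {x : P} (hx : x ∈ U) :
    fderiv ℝ F x = fderiv ℝ G x :=
  Filter.EventuallyEq.fderiv_eq (Filter.eventuallyEq_of_mem (U.2.mem_nhds hx) h)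

/-- The derivative in the direction `e`, as a map. -/
def dirFun (e : P) (f : smoothOn U) : smoothOn U :=
  of U (fun x => fderiv ℝ (rep f) x e) (contDiffOn_fderiv_apply U.2 (rep_smooth f) e)

/-- On an open set the derivative depends only on the values there, so the chosen representative
does not matter. -/
theorem dirFun_of (e : P) (F : P → ℝ) (hF : ContDiffOn ℝ ∞ F U) :
    dirFun e (of U F hF) = of U (fun x => fderiv ℝ F x e) (contDiffOn_fderiv_apply U.2 hF e) := by
  refine of_congr fun x hx => ?_
  rw [fderiv_congr (fun y hy => ?_) hx]
  exact congrFun (congrArg Subtype.val (of_rep (of U F hF))) ⟨y, hy⟩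

/-- The derivative in the direction `e`. -/
def dir (e : P) : Derivation ℝ (smoothOn U) (smoothOn U) :=
  Derivation.mk'
    { toFun := dirFun e
      map_add' := by
        intro f g
        obtain ⟨F, hF, rfl⟩ := exists_eq_of f
        obtain ⟨G, hG, rfl⟩ := exists_eq_of g
        rw [show of U F hF + of U G hG = of U (fun x => F x + G x) (hF.add hG) from rfl, dirFun_of,
          dirFun_of, dirFun_of]
        refine Subtype.ext (funext fun x => ?_)
        have h1 := hasFDerivAt_of_contDiffOn U.2 hF x.2
        have h2 := hasFDerivAt_of_contDiffOn U.2 hG x.2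
        simp [(h1.fun_add h2).fderiv]
      map_smul' := by
        intro c f
        obtain ⟨F, hF, rfl⟩ := exists_eq_of f
        rw [show c • of U F hF = of U (fun x => c • F x) (hF.const_smul c) from rfl, dirFun_of,
          dirFun_of]
        refine Subtype.ext (funext fun x => ?_)
        have h1 := hasFDerivAt_of_contDiffOn U.2 hF x.2
        simp [(h1.const_mul c).fderiv] }
    (by
      intro f g
      obtain ⟨F, hF, rfl⟩ := exists_eq_of f
      obtain ⟨G, hG, rfl⟩ := exists_eq_of g
      change dirFun e (of U F hF * of U G hG) = of U F hF * dirFun e _ + of U G hG * dirFun e _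
      rw [show of U F hF * of U G hG = of U (fun x => F x * G x) (hF.mul hG) from rfl, dirFun_of,
        dirFun_of, dirFun_of]
      refine Subtype.ext (funext fun x => ?_)
      have h1 := hasFDerivAt_of_contDiffOn U.2 hF x.2
      have h2 := hasFDerivAt_of_contDiffOn U.2 hG x.2
      simp [(h1.fun_mul h2).fderiv])

theorem dir_of (e : P) (F : P → ℝ) (hF : ContDiffOn ℝ ∞ F U) :
    dir e (of U F hF) = of U (fun x => fderiv ℝ F x e) (contDiffOn_fderiv_apply U.2 hF e) :=
  dirFun_of e F hF

theorem dir_comm (e e' : P) (f : smoothOn U) : dir e (dir e' f) = dir e' (dir e f) := by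
  obtain ⟨F, hF, rfl⟩ := exists_eq_of f
  rw [dir_of, dir_of, dir_of, dir_of]
  exact of_congr fun x hx => fderiv_fderiv_comm U.2 hF hx _ _

end smoothOn

/-! ### Smoothness of the coefficients and of total derivatives. -/

namespace PDEPair

variable {E : PDEPair}

theorem contDiffOn_pd (hE : E.Admissible) {f : Jet → ℝ} (hf : ContDiffOn ℝ ∞ f E.domain)
    (i : Fin 6) : ContDiffOn ℝ ∞ (pd i f) E.domain :=
  contDiffOn_fderiv_apply hE.isOpen hf _

theorem contDiffOn_coord (i : Fin 6) (s : Set Jet) : ContDiffOn ℝ ∞ (fun u : Jet => u i) s :=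
  (contDiff_apply ℝ ℝ i).contDiffOn

namespace Admissible

variable (hE : E.Admissible)
include hE

theorem smooth_Rz : ContDiffOn ℝ ∞ E.Rz E.domain := contDiffOn_pd hE hE.smooth_R 2
theorem smooth_Rp : ContDiffOn ℝ ∞ E.Rp E.domain := contDiffOn_pd hE hE.smooth_R 3
theorem smooth_Rq : ContDiffOn ℝ ∞ E.Rq E.domain := contDiffOn_pd hE hE.smooth_R 4
theorem smooth_Rs : ContDiffOn ℝ ∞ E.Rs E.domain := contDiffOn_pd hE hE.smooth_R 5
theorem smooth_Tz : ContDiffOn ℝ ∞ E.Tz E.domain := contDiffOn_pd hE hE.smooth_T 2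
theorem smooth_Tp : ContDiffOn ℝ ∞ E.Tp E.domain := contDiffOn_pd hE hE.smooth_T 3
theorem smooth_Tq : ContDiffOn ℝ ∞ E.Tq E.domain := contDiffOn_pd hE hE.smooth_T 4
theorem smooth_Ts : ContDiffOn ℝ ∞ E.Ts E.domain := contDiffOn_pd hE hE.smooth_T 5

theorem smooth_truncDxT : ContDiffOn ℝ ∞ E.truncDxT E.domain :=
  (((contDiffOn_pd hE hE.smooth_T 0).add ((contDiffOn_coord 3 _).mul hE.smooth_Tz)).add
    (hE.smooth_R.mul hE.smooth_Tp)).add ((contDiffOn_coord 5 _).mul hE.smooth_Tq)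

theorem smooth_truncDyR : ContDiffOn ℝ ∞ E.truncDyR E.domain :=
  (((contDiffOn_pd hE hE.smooth_R 1).add ((contDiffOn_coord 4 _).mul hE.smooth_Rz)).add
    ((contDiffOn_coord 5 _).mul hE.smooth_Rp)).add (hE.smooth_T.mul hE.smooth_Rq)

theorem smooth_disc : ContDiffOn ℝ ∞ (fun u => 1 - E.Rs u * E.Ts u) E.domain :=
  contDiffOn_const.sub (hE.smooth_Rs.mul hE.smooth_Ts)

theorem smooth_coeffDxT : ContDiffOn ℝ ∞ E.coeffDxT E.domain :=
  (hE.smooth_truncDxT.add (hE.smooth_Ts.mul hE.smooth_truncDyR)).div hE.smooth_disc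
    hE.nondegenerate

theorem smooth_coeffDyR : ContDiffOn ℝ ∞ E.coeffDyR E.domain :=
  (hE.smooth_truncDyR.add (hE.smooth_Rs.mul hE.smooth_truncDxT)).div hE.smooth_disc
    hE.nondegenerate

theorem smooth_fieldX : ContDiffOn ℝ ∞ E.fieldX E.domain := by
  refine contDiffOn_pi.2 fun i => ?_
  fin_cases i
  exacts [contDiffOn_const, contDiffOn_const, contDiffOn_coord 3 _, hE.smooth_R,
    contDiffOn_coord 5 _, hE.smooth_coeffDyR]

theorem smooth_fieldY : ContDiffOn ℝ ∞ E.fieldY E.domain := by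
  refine contDiffOn_pi.2 fun i => ?_
  fin_cases i
  exacts [contDiffOn_const, contDiffOn_const, contDiffOn_coord 4 _, contDiffOn_coord 5 _,
    hE.smooth_T, hE.smooth_coeffDxT]

theorem smooth_Dx {f : Jet → ℝ} (hf : ContDiffOn ℝ ∞ f E.domain) :
    ContDiffOn ℝ ∞ (E.Dx f) E.domain :=
  (hf.fderiv_of_isOpen hE.isOpen (by simp)).clm_apply hE.smooth_fieldX

theorem smooth_Dy {f : Jet → ℝ} (hf : ContDiffOn ℝ ∞ f E.domain) :
    ContDiffOn ℝ ∞ (E.Dy f) E.domain :=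
  (hf.fderiv_of_isOpen hE.isOpen (by simp)).clm_apply hE.smooth_fieldY

end Admissible

end PDEPair

/-! ### Families of solutions -/

/-- The tangent vector `∂_x` (for `i = 0`) or `∂_y` (for `i = 1`). -/
def planeVec (i : Fin 2) : Plane × Param := (Pi.single i 1, 0)

/-- A smooth family of solutions with four parameters which is an immersion into the space of
jets. -/
structure IsFamily (E : PDEPair) (W : Set (Plane × Param)) (ψ : Plane × Param → ℝ) : Prop where
  isOpen : IsOpen W
  smooth : ContDiffOn ℝ ∞ ψ W
  mapsTo : ∀ w ∈ W, jetMap ψ w ∈ E.domain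
  eq_xx : ∀ w ∈ W, pdPlane 0 (pdPlane 0 ψ) w = E.R (jetMap ψ w)
  eq_yy : ∀ w ∈ W, pdPlane 1 (pdPlane 1 ψ) w = E.T (jetMap ψ w)
  immersion : ∀ w ∈ W, Function.Injective (fderiv ℝ (jetMap ψ) w)

/-- A family requires neither injectivity of the jet map nor connected slices. It can therefore be
restricted to arbitrary open subsets, such as those where R_sT_s avoids 4 or 0, and it is what a
contact transformation produces locally. -/
theorem GeneralSolution.isFamily {E : PDEPair} (S : GeneralSolution E) :
    IsFamily E S.source S.ψ :=
  ⟨S.isOpen, S.smooth, S.mapsTo, S.eq_xx, S.eq_yy, S.immersion⟩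

/-- The derivative of the jet in the direction of the parameters, without the components
`dx`, `dy`. -/
def variation (ψ : Plane × Param → ℝ) (w : Plane × Param) (v : Param) : Fin 4 → ℝ :=
  fun i => fderiv ℝ (jetMap ψ) w (0, v) (i.natAdd 2)

/-- The variation as a linear map. -/
theorem exists_variation_linear (ψ : Plane × Param → ℝ) (w : Plane × Param) :
    ∃ L : Param →ₗ[ℝ] (Fin 4 → ℝ), ∀ v, L v = variation ψ w v := by
  refine ⟨LinearMap.pi fun i => ((ContinuousLinearMap.proj (R := ℝ) (φ := fun _ : Fin 6 => ℝ)
    (i.natAdd 2)).comp ((fderiv ℝ (jetMap ψ) w).comp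
    (ContinuousLinearMap.inr ℝ Plane Param))).toLinearMap, fun v => rfl⟩

namespace IsFamily

variable {E : PDEPair} {W : Set (Plane × Param)} {ψ : Plane × Param → ℝ} (h : IsFamily E W ψ)
include h

theorem smooth_pdPlane {g : Plane × Param → ℝ} (hg : ContDiffOn ℝ ∞ g W) (i : Fin 2) :
    ContDiffOn ℝ ∞ (pdPlane i g) W :=
  contDiffOn_fderiv_apply h.isOpen hg _

theorem smooth_jet : ContDiffOn ℝ ∞ (jetMap ψ) W := by
  refine contDiffOn_pi.2 fun i => ?_
  fin_cases i
  · exact ((contDiff_apply ℝ ℝ (0 : Fin 2)).comp contDiff_fst).contDiffOn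
  · exact ((contDiff_apply ℝ ℝ (1 : Fin 2)).comp contDiff_fst).contDiffOn
  · exact h.smooth
  · exact h.smooth_pdPlane h.smooth 0
  · exact h.smooth_pdPlane h.smooth 1
  · exact h.smooth_pdPlane (h.smooth_pdPlane h.smooth 0) 1

theorem hasFDerivAt_jet {w : Plane × Param} (hw : w ∈ W) :
    HasFDerivAt (jetMap ψ) (fderiv ℝ (jetMap ψ) w) w :=
  hasFDerivAt_of_contDiffOn h.isOpen h.smooth_jet hw

theorem smooth_comp {E' : Type*} [NormedAddCommGroup E'] [NormedSpace ℝ E'] {g : Jet → E'}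
    (hg : ContDiffOn ℝ ∞ g E.domain) : ContDiffOn ℝ ∞ (fun w => g (jetMap ψ w)) W :=
  hg.comp h.smooth_jet h.mapsTo

theorem fderiv_jet_apply {w : Plane × Param} (hw : w ∈ W) (e : Plane × Param) (i : Fin 6) :
    fderiv ℝ (jetMap ψ) w e i = fderiv ℝ (fun w => jetMap ψ w i) w e := by
  rw [(hasFDerivAt_pi'.1 (h.hasFDerivAt_jet hw) i).fderiv]
  rfl

theorem fderiv_jet_zero {w : Plane × Param} (hw : w ∈ W) (e : Plane × Param) :
    fderiv ℝ (jetMap ψ) w e 0 = e.1 0 := by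
  rw [h.fderiv_jet_apply hw]
  exact congrArg (· e) (((ContinuousLinearMap.proj (R := ℝ) (φ := fun _ : Fin 2 => ℝ) 0).comp
    (ContinuousLinearMap.fst ℝ Plane Param)).hasFDerivAt (x := w)).fderiv

theorem fderiv_jet_one {w : Plane × Param} (hw : w ∈ W) (e : Plane × Param) :
    fderiv ℝ (jetMap ψ) w e 1 = e.1 1 := by
  rw [h.fderiv_jet_apply hw]
  exact congrArg (· e) (((ContinuousLinearMap.proj (R := ℝ) (φ := fun _ : Fin 2 => ℝ) 1).comp
    (ContinuousLinearMap.fst ℝ Plane Param)).hasFDerivAt (x := w)).fderiv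

theorem fderiv_comp {g : Jet → ℝ} (hE : E.Admissible) (hg : ContDiffOn ℝ ∞ g E.domain)
    {w : Plane × Param} (hw : w ∈ W) (e : Plane × Param) :
    fderiv ℝ (fun w => g (jetMap ψ w)) w e = fderiv ℝ g (jetMap ψ w) (fderiv ℝ (jetMap ψ) w e) := by
  have h1 := hasFDerivAt_of_contDiffOn hE.isOpen hg (h.mapsTo w hw)
  have := (h1.comp w (h.hasFDerivAt_jet hw)).fderiv
  exact congrArg (· e) this

theorem congr_fderiv {g g' : Plane × Param → ℝ} (hgg : ∀ w ∈ W, g w = g' w) {w : Plane × Param}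
    (hw : w ∈ W) : fderiv ℝ g w = fderiv ℝ g' w :=
  Filter.EventuallyEq.fderiv_eq (Filter.eventuallyEq_of_mem (h.isOpen.mem_nhds hw) hgg)

theorem dx_z {w : Plane × Param} (hw : w ∈ W) :
    fderiv ℝ (jetMap ψ) w (planeVec 0) 2 = jetMap ψ w 3 :=
  h.fderiv_jet_apply hw _ _

theorem dy_z {w : Plane × Param} (hw : w ∈ W) :
    fderiv ℝ (jetMap ψ) w (planeVec 1) 2 = jetMap ψ w 4 :=
  h.fderiv_jet_apply hw _ _

theorem dx_p {w : Plane × Param} (hw : w ∈ W) :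
    fderiv ℝ (jetMap ψ) w (planeVec 0) 3 = E.R (jetMap ψ w) :=
  (h.fderiv_jet_apply hw _ _).trans (h.eq_xx w hw)

theorem dy_p {w : Plane × Param} (hw : w ∈ W) :
    fderiv ℝ (jetMap ψ) w (planeVec 1) 3 = jetMap ψ w 5 :=
  h.fderiv_jet_apply hw _ _

theorem dx_q {w : Plane × Param} (hw : w ∈ W) :
    fderiv ℝ (jetMap ψ) w (planeVec 0) 4 = jetMap ψ w 5 :=
  (h.fderiv_jet_apply hw _ _).trans (fderiv_fderiv_comm h.isOpen h.smooth hw _ _)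

theorem dy_q {w : Plane × Param} (hw : w ∈ W) :
    fderiv ℝ (jetMap ψ) w (planeVec 1) 4 = E.T (jetMap ψ w) :=
  (h.fderiv_jet_apply hw _ _).trans (h.eq_yy w hw)

theorem smooth_coord (i : Fin 6) : ContDiffOn ℝ ∞ (fun w => jetMap ψ w i) W :=
  contDiffOn_pi.1 h.smooth_jet i

/-- Mixed derivatives of a component of the jet. -/
theorem fderiv_fderiv_jet {w : Plane × Param} (hw : w ∈ W) (i : Fin 6) (e e' : Plane × Param)
    {g : Plane × Param → ℝ} (hg : ∀ w ∈ W, fderiv ℝ (jetMap ψ) w e i = g w) :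
    fderiv ℝ (fun w => fderiv ℝ (jetMap ψ) w e' i) w e = fderiv ℝ g w e' := by
  rw [h.congr_fderiv (fun w hw => h.fderiv_jet_apply hw e' i) hw,
    ← h.congr_fderiv hg hw, h.congr_fderiv (fun w hw => h.fderiv_jet_apply hw e i) hw]
  exact fderiv_fderiv_comm h.isOpen (h.smooth_coord i) hw e' e

/-- Third derivatives commute: s_x = (z_xx)_y is the derivative of R along y, and s_y = (z_yy)_x
that of T along x. So s_x and s_y solve the linear system that defines `coeffDyR` and `coeffDxT`,
whose determinant is nonzero. -/
theorem fderiv_s {w : Plane × Param} (hE : E.Admissible) (hw : w ∈ W) :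
    fderiv ℝ (jetMap ψ) w (planeVec 0) 5 = E.coeffDyR (jetMap ψ w) ∧
      fderiv ℝ (jetMap ψ) w (planeVec 1) 5 = E.coeffDxT (jetMap ψ w) := by
  set a := fderiv ℝ (jetMap ψ) w (planeVec 0) 5 with ha
  set b := fderiv ℝ (jetMap ψ) w (planeVec 1) 5 with hb
  have h1 : a = fderiv ℝ (fun w => E.R (jetMap ψ w)) w (planeVec 1) := by
    rw [← h.fderiv_fderiv_jet hw 3 (planeVec 0) (planeVec 1) fun w hw => h.dx_p hw,
      h.congr_fderiv (fun w hw => h.dy_p hw) hw, ← h.fderiv_jet_apply hw]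
  have h2 : b = fderiv ℝ (fun w => E.T (jetMap ψ w)) w (planeVec 0) := by
    rw [← h.fderiv_fderiv_jet hw 4 (planeVec 1) (planeVec 0) fun w hw => h.dy_q hw,
      h.congr_fderiv (fun w hw => h.dx_q hw) hw, ← h.fderiv_jet_apply hw]
  have hx0 : fderiv ℝ (jetMap ψ) w (planeVec 0) 0 = 1 := by
    rw [h.fderiv_jet_zero hw]; simp [planeVec]
  have hx1 : fderiv ℝ (jetMap ψ) w (planeVec 0) 1 = 0 := by
    rw [h.fderiv_jet_one hw]; simp [planeVec]
  have hy0 : fderiv ℝ (jetMap ψ) w (planeVec 1) 0 = 0 := by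
    rw [h.fderiv_jet_zero hw]; simp [planeVec]
  have hy1 : fderiv ℝ (jetMap ψ) w (planeVec 1) 1 = 1 := by
    rw [h.fderiv_jet_one hw]; simp [planeVec]
  rw [h.fderiv_comp hE hE.smooth_R hw, PDEPair.fderiv_eq_sum_pd, Fin.sum_univ_six, hy0, hy1,
    h.dy_z hw, h.dy_p hw, h.dy_q hw, ← hb] at h1
  rw [h.fderiv_comp hE hE.smooth_T hw, PDEPair.fderiv_eq_sum_pd, Fin.sum_univ_six, hx0, hx1,
    h.dx_z hw, h.dx_p hw, h.dx_q hw, ← ha] at h2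
  have hd := hE.nondegenerate _ (h.mapsTo w hw)
  have c1 := E.coeffDyR_mul hd
  have c2 := E.coeffDxT_mul hd
  simp only [PDEPair.truncDyR, PDEPair.truncDxT, PDEPair.Rz, PDEPair.Rp, PDEPair.Rq, PDEPair.Rs,
    PDEPair.Tz, PDEPair.Tp, PDEPair.Tq, PDEPair.Ts] at hd c1 c2
  constructor <;> apply mul_right_cancel₀ hd
  · linear_combination -c1 + h1 + pd 5 E.R (jetMap ψ w) * h2
  · linear_combination -c2 + h2 + pd 5 E.T (jetMap ψ w) * h1

theorem fderiv_jet_x {w : Plane × Param} (hE : E.Admissible) (hw : w ∈ W) :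
    fderiv ℝ (jetMap ψ) w (planeVec 0) = E.fieldX (jetMap ψ w) := by
  funext i
  fin_cases i
  · exact (h.fderiv_jet_zero hw _).trans (by simp [planeVec, PDEPair.fieldX])
  · exact (h.fderiv_jet_one hw _).trans (by simp [planeVec, PDEPair.fieldX])
  exacts [h.dx_z hw, h.dx_p hw, h.dx_q hw, (h.fderiv_s hE hw).1]

theorem fderiv_jet_y {w : Plane × Param} (hE : E.Admissible) (hw : w ∈ W) :
    fderiv ℝ (jetMap ψ) w (planeVec 1) = E.fieldY (jetMap ψ w) := by
  funext i
  fin_cases i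
  · exact (h.fderiv_jet_zero hw _).trans (by simp [planeVec, PDEPair.fieldY])
  · exact (h.fderiv_jet_one hw _).trans (by simp [planeVec, PDEPair.fieldY])
  exacts [h.dy_z hw, h.dy_p hw, h.dy_q hw, (h.fderiv_s hE hw).2]

theorem fderiv_comp_x {g : Jet → ℝ} (hE : E.Admissible) (hg : ContDiffOn ℝ ∞ g E.domain)
    {w : Plane × Param} (hw : w ∈ W) :
    fderiv ℝ (fun w => g (jetMap ψ w)) w (planeVec 0) = E.Dx g (jetMap ψ w) := by
  rw [h.fderiv_comp hE hg hw, h.fderiv_jet_x hE hw, PDEPair.Dx]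

theorem fderiv_comp_y {g : Jet → ℝ} (hE : E.Admissible) (hg : ContDiffOn ℝ ∞ g E.domain)
    {w : Plane × Param} (hw : w ∈ W) :
    fderiv ℝ (fun w => g (jetMap ψ w)) w (planeVec 1) = E.Dy g (jetMap ψ w) := by
  rw [h.fderiv_comp hE hg hw, h.fderiv_jet_y hE hw, PDEPair.Dy]

theorem fderiv_comp_param {g : Jet → ℝ} (hE : E.Admissible) (hg : ContDiffOn ℝ ∞ g E.domain)
    {w : Plane × Param} (hw : w ∈ W) (v : Param) :
    fderiv ℝ (fun w => g (jetMap ψ w)) w (0, v) = pd 2 g (jetMap ψ w) * variation ψ w v 0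
      + pd 3 g (jetMap ψ w) * variation ψ w v 1 + pd 4 g (jetMap ψ w) * variation ψ w v 2
      + pd 5 g (jetMap ψ w) * variation ψ w v 3 := by
  rw [h.fderiv_comp hE hg hw, PDEPair.fderiv_eq_sum_pd, Fin.sum_univ_six, h.fderiv_jet_zero hw,
    h.fderiv_jet_one hw]
  simp only [Pi.zero_apply, variation]
  change _ + _ * pd 2 g _ + _ * pd 3 g _ + _ * pd 4 g _ + _ * pd 5 g _ = _
  simp only [zero_mul, zero_add]
  change fderiv ℝ (jetMap ψ) w (0, v) 2 * _ + fderiv ℝ (jetMap ψ) w (0, v) 3 * _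
    + fderiv ℝ (jetMap ψ) w (0, v) 4 * _ + fderiv ℝ (jetMap ψ) w (0, v) 5 * _
    = _ * fderiv ℝ (jetMap ψ) w (0, v) 2 + _ * fderiv ℝ (jetMap ψ) w (0, v) 3
    + _ * fderiv ℝ (jetMap ψ) w (0, v) 4 + _ * fderiv ℝ (jetMap ψ) w (0, v) 5
  ring

theorem smooth_variation (v : Param) (i : Fin 4) :
    ContDiffOn ℝ ∞ (fun w => variation ψ w v i) W :=
  contDiffOn_pi.1 (contDiffOn_fderiv_apply h.isOpen h.smooth_jet (0, v)) (i.natAdd 2)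

/-- The variations of the components of the jet satisfy the linearized equations. -/
theorem fderiv_variation (hE : E.Admissible) {w : Plane × Param} (hw : w ∈ W) (v : Param) :
    fderiv ℝ (fun w => variation ψ w v 0) w (planeVec 0) = variation ψ w v 1 ∧
    fderiv ℝ (fun w => variation ψ w v 0) w (planeVec 1) = variation ψ w v 2 ∧
    fderiv ℝ (fun w => variation ψ w v 1) w (planeVec 1) = variation ψ w v 3 ∧
    fderiv ℝ (fun w => variation ψ w v 1) w (planeVec 0)
      = E.Rz (jetMap ψ w) * variation ψ w v 0 + E.Rp (jetMap ψ w) * variation ψ w v 1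
        + E.Rq (jetMap ψ w) * variation ψ w v 2 + E.Rs (jetMap ψ w) * variation ψ w v 3 ∧
    fderiv ℝ (fun w => variation ψ w v 2) w (planeVec 1)
      = E.Tz (jetMap ψ w) * variation ψ w v 0 + E.Tp (jetMap ψ w) * variation ψ w v 1
        + E.Tq (jetMap ψ w) * variation ψ w v 2 + E.Ts (jetMap ψ w) * variation ψ w v 3 := by
  refine ⟨?_, ?_, ?_, ?_, ?_⟩
  · exact (h.fderiv_fderiv_jet hw 2 _ _ fun w hw => h.dx_z hw).trans
      (h.fderiv_jet_apply hw _ 3).symm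
  · exact (h.fderiv_fderiv_jet hw 2 _ _ fun w hw => h.dy_z hw).trans
      (h.fderiv_jet_apply hw _ 4).symm
  · exact (h.fderiv_fderiv_jet hw 3 _ _ fun w hw => h.dy_p hw).trans
      (h.fderiv_jet_apply hw _ 5).symm
  · exact (h.fderiv_fderiv_jet hw 3 _ _ fun w hw => h.dx_p hw).trans
      (h.fderiv_comp_param hE hE.smooth_R hw v)
  · exact (h.fderiv_fderiv_jet hw 4 _ _ fun w hw => h.dy_q hw).trans
      (h.fderiv_comp_param hE hE.smooth_T hw v)

/-- Parameter directions have zero x and y components in the jet, so the immersion property concerns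
only the other four. As there are four parameters, the variation is an isomorphism and λ, ν₁, ν₂, ν₃
take arbitrary values on parameter vectors. -/
theorem variation_injective {w : Plane × Param} (hw : w ∈ W) :
    Function.Injective (variation ψ w) := by
  intro v v' hv
  have : fderiv ℝ (jetMap ψ) w (0, v) = fderiv ℝ (jetMap ψ) w (0, v') := by
    funext i
    refine Fin.addCases (m := 2) (n := 4) (fun j => ?_) (fun j => congrFun hv j) i
    fin_cases j
    · exact (h.fderiv_jet_zero hw (0, v)).trans (h.fderiv_jet_zero hw (0, v')).symm
    · exact (h.fderiv_jet_one hw (0, v)).trans (h.fderiv_jet_one hw (0, v')).symm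
  exact congrArg Prod.snd (h.immersion w hw this)

theorem variation_surjective {w : Plane × Param} (hw : w ∈ W) :
    Function.Surjective (variation ψ w) := by
  obtain ⟨L, hL⟩ := exists_variation_linear ψ w
  have hL' : (L : Param → Fin 4 → ℝ) = variation ψ w := funext hL
  rw [← hL']
  refine LinearMap.surjective_of_injective (f := L) ?_
  rw [hL']
  exact h.variation_injective hw

end IsFamily

variable {E : PDEPair} {W : Set (Plane × Param)} {ψ : Plane × Param → ℝ} {a : Param}
  {U : Opens Plane}

/-- The restriction of a smooth function to the slice with parameter `a`. -/
def restrict (hU : MapsTo (fun t => (t, a)) U W) (g : Plane × Param → ℝ)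
    (hg : ContDiffOn ℝ ∞ g W) : smoothOn U :=
  smoothOn.of U (fun t => g (t, a))
    (hg.comp (contDiff_id.prodMk contDiff_const).contDiffOn hU)

@[simp] theorem restrict_apply (hU : MapsTo (fun t => (t, a)) U W) (g : Plane × Param → ℝ)
    (hg : ContDiffOn ℝ ∞ g W) (t : U) : (restrict hU g hg : U → ℝ) t = g (t, a) := rfl

theorem restrict_congr {hU : MapsTo (fun t => (t, a)) U W} {g g' : Plane × Param → ℝ}
    {hg : ContDiffOn ℝ ∞ g W} {hg' : ContDiffOn ℝ ∞ g' W} (hgg : ∀ w ∈ W, g w = g' w) :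
    restrict hU g hg = restrict hU g' hg' :=
  smoothOn.of_congr fun _ ht => hgg _ (hU ht)

theorem dir_restrict (hW : IsOpen W) (hU : MapsTo (fun t => (t, a)) U W) (g : Plane × Param → ℝ)
    (hg : ContDiffOn ℝ ∞ g W) (i : Fin 2) :
    smoothOn.dir (Pi.single i 1) (restrict hU g hg)
      = restrict hU (fun w => fderiv ℝ g w (planeVec i)) (contDiffOn_fderiv_apply hW hg _) := by
  rw [restrict, smoothOn.dir_of]
  refine smoothOn.of_congr fun t ht => ?_
  have h1 := hasFDerivAt_of_contDiffOn hW hg (hU ht)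
  have h2 : HasFDerivAt (fun t : Plane => (t, a)) (ContinuousLinearMap.inl ℝ Plane Param) t :=
    (hasFDerivAt_id t).prodMk (hasFDerivAt_const a t)
  have := (h1.comp t h2).fderiv
  exact congrArg (· (Pi.single i 1)) this

/-! ### The jet algebra realized on a single solution. -/

namespace IsFamily

variable (h : IsFamily E W ψ) (hE : E.Admissible) (hU : MapsTo (fun t => (t, a)) U W)

/-- A function on the space of jets, restricted to the solution with parameter `a`. -/
def onSlice (g : Jet → ℝ) (hg : ContDiffOn ℝ ∞ g E.domain) : smoothOn U :=
  restrict hU (fun w => g (jetMap ψ w)) (h.smooth_comp hg)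

theorem dir_onSlice_zero (g : Jet → ℝ) (hg : ContDiffOn ℝ ∞ g E.domain) :
    smoothOn.dir (Pi.single 0 1) (h.onSlice hU g hg) = h.onSlice hU (E.Dx g) (hE.smooth_Dx hg) := by
  rw [onSlice, dir_restrict h.isOpen]
  exact restrict_congr fun w hw => h.fderiv_comp_x hE hg hw

theorem dir_onSlice_one (g : Jet → ℝ) (hg : ContDiffOn ℝ ∞ g E.domain) :
    smoothOn.dir (Pi.single 1 1) (h.onSlice hU g hg) = h.onSlice hU (E.Dy g) (hE.smooth_Dy hg) := by
  rw [onSlice, dir_restrict h.isOpen]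
  exact restrict_congr fun w hw => h.fderiv_comp_y hE hg hw

/-- The ring of functions on (an open subset of) the solution with parameter `a`, with the
derivatives of the right-hand sides. -/
def slice : JetAlgebra (smoothOn U) where
  dx := smoothOn.dir (Pi.single 0 1)
  dy := smoothOn.dir (Pi.single 1 1)
  comm := smoothOn.dir_comm _ _
  rz := h.onSlice hU E.Rz hE.smooth_Rz
  rp := h.onSlice hU E.Rp hE.smooth_Rp
  rq := h.onSlice hU E.Rq hE.smooth_Rq
  r := h.onSlice hU E.Rs hE.smooth_Rs
  tz := h.onSlice hU E.Tz hE.smooth_Tz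
  tp := h.onSlice hU E.Tp hE.smooth_Tp
  tq := h.onSlice hU E.Tq hE.smooth_Tq
  t := h.onSlice hU E.Ts hE.smooth_Ts

/-- The variation in the direction `v` of the solution with parameter `a`. -/
def sliceVar (v : Param) (i : Fin 4) : smoothOn U :=
  restrict hU (fun w => variation ψ w v i) (h.smooth_variation v i)

theorem isVariation_sliceVar (v : Param) : (h.slice hE hU).IsVariation (h.sliceVar hU v) := by
  constructor <;> simp only [sliceVar, slice] <;> rw [dir_restrict h.isOpen] <;>
    refine Subtype.ext (funext fun t => ?_) <;>
    obtain ⟨h0, h1, h2, h3, h4⟩ := h.fderiv_variation hE (hU t.2) v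
  exacts [h0, h1, h2, h3, h4]

theorem isUnit_disc : IsUnit (h.slice hE hU).disc :=
  smoothOn.isUnit_iff.2 fun t => hE.nondegenerate _ (h.mapsTo _ (hU t.2))

theorem inv1_apply (t : U) : ((h.slice hE hU).inv1 : U → ℝ) t = E.J1 (jetMap ψ (t, a)) := by
  simp only [JetAlgebra.inv1, slice, h.dir_onSlice_zero hE, h.dir_onSlice_one hE]
  rfl

theorem inv2_apply (t : U) : ((h.slice hE hU).inv2 : U → ℝ) t = E.J2 (jetMap ψ (t, a)) := by
  simp only [JetAlgebra.inv2, slice, h.dir_onSlice_zero hE, h.dir_onSlice_one hE]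
  rfl

theorem twoV_apply (t : U) : ((h.slice hE hU).twoV : U → ℝ) t = E.twoV (jetMap ψ (t, a)) := by
  simp only [JetAlgebra.twoV, slice, h.dir_onSlice_zero hE, h.dir_onSlice_one hE]
  rfl

theorem vPrime_apply (t : U) :
    ((h.slice hE hU).vPrime : U → ℝ) t = E.vPrime (jetMap ψ (t, a)) := by
  simp only [JetAlgebra.vPrime, slice, h.dir_onSlice_zero hE, h.dir_onSlice_one hE]
  rfl

/-- At each point the variations run through all of ℝ⁴, so the relation is an identity between
quadratic forms; unit vectors and their sums isolate the coefficients. -/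
theorem separating_sliceVar : JetAlgebra.Separating (fun v => h.sliceVar hU v) := by
  intro c00 c01 c02 c03 c11 c12 c22 hc
  have key : ∀ t : U, ∀ k : Fin 4 → ℝ, (c00 : U → ℝ) t * k 0 ^ 2 + (c01 : U → ℝ) t * (k 0 * k 1)
      + (c02 : U → ℝ) t * (k 0 * k 2) + (c03 : U → ℝ) t * (k 0 * k 3) + (c11 : U → ℝ) t * k 1 ^ 2
      + (c12 : U → ℝ) t * (k 1 * k 2) + (c22 : U → ℝ) t * k 2 ^ 2 = 0 := by
    intro t k
    obtain ⟨v, rfl⟩ := h.variation_surjective (hU t.2) k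
    exact congrFun (congrArg Subtype.val (hc v)) t
  have h00 : ∀ t, (c00 : U → ℝ) t = 0 := fun t => by simpa using key t ![1, 0, 0, 0]
  have h11 : ∀ t, (c11 : U → ℝ) t = 0 := fun t => by simpa using key t ![0, 1, 0, 0]
  have h22 : ∀ t, (c22 : U → ℝ) t = 0 := fun t => by simpa using key t ![0, 0, 1, 0]
  refine ⟨Subtype.ext (funext h00), ?_, ?_, ?_, Subtype.ext (funext h11), ?_,
    Subtype.ext (funext h22)⟩ <;> refine Subtype.ext (funext fun t => ?_)
  · simpa [h00, h11, h22] using key t ![1, 1, 0, 0]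
  · simpa [h00, h11, h22] using key t ![1, 0, 1, 0]
  · simpa [h00, h11, h22] using key t ![1, 0, 0, 1]
  · simpa [h00, h11, h22] using key t ![0, 1, 1, 0]

end IsFamily

/-! ### A common normal form for (A) and (B). -/

namespace PDEPair

variable (E : PDEPair)

/-- The coefficient of `ν₁` in `ω`. -/
def omCoeff1 (u : Jet) : ℝ :=
  4 * E.Dx E.Ts u - 2 * E.Ts u * E.Dy E.Rs u + 4 * E.Rp u * E.Ts u
    - 2 * E.Rs u ^ 2 * E.Tp u * E.Ts u - 2 * E.Rs u * E.Tq u * E.Ts u + 4 * E.Rq u * E.Ts u ^ 2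

/-- The coefficient of `ν₂` in `ω`. -/
def omCoeff2 (u : Jet) : ℝ :=
  4 * E.Dy E.Rs u - 2 * E.Rs u * E.Dx E.Ts u + 4 * E.Rs u * E.Tq u
    - 2 * E.Rq u * E.Rs u * E.Ts u ^ 2 - 2 * E.Rp u * E.Rs u * E.Ts u + 4 * E.Rs u ^ 2 * E.Tp u

/-- The coefficients of `ω / (2 (R_s T_s - 4))`. -/
def coeffA : Fin 3 → Jet → ℝ := ![
  fun u => E.omCoeff1 u / (2 * (E.Rs u * E.Ts u - 4)),
  fun u => E.omCoeff2 u / (2 * (E.Rs u * E.Ts u - 4)),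
  fun u => E.twoV u / (4 * (E.Rs u * E.Ts u - 4))]

/-- The coefficients of `ω'`. -/
def coeffB : Fin 3 → Jet → ℝ := ![
  fun u => (-E.Dy E.Ts u + 2 * E.Tp u - E.Rs u * E.Tp u * E.Ts u + E.Tq u * E.Ts u) / E.Ts u,
  fun u => (-E.Dx E.Rs u + 2 * E.Rq u - E.Rq u * E.Rs u * E.Ts u + E.Rp u * E.Rs u) / E.Rs u,
  fun u => -(E.vPrime u / (2 * E.Rs u ^ 3 * E.Ts u))]

/-- The form `2 λ (c₀ ν₁ + c₁ ν₂ + (1 - R_s T_s) ν₃ + c₂ λ) + T_s ν₁² - 2 ν₁ ν₂ + R_s ν₂²`. -/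
def form (c : Fin 3 → Jet → ℝ) (u : Jet) : Bil Jet :=
  (2 : ℝ) • symProd (lam u) (c 0 u • E.nu1 u + c 1 u • E.nu2 u
    + (1 - E.Rs u * E.Ts u) • E.nu3 u + c 2 u • lam u) + E.nuForm u

/-- After division by 2(R_sT_s - 4), form (A) has the same shape as (B) and differs from it only
through the three coefficients of ν₁, ν₂ and λ. From here on both are instances of `form`. -/
theorem g1_eq {u : Jet} (hu : E.Rs u * E.Ts u ≠ 4) :
    E.g1 u = (2 * (E.Rs u * E.Ts u - 4)) • E.form E.coeffA u := by
  have hne : E.Rs u * E.Ts u - 4 ≠ 0 := sub_ne_zero.2 hu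
  have hom : E.omega u = (2 * (E.Rs u * E.Ts u - 4)) • (E.coeffA 0 u • E.nu1 u
      + E.coeffA 1 u • E.nu2 u + (1 - E.Rs u * E.Ts u) • E.nu3 u + E.coeffA 2 u • lam u) := by
    simp only [smul_add, smul_smul]
    rw [show (2 * (E.Rs u * E.Ts u - 4)) * E.coeffA 0 u = E.omCoeff1 u by
        simp only [coeffA, Matrix.cons_val]; field_simp,
      show (2 * (E.Rs u * E.Ts u - 4)) * E.coeffA 1 u = E.omCoeff2 u by
        simp only [coeffA, Matrix.cons_val]; field_simp,
      show (2 * (E.Rs u * E.Ts u - 4)) * E.coeffA 2 u = E.twoV u / 2 by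
        simp only [coeffA, Matrix.cons_val]; field_simp; norm_num,
      show 2 * (E.Rs u * E.Ts u - 4) * (1 - E.Rs u * E.Ts u)
        = 2 * (4 - E.Rs u * E.Ts u) * (E.Rs u * E.Ts u - 1) by ring]
    rfl
  ext v v'
  simp only [g1, hom, form, symProd]
  simp
  ring

theorem g2_eq (u : Jet) : E.g2 u = E.form E.coeffB u := by
  have : E.omegaPrime u = E.coeffB 0 u • E.nu1 u + E.coeffB 1 u • E.nu2 u
      + (1 - E.Rs u * E.Ts u) • E.nu3 u + E.coeffB 2 u • lam u := by
    refine ContinuousLinearMap.ext fun v => ?_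
    simp [omegaPrime, coeffB]
    ring
  rw [g2, this, form]

/-- The values of `form` in terms of the values of the coframe. -/
def formVal (c : Fin 3 → Jet → ℝ) (u : Jet) (ξ η : Fin 4 → ℝ) : ℝ :=
  ξ 0 * (c 0 u * η 1 + c 1 u * η 2 + (1 - E.Rs u * E.Ts u) * η 3 + c 2 u * η 0)
    + η 0 * (c 0 u * ξ 1 + c 1 u * ξ 2 + (1 - E.Rs u * E.Ts u) * ξ 3 + c 2 u * ξ 0)
    + E.Ts u * (ξ 1 * η 1) - ξ 1 * η 2 - ξ 2 * η 1 + E.Rs u * (ξ 2 * η 2)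

/-- The values of the coframe. -/
def coframe (u v : Jet) : Fin 4 → ℝ := ![lam u v, E.nu1 u v, E.nu2 u v, E.nu3 u v]

theorem form_apply (c : Fin 3 → Jet → ℝ) (u v v' : Jet) :
    E.form c u v v' = E.formVal c u (E.coframe u v) (E.coframe u v') := by
  simp [form, formVal, symProd, nuForm, coframe]
  ring

variable {E}

theorem smooth_coeffA (hE : E.Admissible) (i : Fin 3) :
    ContDiffOn ℝ ∞ (E.coeffA i) {u ∈ E.domain | E.Rs u * E.Ts u ≠ 4} := by
  have hs : {u ∈ E.domain | E.Rs u * E.Ts u ≠ 4} ⊆ E.domain := fun u hu => hu.1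
  have r := hE.smooth_Rs.mono hs
  have t := hE.smooth_Ts.mono hs
  have rp := hE.smooth_Rp.mono hs
  have rq := hE.smooth_Rq.mono hs
  have tp := hE.smooth_Tp.mono hs
  have tq := hE.smooth_Tq.mono hs
  have rz := hE.smooth_Rz.mono hs
  have tz := hE.smooth_Tz.mono hs
  have dxt := (hE.smooth_Dx hE.smooth_Ts).mono hs
  have dyr := (hE.smooth_Dy hE.smooth_Rs).mono hs
  have d1 := (hE.smooth_Dx hE.smooth_Tq).mono hs
  have d2 := (hE.smooth_Dy (hE.smooth_Dy hE.smooth_Rs)).mono hs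
  have d3 := (hE.smooth_Dx hE.smooth_Tp).mono hs
  have d4 := (hE.smooth_Dy hE.smooth_Tq).mono hs
  have d5 := (hE.smooth_Dy hE.smooth_Tp).mono hs
  have d6 := (hE.smooth_Dy hE.smooth_Rq).mono hs
  have d7 := (hE.smooth_Dy hE.smooth_Rp).mono hs
  fin_cases i
  · refine ContDiffOn.div ?_ (by fun_prop) fun u hu => mul_ne_zero two_ne_zero (sub_ne_zero.2 hu.2)
    unfold omCoeff1
    fun_prop
  · refine ContDiffOn.div ?_ (by fun_prop) fun u hu => mul_ne_zero two_ne_zero (sub_ne_zero.2 hu.2)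
    unfold omCoeff2
    fun_prop
  · refine ContDiffOn.div ?_ (by fun_prop) fun u hu => mul_ne_zero four_ne_zero (sub_ne_zero.2 hu.2)
    unfold twoV
    fun_prop

theorem smooth_coeffB (hE : E.Admissible) (i : Fin 3) :
    ContDiffOn ℝ ∞ (E.coeffB i) {u ∈ E.domain | E.Rs u * E.Ts u ≠ 0} := by
  have hs : {u ∈ E.domain | E.Rs u * E.Ts u ≠ 0} ⊆ E.domain := fun u hu => hu.1
  have r := hE.smooth_Rs.mono hs
  have t := hE.smooth_Ts.mono hs
  have rp := hE.smooth_Rp.mono hs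
  have rq := hE.smooth_Rq.mono hs
  have tp := hE.smooth_Tp.mono hs
  have tq := hE.smooth_Tq.mono hs
  have rz := hE.smooth_Rz.mono hs
  have tz := hE.smooth_Tz.mono hs
  have dxr := (hE.smooth_Dx hE.smooth_Rs).mono hs
  have dyt := (hE.smooth_Dy hE.smooth_Ts).mono hs
  have d1 := (hE.smooth_Dx hE.smooth_Tq).mono hs
  have d2 := (hE.smooth_Dx (hE.smooth_Dy hE.smooth_Rs)).mono hs
  have d6 := (hE.smooth_Dy hE.smooth_Rq).mono hs
  have d7 := (hE.smooth_Dy hE.smooth_Rp).mono hs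
  fin_cases i
  · exact ContDiffOn.div (by fun_prop) t fun u hu => right_ne_zero_of_mul hu.2
  · exact ContDiffOn.div (by fun_prop) r fun u hu => left_ne_zero_of_mul hu.2
  · refine ContDiffOn.neg (ContDiffOn.div ?_ (by fun_prop) fun u hu =>
      mul_ne_zero (mul_ne_zero two_ne_zero (pow_ne_zero _ (left_ne_zero_of_mul hu.2)))
        (right_ne_zero_of_mul hu.2))
    unfold vPrime
    fun_prop

/-- The factors of invariance along `D_x` (for `i = 0`) and `D_y` (for `i = 1`). -/
def factor (E : PDEPair) (c : Fin 3 → Jet → ℝ) (i : Fin 2) (u : Jet) : ℝ :=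
  if i = 0 then E.Rp u - E.Ts u * E.Rq u - c 1 u else E.Tq u - E.Rs u * E.Tp u - c 0 u

end PDEPair

/-! ### Conformal invariance of the forms along solutions. -/

namespace IsFamily

variable {E : PDEPair} {W : Set (Plane × Param)} {ψ : Plane × Param → ℝ}

theorem mono (h : IsFamily E W ψ) {W' : Set (Plane × Param)} (hW' : IsOpen W') (hs : W' ⊆ W) :
    IsFamily E W' ψ :=
  ⟨hW', h.smooth.mono hs, fun w hw => h.mapsTo w (hs hw), fun w hw => h.eq_xx w (hs hw),
    fun w hw => h.eq_yy w (hs hw), fun w hw => h.immersion w (hs hw)⟩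

theorem isOpen_preimage (h : IsFamily E W ψ) {g : Jet → ℝ}
    (hg : ContDiffOn ℝ ∞ g E.domain) {s : Set ℝ} (hs : IsOpen s) :
    IsOpen {w ∈ W | g (jetMap ψ w) ∈ s} :=
  (h.smooth_comp hg).continuousOn.isOpen_inter_preimage h.isOpen hs

theorem isOpen_mul_ne (h : IsFamily E W ψ) (hE : E.Admissible) (k : ℝ) :
    IsOpen {w ∈ W | E.Rs (jetMap ψ w) * E.Ts (jetMap ψ w) ≠ k} :=
  h.isOpen_preimage (g := fun u => E.Rs u * E.Ts u) (hE.smooth_Rs.mul hE.smooth_Ts)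
    isOpen_compl_singleton

/-- The open set of all `t` with `(t, a) ∈ W`. -/
def sliceOpens (h : IsFamily E W ψ) (a : Param) : Opens Plane :=
  ⟨{t | (t, a) ∈ W}, h.isOpen.preimage (by fun_prop)⟩

theorem mapsTo_sliceOpens (h : IsFamily E W ψ) (a : Param) :
    MapsTo (fun t => (t, a)) (h.sliceOpens a) W := fun _ ht => ht

theorem smooth_comp_of_subset (h : IsFamily E W ψ) {c : Jet → ℝ} {s : Set Jet}
    (hc : ContDiffOn ℝ ∞ c s) (hs : ∀ w ∈ W, jetMap ψ w ∈ s) :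
    ContDiffOn ℝ ∞ (fun w => c (jetMap ψ w)) W :=
  hc.comp h.smooth_jet hs

theorem smooth_formVal (h : IsFamily E W ψ) (hE : E.Admissible) {c : Fin 3 → Jet → ℝ}
    (hc : ∀ i, ContDiffOn ℝ ∞ (fun w => c i (jetMap ψ w)) W) (v v' : Param) :
    ContDiffOn ℝ ∞ (fun w => E.formVal c (jetMap ψ w) (variation ψ w v) (variation ψ w v')) W := by
  have h0 := h.smooth_variation v
  have h1 := h.smooth_variation v'
  have r := h.smooth_comp hE.smooth_Rs
  have t := h.smooth_comp hE.smooth_Ts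
  have lin : ∀ {x y : Fin 4 → Plane × Param → ℝ}, (∀ i, ContDiffOn ℝ ∞ (x i) W) →
      (∀ i, ContDiffOn ℝ ∞ (y i) W) → ContDiffOn ℝ ∞ (fun w => x 0 w * (c 0 (jetMap ψ w) * y 1 w
        + c 1 (jetMap ψ w) * y 2 w + (1 - E.Rs (jetMap ψ w) * E.Ts (jetMap ψ w)) * y 3 w
        + c 2 (jetMap ψ w) * y 0 w)) W := fun hx hy =>
    (hx 0).mul (((((hc 0).mul (hy 1)).add ((hc 1).mul (hy 2))).add
      ((contDiffOn_const.sub (r.mul t)).mul (hy 3))).add ((hc 2).mul (hy 0)))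
  exact (((((lin h0 h1).add (lin h1 h0)).add (t.mul ((h0 1).mul (h1 1)))).sub
    ((h0 1).mul (h1 2))).sub ((h0 2).mul (h1 1))).add (r.mul ((h0 2).mul (h1 2)))

/-- The conditions on the coefficients in terms of the ring of functions on slices. -/
theorem parallel_of_slice (h : IsFamily E W ψ) (hE : E.Admissible) {c : Fin 3 → Jet → ℝ}
    (hc : ∀ i, ContDiffOn ℝ ∞ (fun w => c i (jetMap ψ w)) W)
    (hlow : ∀ a, (h.slice hE (h.mapsTo_sliceOpens a)).LowEqs
      (restrict (h.mapsTo_sliceOpens a) _ (hc 0)) (restrict (h.mapsTo_sliceOpens a) _ (hc 1)))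
    (hy : ∀ a, (h.slice hE (h.mapsTo_sliceOpens a)).y02
      (restrict (h.mapsTo_sliceOpens a) _ (hc 0)) (restrict (h.mapsTo_sliceOpens a) _ (hc 1))
      (restrict (h.mapsTo_sliceOpens a) _ (hc 2)) = 0) {w : Plane × Param} (hw : w ∈ W)
    (v : Param) (i : Fin 2) :
    fderiv ℝ (fun w => E.formVal c (jetMap ψ w) (variation ψ w v) (variation ψ w v)) w (planeVec i)
      = E.factor c i (jetMap ψ w)
        * E.formVal c (jetMap ψ w) (variation ψ w v) (variation ψ w v) := by
  obtain ⟨t, a⟩ := w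
  obtain ⟨hx, hy⟩ := (hlow a).quad_parallel (h.isVariation_sliceVar hE (h.mapsTo_sliceOpens a))
    (h.separating_sliceVar (h.mapsTo_sliceOpens a)) (h.isUnit_disc hE (h.mapsTo_sliceOpens a))
    (hy a) v
  have hq : (h.slice hE (h.mapsTo_sliceOpens a)).quad (restrict (h.mapsTo_sliceOpens a) _ (hc 0))
      (restrict (h.mapsTo_sliceOpens a) _ (hc 1)) (restrict (h.mapsTo_sliceOpens a) _ (hc 2))
      (h.sliceVar (h.mapsTo_sliceOpens a) v)
      = restrict (h.mapsTo_sliceOpens a) _ (h.smooth_formVal hE hc v v) := by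
    refine Subtype.ext (funext fun t => ?_)
    rw [restrict_apply]
    change 2 * variation ψ (t, a) v 0 * (_ * variation ψ (t, a) v 1 + _ * variation ψ (t, a) v 2
      + (1 - E.Rs (jetMap ψ (t, a)) * E.Ts (jetMap ψ (t, a))) * variation ψ (t, a) v 3
      + _ * variation ψ (t, a) v 0) + E.Ts (jetMap ψ (t, a)) * variation ψ (t, a) v 1 ^ 2
      - 2 * variation ψ (t, a) v 1 * variation ψ (t, a) v 2
      + E.Rs (jetMap ψ (t, a)) * variation ψ (t, a) v 2 ^ 2 = _
    rw [restrict_apply, restrict_apply, restrict_apply, PDEPair.formVal]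
    ring
  rw [hq] at hx hy
  change smoothOn.dir (Pi.single 0 1) _ = _ at hx
  change smoothOn.dir (Pi.single 1 1) _ = _ at hy
  rw [dir_restrict h.isOpen] at hx hy
  fin_cases i
  · exact congrFun (congrArg Subtype.val hx) ⟨t, hw⟩
  · exact congrFun (congrArg Subtype.val hy) ⟨t, hw⟩

section Slices

variable (h : IsFamily E W ψ) (hE : E.Admissible) {a : Param} {U : Opens Plane}
  (hU : MapsTo (fun t => (t, a)) U W)
include h hE

theorem isUnit_slice (hW : ∀ w ∈ W, E.Rs (jetMap ψ w) * E.Ts (jetMap ψ w) ≠ 4) :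
    IsUnit ((h.slice hE hU).r * (h.slice hE hU).t - 4) :=
  smoothOn.isUnit_iff.2 fun t => sub_ne_zero.2 (hW _ (hU t.2))

theorem inv_slice (hJ : E.Metricity) :
    (h.slice hE hU).inv1 = 0 ∧ (h.slice hE hU).inv2 = 0 :=
  ⟨Subtype.ext (funext fun t => (h.inv1_apply hE hU t).trans (hJ _ (h.mapsTo _ (hU t.2))).1),
    Subtype.ext (funext fun t => (h.inv2_apply hE hU t).trans (hJ _ (h.mapsTo _ (hU t.2))).2)⟩

theorem om1_apply (t : U) :
    ((h.slice hE hU).om1 : U → ℝ) t = E.omCoeff1 (jetMap ψ (t, a)) := by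
  simp only [JetAlgebra.om1, slice, h.dir_onSlice_zero hE, h.dir_onSlice_one hE]
  rfl

theorem om2_apply (t : U) :
    ((h.slice hE hU).om2 : U → ℝ) t = E.omCoeff2 (jetMap ψ (t, a)) := by
  simp only [JetAlgebra.om2, slice, h.dir_onSlice_zero hE, h.dir_onSlice_one hE]
  rfl

end Slices

end IsFamily

namespace IsFamily

variable {E : PDEPair} {W : Set (Plane × Param)} {ψ : Plane × Param → ℝ}

theorem smooth_coeffA_comp (h : IsFamily E W ψ) (hE : E.Admissible)
    (hW : ∀ w ∈ W, E.Rs (jetMap ψ w) * E.Ts (jetMap ψ w) ≠ 4) (i : Fin 3) :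
    ContDiffOn ℝ ∞ (fun w => E.coeffA i (jetMap ψ w)) W :=
  h.smooth_comp_of_subset (PDEPair.smooth_coeffA hE i) fun w hw => ⟨h.mapsTo w hw, hW w hw⟩

theorem smooth_coeffB_comp (h : IsFamily E W ψ) (hE : E.Admissible)
    (hW : ∀ w ∈ W, E.Rs (jetMap ψ w) * E.Ts (jetMap ψ w) ≠ 0) (i : Fin 3) :
    ContDiffOn ℝ ∞ (fun w => E.coeffB i (jetMap ψ w)) W :=
  h.smooth_comp_of_subset (PDEPair.smooth_coeffB hE i) fun w hw => ⟨h.mapsTo w hw, hW w hw⟩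

section

variable (h : IsFamily E W ψ) (hE : E.Admissible) (hJ : E.Metricity)
  (hW : ∀ w ∈ W, E.Rs (jetMap ψ w) * E.Ts (jetMap ψ w) ≠ 4)
include hJ

theorem sliceA (a : Param) {U : Opens Plane} (hU : MapsTo (fun t => (t, a)) U W) :
    (h.slice hE hU).LowEqs (restrict hU _ (h.smooth_coeffA_comp hE hW 0))
        (restrict hU _ (h.smooth_coeffA_comp hE hW 1)) ∧
      (h.slice hE hU).y02 (restrict hU _ (h.smooth_coeffA_comp hE hW 0))
        (restrict hU _ (h.smooth_coeffA_comp hE hW 1))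
        (restrict hU _ (h.smooth_coeffA_comp hE hW 2)) = 0 := by
  have hne : ∀ t : U, E.Rs (jetMap ψ (t, a)) * E.Ts (jetMap ψ (t, a)) - 4 ≠ 0 :=
    fun t => sub_ne_zero.2 (hW _ (hU t.2))
  have hu := h.isUnit_slice hE hU hW
  have ha : 2 * ((h.slice hE hU).r * (h.slice hE hU).t - 4)
      * restrict hU _ (h.smooth_coeffA_comp hE hW 0) = (h.slice hE hU).om1 := by
    refine Subtype.ext (funext fun t => ?_)
    rw [h.om1_apply hE hU]
    exact mul_div_cancel₀ _ (mul_ne_zero two_ne_zero (hne t))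
  have hb : 2 * ((h.slice hE hU).r * (h.slice hE hU).t - 4)
      * restrict hU _ (h.smooth_coeffA_comp hE hW 1) = (h.slice hE hU).om2 := by
    refine Subtype.ext (funext fun t => ?_)
    rw [h.om2_apply hE hU]
    exact mul_div_cancel₀ _ (mul_ne_zero two_ne_zero (hne t))
  have hc : 4 * ((h.slice hE hU).r * (h.slice hE hU).t - 4)
      * restrict hU _ (h.smooth_coeffA_comp hE hW 2) = (h.slice hE hU).twoV := by
    refine Subtype.ext (funext fun t => ?_)
    rw [h.twoV_apply hE hU]
    exact mul_div_cancel₀ _ (mul_ne_zero four_ne_zero (hne t))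
  obtain ⟨h1, h2⟩ := h.inv_slice hE hU hJ
  have low := JetAlgebra.lowEqs_of_inv h1 h2 hu ha hb
  -- The remainder `y01` does not involve c, so its vanishing may be taken from the commutation
  -- argument with c = 0, before the true c is known to work.
  exact ⟨low, low.y02_eq_zero hu ha hb hc (low.remainders (h.isVariation_sliceVar hE hU)
    (h.separating_sliceVar hU) (h.isUnit_disc hE hU) 0).2.1⟩

include h hE hW in
theorem parallelA {w : Plane × Param} (hw : w ∈ W) (v : Param) (i : Fin 2) :
    fderiv ℝ (fun w => E.formVal E.coeffA (jetMap ψ w) (variation ψ w v) (variation ψ w v)) w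
        (planeVec i) = E.factor E.coeffA i (jetMap ψ w)
        * E.formVal E.coeffA (jetMap ψ w) (variation ψ w v) (variation ψ w v) :=
  h.parallel_of_slice hE (h.smooth_coeffA_comp hE hW)
    (fun a => (h.sliceA hE hJ hW a (h.mapsTo_sliceOpens a)).1)
    (fun a => (h.sliceA hE hJ hW a (h.mapsTo_sliceOpens a)).2) hw v i

include h hE hW in
/-- The two forms agree up to the factor where both are defined. -/
theorem coeffA_eq_coeffB (hW0 : ∀ w ∈ W, E.Rs (jetMap ψ w) * E.Ts (jetMap ψ w) ≠ 0)
    {w : Plane × Param} (hw : w ∈ W) (i : Fin 3) :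
    E.coeffA i (jetMap ψ w) = E.coeffB i (jetMap ψ w) := by
  -- After clearing denominators, the two formulas for the coefficient of ν₁ differ by a multiple of
  -- J₂, and those for ν₂ by a multiple of J₁.
  have h0 : ∀ w ∈ W, E.coeffA 0 (jetMap ψ w) = E.coeffB 0 (jetMap ψ w) := by
    intro w hw
    have h1 := sub_ne_zero.2 (hW w hw)
    have h2 := right_ne_zero_of_mul (hW0 w hw)
    have hj := (hJ _ (h.mapsTo w hw)).2
    simp only [PDEPair.J2] at hj
    simp only [PDEPair.coeffA, PDEPair.coeffB, Matrix.cons_val, PDEPair.omCoeff1]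
    rw [div_eq_div_iff (mul_ne_zero two_ne_zero h1) h2]
    linear_combination 2 * hj
  have h1 : ∀ w ∈ W, E.coeffA 1 (jetMap ψ w) = E.coeffB 1 (jetMap ψ w) := by
    intro w hw
    have h1 := sub_ne_zero.2 (hW w hw)
    have h2 := left_ne_zero_of_mul (hW0 w hw)
    have hj := (hJ _ (h.mapsTo w hw)).1
    simp only [PDEPair.J1] at hj
    simp only [PDEPair.coeffA, PDEPair.coeffB, Matrix.cons_val, PDEPair.omCoeff2]
    rw [div_eq_div_iff (mul_ne_zero two_ne_zero h1) h2]
    linear_combination 2 * hj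
  obtain ⟨t, a⟩ := w
  have hU := h.mapsTo_sliceOpens a
  fin_cases i
  · exact h0 _ hw
  · exact h1 _ hw
  · obtain ⟨low, hy⟩ := h.sliceA hE hJ hW a hU
    have hr : IsUnit (h.slice hE hU).r :=
      smoothOn.isUnit_iff.2 fun t => left_ne_zero_of_mul (hW0 _ (hU t.2))
    have ht : IsUnit (h.slice hE hU).t :=
      smoothOn.isUnit_iff.2 fun t => right_ne_zero_of_mul (hW0 _ (hU t.2))
    have ha : (h.slice hE hU).t * restrict hU _ (h.smooth_coeffA_comp hE hW 0)
        = -(h.slice hE hU).dy (h.slice hE hU).t + 2 * (h.slice hE hU).tp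
          - (h.slice hE hU).r * (h.slice hE hU).tp * (h.slice hE hU).t
          + (h.slice hE hU).tq * (h.slice hE hU).t := by
      rw [restrict_congr (hg' := h.smooth_coeffB_comp hE hW0 0) h0]
      simp only [slice, h.dir_onSlice_one hE]
      exact Subtype.ext (funext fun t => mul_div_cancel₀ _ (right_ne_zero_of_mul (hW0 _ (hU t.2))))
    have hb : (h.slice hE hU).r * restrict hU _ (h.smooth_coeffA_comp hE hW 1)
        = -(h.slice hE hU).dx (h.slice hE hU).r + 2 * (h.slice hE hU).rq
          - (h.slice hE hU).rq * (h.slice hE hU).r * (h.slice hE hU).t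
          + (h.slice hE hU).rp * (h.slice hE hU).r := by
      rw [restrict_congr (hg' := h.smooth_coeffB_comp hE hW0 1) h1]
      simp only [slice, h.dir_onSlice_zero hE]
      exact Subtype.ext (funext fun t => mul_div_cancel₀ _ (left_ne_zero_of_mul (hW0 _ (hU t.2))))
    have hc : 2 * (h.slice hE hU).r ^ 3 * (h.slice hE hU).t
        * restrict hU _ (h.smooth_coeffB_comp hE hW0 2) = -(h.slice hE hU).vPrime := by
      refine Subtype.ext (funext fun t => ?_)
      change _ = -((h.slice hE hU).vPrime : _ → ℝ) t
      rw [h.vPrime_apply hE hU]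
      refine Eq.trans (mul_neg _ _) (congrArg Neg.neg (mul_div_cancel₀ _ ?_))
      exact mul_ne_zero (mul_ne_zero two_ne_zero (pow_ne_zero _ (left_ne_zero_of_mul
        (hW0 _ (hU t.2))))) (right_ne_zero_of_mul (hW0 _ (hU t.2)))
    have hy' := low.y02_eq_zero' hr ht ha hb hc
    -- With a and b already identified, both third coefficients solve `y02 = 0`, an equation in
    -- which c occurs only as 2c.
    have e := congrFun (congrArg Subtype.val (hy.trans hy'.symm)) ⟨t, hw⟩
    simp only [JetAlgebra.y02] at e
    change 2 * E.coeffA 2 (jetMap ψ (t, a)) + _ + _ + _ + _ - _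
      = 2 * E.coeffB 2 (jetMap ψ (t, a)) + _ + _ + _ + _ - _ at e
    change E.coeffA 2 _ = E.coeffB 2 _
    linarith

end

/-- The source and the jet space both have dimension 6, so an injective derivative is surjective and
the jet map is open. -/
theorem map_nhds_jet (h : IsFamily E W ψ) {w : Plane × Param} (hw : w ∈ W) :
    map (jetMap ψ) (𝓝 w) = 𝓝 (jetMap ψ w) := by
  have hs : HasStrictFDerivAt (jetMap ψ) (fderiv ℝ (jetMap ψ) w) w :=
    (h.smooth_jet.contDiffAt (h.isOpen.mem_nhds hw)).hasStrictFDerivAt (by simp)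
  refine hs.map_nhds_eq_of_surj (LinearMap.range_eq_top.2 ?_)
  refine (LinearMap.injective_iff_surjective_of_finrank_eq_finrank
    (f := (fderiv ℝ (jetMap ψ) w).toLinearMap) ?_).1 (h.immersion w hw)
  simp

/-- Otherwise the open jet map would carry a neighbourhood of the point onto an open set of jets on
which R_sT_s = 4, contrary to genericity. -/
theorem frequently_ne_four (h : IsFamily E W ψ) (hgen : E.Generic) {w : Plane × Param}
    (hw : w ∈ W) : ∃ᶠ w' in 𝓝 w, E.Rs (jetMap ψ w') * E.Ts (jetMap ψ w') ≠ 4 := by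
  intro hf
  have h1 : {u ∈ E.domain | E.Rs u * E.Ts u = 4} ∈ 𝓝 (jetMap ψ w) := by
    rw [← h.map_nhds_jet hw, mem_map]
    filter_upwards [hf, h.isOpen.mem_nhds hw] with w' h4 hw'
    exact ⟨h.mapsTo w' hw', not_not.1 h4⟩
  have h2 := mem_interior_iff_mem_nhds.2 h1
  rwa [hgen] at h2

/-- Away from R_sT_s = 4 the coefficients agree with those of (A), whose invariance is known. Both
sides are continuous and such points accumulate everywhere, so the identity extends to R_sT_s = 4.
-/
theorem parallelB (h : IsFamily E W ψ) (hE : E.Admissible) (hJ : E.Metricity) (hgen : E.Generic)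
    (hW : ∀ w ∈ W, E.Rs (jetMap ψ w) * E.Ts (jetMap ψ w) ≠ 0)
    {w : Plane × Param} (hw : w ∈ W) (v : Param) (i : Fin 2) :
    fderiv ℝ (fun w => E.formVal E.coeffB (jetMap ψ w) (variation ψ w v) (variation ψ w v)) w
        (planeVec i) = E.factor E.coeffB i (jetMap ψ w)
        * E.formVal E.coeffB (jetMap ψ w) (variation ψ w v) (variation ψ w v) := by
  have hB := h.smooth_coeffB_comp hE hW
  have hform := h.smooth_formVal hE hB v v
  have hfac : ContinuousOn (fun w => E.factor E.coeffB i (jetMap ψ w)) W := by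
    have c0 := (hB 0).continuousOn
    have c1 := (hB 1).continuousOn
    have r := (h.smooth_comp hE.smooth_Rs).continuousOn
    have t := (h.smooth_comp hE.smooth_Ts).continuousOn
    have rp := (h.smooth_comp hE.smooth_Rp).continuousOn
    have rq := (h.smooth_comp hE.smooth_Rq).continuousOn
    have tp := (h.smooth_comp hE.smooth_Tp).continuousOn
    have tq := (h.smooth_comp hE.smooth_Tq).continuousOn
    unfold PDEPair.factor
    split_ifs
    · exact (rp.sub (t.mul rq)).sub c1
    · exact (tq.sub (r.mul tp)).sub c0
  have hcont := ((contDiffOn_fderiv_apply h.isOpen hform (planeVec i)).continuousOn.sub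
    (hfac.mul hform.continuousOn)).continuousAt (h.isOpen.mem_nhds hw)
  rw [← sub_eq_zero]
  by_contra hne
  have hev := hcont.eventually_ne hne
  obtain ⟨w', h4, hw', hne'⟩ := ((h.frequently_ne_four hgen hw).and_eventually
    ((h.isOpen.eventually_mem hw).and hev)).exists
  have hop := h.isOpen_mul_ne hE 4
  have h' := h.mono hop fun w hw => hw.1
  have hw'' : w' ∈ {w ∈ W | E.Rs (jetMap ψ w) * E.Ts (jetMap ψ w) ≠ 4} := ⟨hw', h4⟩
  have hAB := fun w hw i => h'.coeffA_eq_coeffB hE hJ (fun w hw => hw.2)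
    (fun w hw => hW w hw.1) (w := w) hw i
  refine hne' (sub_eq_zero.2 ?_)
  have hval : ∀ w ∈ {w ∈ W | E.Rs (jetMap ψ w) * E.Ts (jetMap ψ w) ≠ 4},
      E.formVal E.coeffB (jetMap ψ w) (variation ψ w v) (variation ψ w v)
      = E.formVal E.coeffA (jetMap ψ w) (variation ψ w v) (variation ψ w v) := fun w hw => by
    simp only [PDEPair.formVal, hAB w hw]
  dsimp only [Pi.mul_apply]
  rw [h'.congr_fderiv hval hw'', hval w' hw'', h'.parallelA hE hJ (fun w hw => hw.2) hw'']
  simp only [PDEPair.factor, hAB w' hw'']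

end IsFamily

/-! ### Conformal transport -/

/-- Functions with a common logarithmic derivative are proportional along a connected set. -/
theorem proportional_of_fderiv_eq {P ι : Type*} [NormedAddCommGroup P] [NormedSpace ℝ P]
    {U : Set P} (hU : IsOpen U) (hconn : IsPreconnected U) {Q : ι → P → ℝ} {μ : P → P →L[ℝ] ℝ}
    (hQ : ∀ i, ∀ t ∈ U, HasFDerivAt (Q i) (Q i t • μ t) t) (hne : ∀ t ∈ U, ∃ i, Q i t ≠ 0)
    {t t' : P} (ht : t ∈ U) (ht' : t' ∈ U) : ∃ c : ℝ, 0 < c ∧ ∀ i, Q i t' = c * Q i t := by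
  -- Simultaneous positive proportionality is symmetric and transitive, so by connectedness it only
  -- has to be proved near each point.
  refine hconn.induction₂ (fun t t' => ∃ c : ℝ, 0 < c ∧ ∀ i, Q i t' = c * Q i t) ?_ ?_ ?_ ht ht'
  · intro t ht
    obtain ⟨j, hj⟩ := hne t ht
    have hcont : ContinuousAt (fun s => Q j s * Q j t) t :=
      (hQ j t ht).continuousAt.mul continuousAt_const
    have hpos : ∀ᶠ s in 𝓝 t, 0 < Q j s * Q j t :=
      hcont.eventually (lt_mem_nhds (mul_self_pos.2 hj))
    obtain ⟨r, hr, hball⟩ := Metric.eventually_nhds_iff_ball.1 (hpos.and (hU.mem_nhds ht))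
    refine mem_nhdsWithin_of_mem_nhds (Filter.mem_of_superset (Metric.ball_mem_nhds t hr)
      fun s hs => ?_)
    refine ⟨Q j s / Q j t, ?_, fun i => ?_⟩
    · rw [← mul_div_mul_right _ _ hj]
      exact div_pos (hball s hs).1 (mul_self_pos.2 hj)
    -- Numerator and denominator have the same logarithmic derivative μ, so the quotient has zero
    -- derivative on a ball where `Q j` does not vanish.
    · have hd : ∀ x ∈ Metric.ball t r, HasFDerivAt (fun x => Q i x / Q j x) (0 : P →L[ℝ] ℝ) x := by
        intro x hx
        have hjx : Q j x ≠ 0 := left_ne_zero_of_mul (hball x hx).1.ne'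
        have h1 := hQ i x (hball x hx).2
        have h2 := (hasDerivAt_inv hjx).comp_hasFDerivAt x (hQ j x (hball x hx).2)
        have h3 := h1.mul h2
        have hz : Q i x • -(Q j x ^ 2)⁻¹ • Q j x • μ x
            + ((fun y => y⁻¹) ∘ Q j) x • Q i x • μ x = 0 := by
          ext e
          simp
          field_simp
          ring
        rw [hz] at h3
        exact h3.congr_of_eventuallyEq (.of_forall fun x => div_eq_mul_inv _ _)
      have hc := (convex_ball t r).is_const_of_fderivWithin_eq_zero (𝕜 := ℝ)
        (f := fun x => Q i x / Q j x)
        (fun x hx => (hd x hx).differentiableAt.differentiableWithinAt)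
        (fun x hx => ((hd x hx).hasFDerivWithinAt).fderivWithin
          (Metric.isOpen_ball.uniqueDiffWithinAt hx)) hs (Metric.mem_ball_self hr)
      have hjs : Q j s ≠ 0 := left_ne_zero_of_mul (hball s hs).1.ne'
      field_simp at hc ⊢
      linear_combination hc
  · rintro x y z - - - ⟨c, hc, h1⟩ ⟨d, hd, h2⟩
    exact ⟨d * c, mul_pos hd hc, fun i => by rw [h2, h1, mul_assoc]⟩
  · rintro x y - - ⟨c, hc, h1⟩
    exact ⟨c⁻¹, inv_pos.2 hc, fun i => by rw [h1, inv_mul_cancel_left₀ hc.ne']⟩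

/-! ### Bilinear forms on the space of parameters -/

/-- The sum of the squares of the coefficients. -/
def normSq (B : Bil Param) : ℝ := ∑ i, ∑ j, B (Pi.single i 1) (Pi.single j 1) ^ 2

theorem bil_ext {B B' : Bil Param}
    (h : ∀ i j, B (Pi.single i 1) (Pi.single j 1) = B' (Pi.single i 1) (Pi.single j 1)) :
    B = B' := by
  refine ContinuousLinearMap.coe_injective ?_
  refine LinearMap.pi_ext' fun i => LinearMap.ext_ring ?_
  refine ContinuousLinearMap.coe_injective ?_
  exact LinearMap.pi_ext' fun j => LinearMap.ext_ring (h i j)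

theorem zero_smul_bil {V : Type*} [NormedAddCommGroup V] [NormedSpace ℝ V] (B : Bil V) :
    (0 : ℝ) • B = 0 := by
  ext v w
  simp

theorem normSq_smul (c : ℝ) (B : Bil Param) : normSq (c • B) = c ^ 2 * normSq B := by
  simp [normSq, Finset.mul_sum, mul_pow]

theorem normSq_pos {B : Bil Param} (hB : B ≠ 0) : 0 < normSq B := by
  have h0 : 0 ≤ normSq B := Finset.sum_nonneg fun _ _ => Finset.sum_nonneg fun _ _ => sq_nonneg _
  refine h0.lt_of_ne fun h => hB (bil_ext fun i j => ?_)
  have h1 := (Finset.sum_eq_zero_iff_of_nonneg (fun i _ => Finset.sum_nonneg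
    fun j _ => sq_nonneg _)).1 h.symm i (Finset.mem_univ i)
  have h2 := (Finset.sum_eq_zero_iff_of_nonneg (fun j _ => sq_nonneg _)).1 h1 j (Finset.mem_univ j)
  simpa using h2

/-- The positive multiple of norm one. -/
def normalize (B : Bil Param) : Bil Param := (Real.sqrt (normSq B))⁻¹ • B

/-- Normalization forgets positive factors only. This is why the factor along a solution has to be
shown positive, not merely nonzero. -/
theorem normalize_smul {c : ℝ} (hc : 0 < c) (B : Bil Param) : normalize (c • B) = normalize B := by
  rw [normalize, normalize, normSq_smul, Real.sqrt_mul (sq_nonneg c), Real.sqrt_sq hc.le,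
    smul_smul, mul_inv, mul_right_comm, inv_mul_cancel₀ hc.ne', one_mul]

theorem contDiffOn_bil {V : Type*} [NormedAddCommGroup V] [NormedSpace ℝ V] {B : V → Bil Param}
    {s : Set V} : ContDiffOn ℝ ∞ B s ↔ ∀ v v', ContDiffOn ℝ ∞ (fun x => B x v v') s := by
  rw [contDiffOn_clm_apply]
  exact forall_congr' fun v => contDiffOn_clm_apply

theorem contDiffOn_normSq {V : Type*} [NormedAddCommGroup V] [NormedSpace ℝ V] {B : V → Bil Param}
    {s : Set V} (hB : ContDiffOn ℝ ∞ B s) : ContDiffOn ℝ ∞ (fun x => normSq (B x)) s :=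
  ContDiffOn.sum fun _ _ => ContDiffOn.sum fun _ _ => (contDiffOn_bil.1 hB _ _).pow 2

theorem contDiffOn_normalize {V : Type*} [NormedAddCommGroup V] [NormedSpace ℝ V]
    {B : V → Bil Param} {s : Set V} (hB : ContDiffOn ℝ ∞ B s) (h0 : ∀ x ∈ s, B x ≠ 0) :
    ContDiffOn ℝ ∞ (fun x => normalize (B x)) s :=
  contDiffOn_bil.2 fun v v' =>
    (((contDiffOn_normSq hB).sqrt fun x hx => (normSq_pos (h0 x hx)).ne').inv
      fun x hx => (Real.sqrt_pos.2 (normSq_pos (h0 x hx))).ne').mul (contDiffOn_bil.1 hB v v')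

/-- Smooth fields of proportional nondegenerate forms are conformal. -/
theorem conformalOn_of_proportional {A : Set Param} {h h' : Param → Bil Param}
    (hh : IsMetricOn A h) (hh' : ContDiffOn ℝ ∞ h' A) (hne : ∀ a ∈ A, h' a ≠ 0)
    (hp : ∀ a ∈ A, ∃ c : ℝ, h' a = c • h a) : ConformalOn A h' h := by
  have h0 : ∀ a ∈ A, h a ≠ 0 := by
    intro a ha h0
    have := hh.nondegenerate a ha (Pi.single 0 1) fun w => by rw [h0]; rfl
    simpa using congrFun this 0
  -- The coefficient of the projection of `h'` onto `h` in the Euclidean inner product of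
  -- coefficient matrices. It is manifestly smooth, and equals the pointwise factor wherever the two
  -- forms are proportional.
  set c : Param → ℝ := fun a => (∑ i, ∑ j, h' a (Pi.single i 1) (Pi.single j 1)
    * h a (Pi.single i 1) (Pi.single j 1)) / normSq (h a) with hc
  refine ⟨c, ?_, fun a ha => ?_⟩
  · refine ContDiffOn.div ?_ (contDiffOn_normSq hh.smooth) fun a ha => (normSq_pos (h0 a ha)).ne'
    exact ContDiffOn.sum fun i _ => ContDiffOn.sum fun j _ =>
      (contDiffOn_bil.1 hh' _ _).mul (contDiffOn_bil.1 hh.smooth _ _)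
  · obtain ⟨k, hk⟩ := hp a ha
    have hck : c a = k := by
      simp only [hc, hk, smul_apply, smul_eq_mul]
      rw [div_eq_iff (normSq_pos (h0 a ha)).ne', normSq]
      simp only [Finset.mul_sum]
      exact Finset.sum_congr rfl fun i _ => Finset.sum_congr rfl fun j _ => by ring
    rw [hck]
    exact ⟨fun h => hne a ha (by rw [hk, h, zero_smul_bil]), hk⟩

/-! ### A representative of the class that is regular everywhere. -/

namespace PDEPair

variable (E : PDEPair)

/-- The coefficients of a form of the conformal class which is regular everywhere. -/
def canon (i : Fin 3) (u : Jet) : ℝ :=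
  if 0 < 1 - E.Rs u * E.Ts u then E.coeffA i u else E.coeffB i u

variable {E}

/-- If 1 - R_sT_s > 0 then R_sT_s < 1, so (A) is defined; if 1 - R_sT_s < 0 then R_sT_s > 1, so (B)
is. As 1 - R_sT_s never vanishes, these two open regions cover the jet space. -/
theorem ne_four_of_pos {u : Jet} (hu : 0 < 1 - E.Rs u * E.Ts u) : E.Rs u * E.Ts u ≠ 4 := by
  intro h
  linarith

theorem ne_zero_of_neg {u : Jet} (hu : 1 - E.Rs u * E.Ts u < 0) : E.Rs u * E.Ts u ≠ 0 := by
  intro h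
  linarith

theorem formVal_congr {c c' : Fin 3 → Jet → ℝ} {u : Jet} (h : ∀ i, c i u = c' i u)
    (ξ η : Fin 4 → ℝ) : E.formVal c u ξ η = E.formVal c' u ξ η := by
  simp only [formVal, h]

theorem formVal_comm (c : Fin 3 → Jet → ℝ) (u : Jet) (ξ η : Fin 4 → ℝ) :
    E.formVal c u ξ η = E.formVal c u η ξ := by
  simp only [formVal]
  ring

theorem formVal_polar (c : Fin 3 → Jet → ℝ) (u : Jet) (ξ η : Fin 4 → ℝ) :
    E.formVal c u ξ η = (E.formVal c u (ξ + η) (ξ + η) - E.formVal c u ξ ξ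
      - E.formVal c u η η) / 2 := by
  simp only [formVal, Pi.add_apply]
  ring

/-- The quantity 1 - R_sT_s enters twice: it pairs λ with ν₃, and up to sign it is the determinant
of the binary form in ν₁, ν₂. The components can therefore be eliminated one after another. -/
theorem formVal_nondegenerate {c : Fin 3 → Jet → ℝ} {u : Jet} (hu : 1 - E.Rs u * E.Ts u ≠ 0)
    {ξ : Fin 4 → ℝ} (h : ∀ η, E.formVal c u ξ η = 0) : ξ = 0 := by
  have e3 := h ![0, 0, 0, 1]
  have e1 := h ![0, 1, 0, 0]
  have e2 := h ![0, 0, 1, 0]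
  have e0 := h ![1, 0, 0, 0]
  simp only [formVal, Matrix.cons_val] at e0 e1 e2 e3
  have h0 : ξ 0 = 0 := by
    apply mul_right_cancel₀ hu
    linear_combination e3
  have h2 : ξ 2 = 0 := by
    apply mul_right_cancel₀ hu
    linear_combination -e1 - E.Ts u * e2 + (c 0 u + E.Ts u * c 1 u) * h0
  have h1 : ξ 1 = 0 := by
    linear_combination -e2 + c 1 u * h0 + E.Rs u * h2
  have h3 : ξ 3 = 0 := by
    apply mul_right_cancel₀ hu
    linear_combination e0 - c 0 u * h1 - c 1 u * h2 - 2 * c 2 u * h0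
  funext i
  fin_cases i <;> assumption

theorem exists_formVal_ne_zero {c : Fin 3 → Jet → ℝ} {u : Jet} (hu : 1 - E.Rs u * E.Ts u ≠ 0) :
    ∃ ξ, E.formVal c u ξ ξ ≠ 0 := by
  -- On (1, 0, 0, x) the form is 2((1 - R_sT_s)x + c₂); this x makes it 1.
  refine ⟨![1, 0, 0, (1 - 2 * c 2 u) / (2 * (1 - E.Rs u * E.Ts u))], ?_⟩
  have : E.formVal c u ![1, 0, 0, (1 - 2 * c 2 u) / (2 * (1 - E.Rs u * E.Ts u))]
      ![1, 0, 0, (1 - 2 * c 2 u) / (2 * (1 - E.Rs u * E.Ts u))] = 1 := by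
    simp only [formVal, Matrix.cons_val]
    field_simp
    ring
  rw [this]
  exact one_ne_zero

end PDEPair

/-- The restriction to the directions of the parameters of the pullback by the jet. -/
def vert (ψ : Plane × Param → ℝ) (g : Jet → Bil Jet) (w : Plane × Param) : Bil Param :=
  (pullback (jetMap ψ) g w).bilinearComp (ContinuousLinearMap.inr ℝ Plane Param)
    (ContinuousLinearMap.inr ℝ Plane Param)

/-- The regular form of the conformal class. -/
def canonForm (E : PDEPair) (ψ : Plane × Param → ℝ) (w : Plane × Param) : Bil Param :=
  vert ψ (E.form E.canon) w

namespace IsFamily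

variable {E : PDEPair} {W : Set (Plane × Param)} {ψ : Plane × Param → ℝ}

section

variable (h : IsFamily E W ψ) (hE : E.Admissible) {w : Plane × Param} (hw : w ∈ W)
include h hE hw

/-- The forms λ, ν₁, ν₂, ν₃ annihilate `D_x` and `D_y`, the images of the plane directions. Only the
parameter part of a vector contributes, and its x and y components vanish. -/
theorem coframe_jet (e : Plane × Param) :
    E.coframe (jetMap ψ w) (fderiv ℝ (jetMap ψ) w e) = variation ψ w e.2 := by
  have hd := hE.nondegenerate _ (h.mapsTo w hw)
  have he : fderiv ℝ (jetMap ψ) w e = e.1 0 • E.fieldX (jetMap ψ w)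
      + e.1 1 • E.fieldY (jetMap ψ w) + fderiv ℝ (jetMap ψ) w (0, e.2) := by
    rw [← h.fderiv_jet_x hE hw, ← h.fderiv_jet_y hE hw, ← map_smul, ← map_smul, ← map_add,
      ← map_add]
    congr 1
    refine Prod.ext ?_ ?_
    · funext i
      fin_cases i <;> simp [planeVec]
    · simp [planeVec]
  have h0 : fderiv ℝ (jetMap ψ) w (0, e.2) 0 = 0 := h.fderiv_jet_zero hw _
  have h1 : fderiv ℝ (jetMap ψ) w (0, e.2) 1 = 0 := h.fderiv_jet_one hw _
  rw [he]
  generalize hD : fderiv ℝ (jetMap ψ) w (0, e.2) = D at h0 h1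
  have hv : ∀ i : Fin 4, variation ψ w e.2 i = D (i.natAdd 2) := fun i => by rw [← hD]; rfl
  set u := jetMap ψ w with hu
  have hx : ∀ i, (e.1 0 • E.fieldX u + e.1 1 • E.fieldY u + D) i
      = e.1 0 * E.fieldX u i + e.1 1 * E.fieldY u i + D i := fun i => rfl
  generalize e.1 0 • E.fieldX u + e.1 1 • E.fieldY u + D = x at hx
  have x0 := hx 0
  have x1 := hx 1
  simp only [PDEPair.fieldX, PDEPair.fieldY, Matrix.cons_val, h0, h1] at x0 x1
  funext i
  rw [hv]
  have xi := hx (i.natAdd 2)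
  fin_cases i
  · change x 2 - u 3 * x 0 - u 4 * x 1 = D 2
    change x 2 = e.1 0 * u 3 + e.1 1 * u 4 + D 2 at xi
    rw [x0, x1, xi]
    ring
  · change x 3 - E.R u * x 0 - u 5 * x 1 = D 3
    change x 3 = e.1 0 * E.R u + e.1 1 * u 5 + D 3 at xi
    rw [x0, x1, xi]
    ring
  · change x 4 - u 5 * x 0 - E.T u * x 1 = D 4
    change x 4 = e.1 0 * u 5 + e.1 1 * E.T u + D 4 at xi
    rw [x0, x1, xi]
    ring
  · change x 5 - E.Dy E.R u * x 0 - E.Dx E.T u * x 1 = D 5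
    change x 5 = e.1 0 * E.coeffDyR u + e.1 1 * E.coeffDxT u + D 5 at xi
    rw [x0, x1, xi, E.Dy_R hd, E.Dx_T hd]
    ring

theorem pullback_form (c : Fin 3 → Jet → ℝ) (e e' : Plane × Param) :
    pullback (jetMap ψ) (E.form c) w e e'
      = E.formVal c (jetMap ψ w) (variation ψ w e.2) (variation ψ w e'.2) := by
  rw [← h.coframe_jet hE hw, ← h.coframe_jet hE hw]
  exact E.form_apply c _ _ _

theorem vert_form (c : Fin 3 → Jet → ℝ) (v v' : Param) :
    vert ψ (E.form c) w v v' = E.formVal c (jetMap ψ w) (variation ψ w v) (variation ψ w v') :=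
  h.pullback_form hE hw c (0, v) (0, v')

theorem canonForm_apply (v v' : Param) : canonForm E ψ w v v'
    = E.formVal E.canon (jetMap ψ w) (variation ψ w v) (variation ψ w v') :=
  h.vert_form hE hw _ v v'

theorem canonForm_nondegenerate {v : Param} (hv : ∀ v', canonForm E ψ w v v' = 0) : v = 0 := by
  have h1 : variation ψ w v = 0 := by
    refine PDEPair.formVal_nondegenerate (c := E.canon) (hE.nondegenerate _ (h.mapsTo w hw))
      fun η => ?_
    obtain ⟨v', rfl⟩ := h.variation_surjective hw η
    rw [← h.canonForm_apply hE hw]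
    exact hv v'
  obtain ⟨L, hL⟩ := exists_variation_linear ψ w
  refine h.variation_injective hw (h1.trans ?_)
  rw [← hL, map_zero]

theorem canonForm_ne_zero : canonForm E ψ w ≠ 0 := by
  obtain ⟨ξ, hξ⟩ := PDEPair.exists_formVal_ne_zero (c := E.canon)
    (hE.nondegenerate _ (h.mapsTo w hw))
  obtain ⟨v, rfl⟩ := h.variation_surjective hw ξ
  intro h0
  rw [← h.canonForm_apply hE hw, h0] at hξ
  exact hξ rfl

end

section

variable (h : IsFamily E W ψ) (hE : E.Admissible)
include h hE

theorem isOpen_pos : IsOpen {w ∈ W | 0 < 1 - E.Rs (jetMap ψ w) * E.Ts (jetMap ψ w)} :=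
  h.isOpen_preimage hE.smooth_disc isOpen_Ioi

theorem isOpen_neg : IsOpen {w ∈ W | 1 - E.Rs (jetMap ψ w) * E.Ts (jetMap ψ w) < 0} :=
  h.isOpen_preimage hE.smooth_disc isOpen_Iio

/-- The family is covered by the open sets where `canon` is `coeffA` and `coeffB`. -/
theorem canon_cases {w : Plane × Param} (hw : w ∈ W) :
    (∃ W' ⊆ W, w ∈ W' ∧ IsOpen W' ∧ (∀ w ∈ W', E.Rs (jetMap ψ w) * E.Ts (jetMap ψ w) ≠ 4) ∧
      ∀ w ∈ W', ∀ i, E.canon i (jetMap ψ w) = E.coeffA i (jetMap ψ w)) ∨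
    (∃ W' ⊆ W, w ∈ W' ∧ IsOpen W' ∧ (∀ w ∈ W', E.Rs (jetMap ψ w) * E.Ts (jetMap ψ w) ≠ 0) ∧
      ∀ w ∈ W', ∀ i, E.canon i (jetMap ψ w) = E.coeffB i (jetMap ψ w)) := by
  rcases lt_or_gt_of_ne (hE.nondegenerate _ (h.mapsTo w hw)).symm with hpos | hneg
  · exact .inl ⟨{w ∈ W | 0 < 1 - E.Rs (jetMap ψ w) * E.Ts (jetMap ψ w)}, fun w hw => hw.1, ⟨hw, hpos⟩, h.isOpen_pos hE,
      fun w hw => PDEPair.ne_four_of_pos hw.2, fun w hw i => if_pos hw.2⟩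
  · exact .inr ⟨{w ∈ W | 1 - E.Rs (jetMap ψ w) * E.Ts (jetMap ψ w) < 0}, fun w hw => hw.1, ⟨hw, hneg⟩, h.isOpen_neg hE,
      fun w hw => PDEPair.ne_zero_of_neg hw.2, fun w hw i => if_neg hw.2.not_gt⟩

theorem smooth_canon (i : Fin 3) : ContDiffOn ℝ ∞ (fun w => E.canon i (jetMap ψ w)) W := by
  intro w hw
  rcases h.canon_cases hE hw with ⟨W', hs, hw', hop, hne, heq⟩ | ⟨W', hs, hw', hop, hne, heq⟩
  · exact ((((h.mono hop hs).smooth_coeffA_comp hE hne i).congr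
      fun w hw => heq w hw i).contDiffAt (hop.mem_nhds hw')).contDiffWithinAt
  · exact ((((h.mono hop hs).smooth_coeffB_comp hE hne i).congr
      fun w hw => heq w hw i).contDiffAt (hop.mem_nhds hw')).contDiffWithinAt

theorem smooth_canonForm : ContDiffOn ℝ ∞ (canonForm E ψ) W :=
  contDiffOn_bil.2 fun v v' => (h.smooth_formVal hE (h.smooth_canon hE) v v').congr
    fun _ hw => h.canonForm_apply hE hw v v'

theorem parallel_canon (hJ : E.Metricity) (hgen : E.Generic) {w : Plane × Param} (hw : w ∈ W)
    (v : Param) (i : Fin 2) :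
    fderiv ℝ (fun w => E.formVal E.canon (jetMap ψ w) (variation ψ w v) (variation ψ w v)) w
        (planeVec i) = E.factor E.canon i (jetMap ψ w)
        * E.formVal E.canon (jetMap ψ w) (variation ψ w v) (variation ψ w v) := by
  rcases h.canon_cases hE hw with ⟨W', hs, hw', hop, hne, heq⟩ | ⟨W', hs, hw', hop, hne, heq⟩
  · have h' := h.mono hop hs
    rw [h'.congr_fderiv (fun w hw => PDEPair.formVal_congr (heq w hw) _ _) hw',
      PDEPair.formVal_congr (heq w hw'), h'.parallelA hE hJ hne hw']
    simp only [PDEPair.factor, heq w hw']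
  · have h' := h.mono hop hs
    rw [h'.congr_fderiv (fun w hw => PDEPair.formVal_congr (heq w hw) _ _) hw',
      PDEPair.formVal_congr (heq w hw'), h'.parallelB hE hJ hgen hne hw']
    simp only [PDEPair.factor, heq w hw']

/-- The regular form is constant along the solutions up to a positive factor. -/
theorem canonForm_proportional (hJ : E.Metricity) (hgen : E.Generic) {a : Param}
    (hconn : IsPreconnected {t : Plane | (t, a) ∈ W}) {t t' : Plane} (ht : (t, a) ∈ W)
    (ht' : (t', a) ∈ W) : ∃ c : ℝ, 0 < c ∧ canonForm E ψ (t', a) = c • canonForm E ψ (t, a) := by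
  set F : Param → Plane × Param → ℝ := fun v w =>
    E.formVal E.canon (jetMap ψ w) (variation ψ w v) (variation ψ w v) with hF
  set m : Fin 2 → Plane → ℝ := fun i t => E.factor E.canon i (jetMap ψ (t, a)) with hm
  obtain ⟨c, hc, hval⟩ := proportional_of_fderiv_eq (h.sliceOpens a).2 hconn
    (Q := fun v t => F v (t, a))
    (μ := fun t => m 0 t • (ContinuousLinearMap.proj (R := ℝ) (φ := fun _ : Fin 2 => ℝ) 0)
      + m 1 t • (ContinuousLinearMap.proj (R := ℝ) (φ := fun _ : Fin 2 => ℝ) 1))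
    (fun v t ht => by
      have h1 := hasFDerivAt_of_contDiffOn h.isOpen (h.smooth_formVal hE (h.smooth_canon hE) v v) ht
      have h2 : HasFDerivAt (fun t : Plane => (t, a)) (ContinuousLinearMap.inl ℝ Plane Param) t :=
        (hasFDerivAt_id t).prodMk (hasFDerivAt_const a t)
      have h3 := h1.comp t h2
      have hz : (fderiv ℝ (F v) (t, a)).comp (ContinuousLinearMap.inl ℝ Plane Param)
          = F v (t, a) • (m 0 t • (ContinuousLinearMap.proj (R := ℝ) (φ := fun _ : Fin 2 => ℝ) 0)
            + m 1 t • (ContinuousLinearMap.proj (R := ℝ) (φ := fun _ : Fin 2 => ℝ) 1)) := by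
        refine ContinuousLinearMap.ext fun e => ?_
        have he : ((e, 0) : Plane × Param) = e 0 • planeVec 0 + e 1 • planeVec 1 := by
          refine Prod.ext ?_ ?_
          · funext i
            fin_cases i <;> simp [planeVec]
          · simp [planeVec]
        have hp := fun i => h.parallel_canon hE hJ hgen ht v i
        change fderiv ℝ (F v) (t, a) (e, 0) = F v (t, a) * (m 0 t * e 0 + m 1 t * e 1)
        rw [he, map_add, map_smul, map_smul]
        refine (congrArg₂ (fun x y => e 0 • x + e 1 • y) (hp 0) (hp 1)).trans ?_
        simp only [smul_eq_mul]
        ring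
      rw [← hz]
      exact h3)
    (fun t ht => by
      obtain ⟨ξ, hξ⟩ := PDEPair.exists_formVal_ne_zero (c := E.canon)
        (hE.nondegenerate _ (h.mapsTo _ ht))
      obtain ⟨v, rfl⟩ := h.variation_surjective ht ξ
      exact ⟨v, hξ⟩) ht ht'
  refine ⟨c, hc, ContinuousLinearMap.ext fun v => ContinuousLinearMap.ext fun v' => ?_⟩
  change canonForm E ψ (t', a) v v' = c * canonForm E ψ (t, a) v v'
  have hadd : ∀ w, variation ψ w (v + v') = variation ψ w v + variation ψ w v' := by
    intro w
    obtain ⟨L, hL⟩ := exists_variation_linear ψ w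
    rw [← hL, ← hL, ← hL, map_add]
  -- The factor is the same for all vectors, so proportionality of the quadratic forms passes to the
  -- bilinear forms by polarization.
  have e1 := hval (v + v')
  simp only [hF, hadd] at e1
  rw [h.canonForm_apply hE ht, h.canonForm_apply hE ht', PDEPair.formVal_polar,
    PDEPair.formVal_polar (u := jetMap ψ (t, a)), e1]
  have e2 := hval v
  have e3 := hval v'
  simp only [hF] at e2 e3
  rw [e2, e3]
  ring

end

end IsFamily

/-! ### The conformal class on the space of parameters. -/

namespace GeneralSolution

variable {E : PDEPair} (S : GeneralSolution E)

theorem isOpen_params : IsOpen S.params := isOpenMap_snd _ S.isOpen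

theorem pullback_snd (h : Param → Bil Param) (w : Plane × Param) (e e' : Plane × Param) :
    pullback Prod.snd h w e e' = h w.2 e.2 e'.2 := by
  have : fderiv ℝ (Prod.snd : Plane × Param → Param) w = ContinuousLinearMap.snd ℝ Plane Param :=
    (ContinuousLinearMap.snd ℝ Plane Param).hasFDerivAt.fderiv
  rw [pullback, this]
  rfl

/-- The pullback of the regular form is the pullback of a form on the parameters. -/
theorem pullback_eq_smul (hE : E.Admissible) {h : Param → Bil Param} {c : Fin 3 → Jet → ℝ}
    {w : Plane × Param} (hw : w ∈ S.source) {k : ℝ} (hc : ∀ i, E.canon i (S.jet w) = c i (S.jet w))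
    (hk : canonForm E S.ψ w = k • h w.2) :
    pullback S.jet (E.form c) w = k • pullback Prod.snd h w := by
  refine ContinuousLinearMap.ext fun e => ContinuousLinearMap.ext fun e' => ?_
  change pullback (jetMap S.ψ) (E.form c) w e e' = k * pullback Prod.snd h w e e'
  rw [S.isFamily.pullback_form hE hw, pullback_snd,
    ← PDEPair.formVal_congr (c := E.canon) (u := jetMap S.ψ w) hc, ← S.isFamily.canonForm_apply hE hw, hk]
  rfl

theorem conformalOn_pullback {g g' : Jet → Bil Jet} {h : Param → Bil Param}
    {s : Set (Plane × Param)} {c k : Plane × Param → ℝ}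
    (hc : ContDiffOn ℝ ∞ c s) (hk : ContDiffOn ℝ ∞ k s) (hc0 : ∀ w ∈ s, c w ≠ 0)
    (hk0 : ∀ w ∈ s, k w ≠ 0) (hg : ∀ w ∈ s, g (S.jet w) = c w • g' (S.jet w))
    (hg' : ∀ w ∈ s, pullback S.jet g' w = k w • pullback Prod.snd h w) :
    ConformalOn s (pullback S.jet g) (pullback Prod.snd h) := by
  refine ⟨fun w => c w * k w, hc.mul hk, fun w hw => ⟨mul_ne_zero (hc0 w hw) (hk0 w hw), ?_⟩⟩
  refine ContinuousLinearMap.ext fun e => ContinuousLinearMap.ext fun e' => ?_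
  have h1 := congrArg (fun B : Bil (Plane × Param) => B e e') (hg' w hw)
  have h2 : pullback S.jet g w e e' = c w * pullback S.jet g' w e e' := by
    simp only [pullback, hg w hw]
    rfl
  rw [h2]
  change pullback S.jet g' w e e' = k w * pullback Prod.snd h w e e' at h1
  rw [h1]
  exact (mul_assoc _ _ _).symm

/-- The two forms agree with the regular form. -/
theorem canon_eq_coeffA (hE : E.Admissible) (hJ : E.Metricity) {w : Plane × Param}
    (hw : w ∈ S.source) (h4 : E.Rs (S.jet w) * E.Ts (S.jet w) ≠ 4) (i : Fin 3) :
    E.canon i (S.jet w) = E.coeffA i (S.jet w) := by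
  by_cases hpos : 0 < 1 - E.Rs (S.jet w) * E.Ts (S.jet w)
  · exact if_pos hpos
  · have hneg := lt_of_le_of_ne (not_lt.1 hpos) (hE.nondegenerate _ (S.mapsTo w hw))
    have hop := S.isFamily.isOpen_neg hE
    have h1 := S.isFamily.mono hop fun w hw => hw.1
    have h2 := h1.mono (h1.isOpen_mul_ne hE 4) fun w hw => hw.1
    exact (if_neg hpos).trans (h2.coeffA_eq_coeffB hE hJ (fun w hw => hw.2)
      (fun w hw => PDEPair.ne_zero_of_neg hw.1.2) ⟨⟨hw, hneg⟩, h4⟩ i).symm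

theorem canon_eq_coeffB (hE : E.Admissible) (hJ : E.Metricity) {w : Plane × Param}
    (hw : w ∈ S.source) (h0 : E.Rs (S.jet w) * E.Ts (S.jet w) ≠ 0) (i : Fin 3) :
    E.canon i (S.jet w) = E.coeffB i (S.jet w) := by
  by_cases hpos : 0 < 1 - E.Rs (S.jet w) * E.Ts (S.jet w)
  · have hop := S.isFamily.isOpen_pos hE
    have h1 := S.isFamily.mono hop fun w hw => hw.1
    have h2 := h1.mono (h1.isOpen_mul_ne hE 0) fun w hw => hw.1
    exact (if_pos hpos).trans (h2.coeffA_eq_coeffB hE hJ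
      (fun w hw => PDEPair.ne_four_of_pos hw.1.2) (fun w hw => hw.2) ⟨⟨hw, hpos⟩, h0⟩ i)
  · exact if_neg hpos

/-- The regular form is evaluated at any point of the solution and normalized. Since the slice is
connected, the form changes only by a positive factor along it, so the result depends on the
parameter alone. -/
theorem conformalClass_nonempty (hE : E.Admissible) (hJ : E.Metricity) (hgen : E.Generic) :
    S.conformalClass.Nonempty := by
  classical
  have hF := S.isFamily
  -- The value 0 is taken only outside `S.params`, where nothing is required.
  set h : Param → Bil Param := fun a => if H : ∃ t, (t, a) ∈ S.source then
    normalize (canonForm E S.ψ (H.choose, a)) else 0 with hh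
  have key : ∀ w ∈ S.source, h w.2 = normalize (canonForm E S.ψ w) := by
    rintro ⟨t, a⟩ hw
    have H : ∃ t, (t, a) ∈ S.source := ⟨t, hw⟩
    obtain ⟨c, hc, hval⟩ := hF.canonForm_proportional hE hJ hgen (S.slice_connected a) hw
      H.choose_spec
    rw [hh]
    simp only [dif_pos H]
    rw [hval, normalize_smul hc]
  have hsq : ∀ w ∈ S.source, 0 < Real.sqrt (normSq (canonForm E S.ψ w)) := fun w hw =>
    Real.sqrt_pos.2 (normSq_pos (hF.canonForm_ne_zero hE hw))
  have key' : ∀ w ∈ S.source,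
      canonForm E S.ψ w = Real.sqrt (normSq (canonForm E S.ψ w)) • h w.2 := by
    intro w hw
    rw [key w hw, normalize, smul_smul, mul_inv_cancel₀ (hsq w hw).ne', one_smul]
  have hsm : ContDiffOn ℝ ∞ (fun w => Real.sqrt (normSq (canonForm E S.ψ w))) S.source :=
    (contDiffOn_normSq (hF.smooth_canonForm hE)).sqrt fun w hw =>
      (normSq_pos (hF.canonForm_ne_zero hE hw)).ne'
  refine ⟨h, ⟨?_, ?_, ?_⟩, ?_, ?_⟩
  · rintro a ⟨⟨t, a⟩, hw, rfl⟩
    -- The chosen point may vary discontinuously with the parameter. Near a given parameter the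
    -- fixed t serves instead, and gives the same normalized form.
    have hop : IsOpen {a | (t, a) ∈ S.source} := S.isOpen.preimage (by fun_prop)
    have hs : ContDiffOn ℝ ∞ (fun a => normalize (canonForm E S.ψ (t, a)))
        {a | (t, a) ∈ S.source} :=
      (contDiffOn_normalize (hF.smooth_canonForm hE)
        fun w hw => hF.canonForm_ne_zero hE hw).comp
          (contDiff_const.prodMk contDiff_id).contDiffOn fun a ha => ha
    exact ((hs.congr fun a ha => key (t, a) ha).contDiffAt (hop.mem_nhds hw)).contDiffWithinAt
  · rintro a ⟨⟨t, a⟩, hw, rfl⟩ v v'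
    rw [key _ hw]
    change _ * canonForm E S.ψ (t, a) v v' = _ * canonForm E S.ψ (t, a) v' v
    rw [hF.canonForm_apply hE hw, hF.canonForm_apply hE hw, PDEPair.formVal_comm]
  · rintro a ⟨⟨t, a⟩, hw, rfl⟩ v hv
    refine hF.canonForm_nondegenerate hE hw fun v' => ?_
    rw [key' _ hw]
    exact mul_eq_zero_of_right _ (hv v')
  · refine S.conformalOn_pullback (g' := E.form E.coeffA)
      (c := fun w => 2 * (E.Rs (S.jet w) * E.Ts (S.jet w) - 4))
      (contDiffOn_const.mul (((hF.smooth_comp (hE.smooth_Rs.mul hE.smooth_Ts)).mono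
        fun w hw => hw.1).sub contDiffOn_const)) (hsm.mono fun w hw => hw.1)
      (fun w hw => mul_ne_zero two_ne_zero (sub_ne_zero.2 hw.2)) (fun w hw => (hsq w hw.1).ne')
      (fun w hw => E.g1_eq hw.2) fun w hw => ?_
    exact S.pullback_eq_smul hE hw.1 (S.canon_eq_coeffA hE hJ hw.1 hw.2) (key' w hw.1)
  · refine S.conformalOn_pullback (g' := E.form E.coeffB) (c := fun w => 1)
      contDiffOn_const (hsm.mono fun w hw => hw.1)
      (fun w hw => one_ne_zero) (fun w hw => (hsq w hw.1).ne')
      (fun w hw => by rw [E.g2_eq, one_smul]) fun w hw => ?_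
    exact S.pullback_eq_smul hE hw.1 (S.canon_eq_coeffB hE hJ hw.1 hw.2) (key' w hw.1)

/-- The metrics of the conformal class are pointwise multiples of the regular form. -/
theorem eq_smul_canonForm (hE : E.Admissible) {h : Param → Bil Param} (hh : h ∈ S.conformalClass)
    {w : Plane × Param} (hw : w ∈ S.source) :
    ∃ c : ℝ, c ≠ 0 ∧ h w.2 = c • canonForm E S.ψ w := by
  have fin : ∀ {c : Fin 3 → Jet → ℝ} {k : ℝ}, k ≠ 0 →
      (∀ i, E.canon i (S.jet w) = c i (S.jet w)) →
      (∀ e e', k * E.form c (S.jet w) (fderiv ℝ S.jet w e) (fderiv ℝ S.jet w e')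
        = pullback Prod.snd h w e e') →
      h w.2 = k • canonForm E S.ψ w := by
    intro c k hk hc hp
    refine ContinuousLinearMap.ext fun v => ContinuousLinearMap.ext fun v' => ?_
    change _ = k * canonForm E S.ψ w v v'
    rw [S.isFamily.canonForm_apply hE hw, PDEPair.formVal_congr (c' := c) (u := jetMap S.ψ w) hc,
      ← S.isFamily.vert_form hE hw]
    have := hp (0, v) (0, v')
    rw [pullback_snd] at this
    exact this.symm
  rcases lt_or_gt_of_ne (hE.nondegenerate _ (S.mapsTo w hw)).symm with hpos | hneg
  · have h4 : E.Rs (S.jet w) * E.Ts (S.jet w) ≠ 4 := PDEPair.ne_four_of_pos hpos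
    obtain ⟨c, -, hc⟩ := hh.2.1
    obtain ⟨hc0, hval⟩ := hc w ⟨hw, h4⟩
    have h4' : 2 * (E.Rs (S.jet w) * E.Ts (S.jet w) - 4) ≠ 0 :=
      mul_ne_zero two_ne_zero (sub_ne_zero.2 h4)
    refine ⟨_, mul_ne_zero (inv_ne_zero hc0) h4', fin (c := E.coeffA)
      (mul_ne_zero (inv_ne_zero hc0) h4') (fun i => if_pos hpos) fun e e' => ?_⟩
    have h1 := congrArg (fun B : Bil (Plane × Param) => B e e') hval
    change E.g1 (S.jet w) (fderiv ℝ S.jet w e) (fderiv ℝ S.jet w e')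
      = c w * pullback Prod.snd h w e e' at h1
    rw [E.g1_eq h4] at h1
    change 2 * (E.Rs (S.jet w) * E.Ts (S.jet w) - 4)
      * E.form E.coeffA (S.jet w) (fderiv ℝ S.jet w e) (fderiv ℝ S.jet w e') = _ at h1
    rw [mul_assoc, h1, inv_mul_cancel_left₀ hc0]
  · obtain ⟨c, -, hc⟩ := hh.2.2
    obtain ⟨hc0, hval⟩ := hc w ⟨hw, PDEPair.ne_zero_of_neg hneg⟩
    refine ⟨_, inv_ne_zero hc0, fin (c := E.coeffB) (inv_ne_zero hc0)
      (fun i => if_neg hneg.not_gt) fun e e' => ?_⟩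
    have h1 := congrArg (fun B : Bil (Plane × Param) => B e e') hval
    change E.g2 (S.jet w) (fderiv ℝ S.jet w e) (fderiv ℝ S.jet w e')
      = c w * pullback Prod.snd h w e e' at h1
    rw [E.g2_eq] at h1
    rw [h1, inv_mul_cancel_left₀ hc0]

end GeneralSolution

theorem IsMetricOn.ne_zero {A : Set Param} {h : Param → Bil Param} (hh : IsMetricOn A h)
    {a : Param} (ha : a ∈ A) : h a ≠ 0 := by
  intro h0
  have := hh.nondegenerate a ha (Pi.single 0 1) fun w => by rw [h0]; rfl
  simpa using congrFun this 0

theorem ConformalOn.isMetricOn {A : Set Param} {h h' : Param → Bil Param} (hh : IsMetricOn A h)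
    (hc : ConformalOn A h' h) : IsMetricOn A h' := by
  obtain ⟨c, hc, hval⟩ := hc
  have hv : ∀ a ∈ A, ∀ v w, h' a v w = c a * h a v w := fun a ha v w => by
    rw [(hval a ha).2]; rfl
  refine ⟨contDiffOn_bil.2 fun v v' => (hc.mul (contDiffOn_bil.1 hh.smooth v v')).congr
    fun a ha => hv a ha v v', fun a ha v w => ?_, fun a ha v hz => ?_⟩
  · rw [hv a ha, hv a ha, hh.symm a ha]
  · refine hh.nondegenerate a ha v fun w => ?_
    have := hz w
    rw [hv a ha] at this
    exact (mul_eq_zero.1 this).resolve_left (hval a ha).1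

namespace GeneralSolution

variable {E : PDEPair} (S : GeneralSolution E)

theorem conformalOn_pullback_snd {h h' : Param → Bil Param} (hc : ConformalOn S.params h' h)
    {s : Set (Plane × Param)} (hs : s ⊆ S.source) {G : Plane × Param → Bil (Plane × Param)}
    (hG : ConformalOn s G (pullback Prod.snd h)) : ConformalOn s G (pullback Prod.snd h') := by
  obtain ⟨c, hc, hval⟩ := hc
  obtain ⟨k, hk, hkval⟩ := hG
  have hmaps : MapsTo Prod.snd s S.params := fun w hw => ⟨w, hs hw, rfl⟩
  have hc0 : ∀ w ∈ s, c w.2 ≠ 0 := fun w hw => (hval _ (hmaps hw)).1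
  refine ⟨fun w => k w * (c w.2)⁻¹, hk.mul ((hc.comp contDiff_snd.contDiffOn hmaps).inv hc0),
    fun w hw => ⟨mul_ne_zero (hkval w hw).1 (inv_ne_zero (hc0 w hw)), ?_⟩⟩
  refine ContinuousLinearMap.ext fun e => ContinuousLinearMap.ext fun e' => ?_
  have h1 := congrArg (fun B : Bil (Plane × Param) => B e e') (hkval w hw).2
  change G w e e' = k w * pullback Prod.snd h w e e' at h1
  change G w e e' = k w * (c w.2)⁻¹ * pullback Prod.snd h' w e e'
  rw [h1, pullback_snd, pullback_snd, (hval _ (hmaps hw)).2]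
  change _ = k w * (c w.2)⁻¹ * (c w.2 * h w.2 e.2 e'.2)
  rw [mul_assoc, inv_mul_cancel_left₀ (hc0 w hw)]

/-- At each parameter all metrics of the class are nonzero multiples of one and the same
`canonForm`, hence of each other. Conversely, a conformal factor on the parameters pulls back to a
smooth factor that can be absorbed. -/
theorem mem_conformalClass_iff (hE : E.Admissible) {h h' : Param → Bil Param}
    (hh : h ∈ S.conformalClass) : h' ∈ S.conformalClass ↔ ConformalOn S.params h' h := by
  constructor
  · intro hh'
    refine conformalOn_of_proportional hh.1 hh'.1.smooth (fun a ha => hh'.1.ne_zero ha) ?_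
    rintro a ⟨w, hw, rfl⟩
    obtain ⟨c, hc, h1⟩ := S.eq_smul_canonForm hE hh hw
    obtain ⟨c', hc', h2⟩ := S.eq_smul_canonForm hE hh' hw
    refine ⟨c' * c⁻¹, ?_⟩
    rw [h1, h2, smul_smul, mul_assoc, inv_mul_cancel₀ hc, mul_one]
  · exact fun hc => ⟨hc.isMetricOn hh.1, S.conformalOn_pullback_snd hc (fun w hw => hw.1) hh.2.1,
      S.conformalOn_pullback_snd hc (fun w hw => hw.1) hh.2.2⟩

end GeneralSolution

/-! ### The signature -/

/-- A nondegenerate sum of squares with coefficients whose signs are, up to order, given by `σ`. -/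
theorem isDiagonalizableTo_of_sum {B : Bil Param} (hB : ∀ v, (∀ w, B v w = 0) → v = 0)
    {σ d : Fin 4 → ℝ} (ℓ : Param →ₗ[ℝ] (Fin 4 → ℝ))
    (hℓ : ∀ v w, B v w = ∑ i, d i * (ℓ v i * ℓ w i)) (e : Equiv.Perm (Fin 4))
    (hσ : ∀ i, σ i ^ 2 = 1) (hs : ∀ i, 0 < d i * σ (e i)) : IsDiagonalizableTo B σ := by
  -- As σ² = 1 and dσ > 0, the square root is that of |d|. Permuting and rescaling the given
  -- coordinates makes the form standard, and the required basis is dual to these new coordinates.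
  set m : Param →ₗ[ℝ] (Fin 4 → ℝ) := LinearMap.pi fun j =>
    Real.sqrt (d (e.symm j) * σ j) • (LinearMap.proj (e.symm j)).comp ℓ with hm
  have hmv : ∀ v j, m v j = Real.sqrt (d (e.symm j) * σ j) * ℓ v (e.symm j) := fun v j => rfl
  have hBm : ∀ v w, B v w = ∑ j, σ j * (m v j * m w j) := by
    intro v w
    rw [hℓ, ← e.symm.sum_comp]
    refine Finset.sum_congr rfl fun j _ => ?_
    have h1 := hs (e.symm j)
    rw [e.apply_symm_apply] at h1
    rw [hmv, hmv]
    have h2 := Real.mul_self_sqrt h1.le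
    linear_combination (-(σ j * ℓ v (e.symm j) * ℓ w (e.symm j))) * h2
      - (d (e.symm j) * ℓ v (e.symm j) * ℓ w (e.symm j)) * hσ j
  have hinj : Function.Injective m := by
    refine (injective_iff_map_eq_zero m).2 fun v hv => hB v fun w => ?_
    rw [hBm, hv]
    simp
  set L := LinearEquiv.ofInjectiveEndo m hinj with hL
  refine ⟨(Pi.basisFun ℝ (Fin 4)).map L.symm, fun i j => ?_⟩
  have hb : ∀ i, m (((Pi.basisFun ℝ (Fin 4)).map L.symm) i) = Pi.single i 1 := by
    intro i
    rw [Module.Basis.map_apply, Pi.basisFun_apply]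
    exact L.apply_symm_apply _
  rw [hBm, hb, hb]
  by_cases hij : i = j
  · subst hij
    rw [if_pos rfl, Finset.sum_eq_single i] <;> simp +contextual
  · rw [if_neg hij]
    refine Finset.sum_eq_zero fun k _ => ?_
    by_cases hk : k = i
    · subst hk
      simp [hij]
    · simp [hk]

namespace PDEPair

variable {E : PDEPair}

/-- The form is a difference of two squares plus a binary form of discriminant `1 - R_s T_s`. -/
theorem exists_formVal_eq_sum (c : Fin 3 → Jet → ℝ) {u : Jet} (hu : 1 - E.Rs u * E.Ts u ≠ 0) :
    ∃ (ℓ : (Fin 4 → ℝ) →ₗ[ℝ] (Fin 4 → ℝ)) (d₁ d₃ : ℝ), d₁ * d₃ * (1 - E.Rs u * E.Ts u) < 0 ∧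
      ∀ ξ η, E.formVal c u ξ η
        = ∑ i, ![1 / 2, d₁, -(1 / 2), d₃] i * (ℓ ξ i * ℓ η i) := by
  have hθ : ∃ θ : (Fin 4 → ℝ) →ₗ[ℝ] ℝ, ∀ ξ, θ ξ = c 0 u * ξ 1 + c 1 u * ξ 2
      + (1 - E.Rs u * E.Ts u) * ξ 3 + c 2 u * ξ 0 :=
    ⟨c 0 u • LinearMap.proj 1 + c 1 u • LinearMap.proj 2
      + (1 - E.Rs u * E.Ts u) • LinearMap.proj 3 + c 2 u • LinearMap.proj 0, fun ξ => rfl⟩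
  obtain ⟨θ, hθ⟩ := hθ
  set p : Fin 4 → (Fin 4 → ℝ) →ₗ[ℝ] ℝ := fun i => LinearMap.proj i with hp
  have hpv : ∀ i ξ, p i ξ = ξ i := fun i ξ => rfl
  -- In both cases 2λθ = ½(λ + θ)² - ½(λ - θ)². If T_s ≠ 0 the square in ν₁ is completed; if T_s = 0
  -- the rest is ν₂(R_sν₂ - 2ν₁), a product that is again half a difference of squares.
  by_cases ht : E.Ts u = 0
  · refine ⟨LinearMap.pi ![p 0 + θ, p 2 + (E.Rs u / 2) • p 2 - p 1, p 0 - θ,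
      p 2 - (E.Rs u / 2) • p 2 + p 1], 1 / 2, -(1 / 2), by rw [ht]; norm_num, fun ξ η => ?_⟩
    simp only [formVal, Fin.sum_univ_four, LinearMap.pi_apply, Matrix.cons_val, LinearMap.add_apply,
      LinearMap.sub_apply, LinearMap.smul_apply, hpv, hθ, smul_eq_mul, ht]
    ring
  · refine ⟨LinearMap.pi ![p 0 + θ, p 1 - (1 / E.Ts u) • p 2, p 0 - θ, p 2],
      E.Ts u, E.Rs u - 1 / E.Ts u, ?_, fun ξ η => ?_⟩
    · have : E.Ts u * (E.Rs u - 1 / E.Ts u) * (1 - E.Rs u * E.Ts u)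
          = -(1 - E.Rs u * E.Ts u) ^ 2 := by
        field_simp
        ring
      rw [this]
      exact neg_neg_of_pos (by positivity)
    · simp only [formVal, Fin.sum_univ_four, LinearMap.pi_apply, Matrix.cons_val,
        LinearMap.add_apply, LinearMap.sub_apply, LinearMap.smul_apply, hpv, hθ, smul_eq_mul]
      field_simp
      ring

end PDEPair

namespace GeneralSolution

variable {E : PDEPair} (S : GeneralSolution E)

/-- The diagonal entries are c/2, cd₁, -c/2, cd₃. The first and third have opposite signs, and d₁d₃
has the sign opposite to 1 - R_sT_s. The cases are the possible signs of c, d₁, d₃, each with the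
permutation that sorts the signs. -/
theorem signature (hE : E.Admissible) {h : Param → Bil Param} (hh : h ∈ S.conformalClass)
    {w : Plane × Param} (hw : w ∈ S.source) :
    (0 < 1 - E.Rs (S.jet w) * E.Ts (S.jet w) → IsSplit (h w.2)) ∧
      (1 - E.Rs (S.jet w) * E.Ts (S.jet w) < 0 → IsLorentzian (h w.2)) := by
  obtain ⟨c, hc, hval⟩ := S.eq_smul_canonForm hE hh hw
  obtain ⟨ℓ, d₁, d₃, hd, hsum⟩ := PDEPair.exists_formVal_eq_sum (E := E) E.canon
    (hE.nondegenerate _ (S.mapsTo w hw))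
  obtain ⟨L, hL⟩ := exists_variation_linear S.ψ w
  have hnd : ∀ v, (∀ v', h w.2 v v' = 0) → v = 0 :=
    hh.1.nondegenerate w.2 ⟨w, hw, rfl⟩
  have hB : ∀ v v', h w.2 v v' = ∑ i, ![c * (1 / 2), c * d₁, c * -(1 / 2), c * d₃] i
      * ((ℓ ∘ₗ L) v i * (ℓ ∘ₗ L) v' i) := by
    intro v v'
    rw [hval]
    change c * canonForm E S.ψ w v v' = _
    rw [S.isFamily.canonForm_apply hE hw]
    have := hsum (variation S.ψ w v) (variation S.ψ w v')
    rw [this]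
    simp only [Fin.sum_univ_four, Matrix.cons_val, LinearMap.comp_apply, hL]
    ring
  have mk := fun (σ : Fin 4 → ℝ) => isDiagonalizableTo_of_sum (σ := σ) hnd _ hB
  have half : c < 0 → c * 2⁻¹ < 0 := fun hc => mul_neg_of_neg_of_pos hc (by norm_num)
  constructor
  · intro hpos
    have hdd : d₁ * d₃ < 0 := by
      by_contra! hn
      exact absurd hd (not_lt.2 (mul_nonneg hn hpos.le))
    have hdd' : (c * d₁) * (c * d₃) < 0 := by
      have : (c * d₁) * (c * d₃) = c ^ 2 * (d₁ * d₃) := by ring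
      rw [this]
      exact mul_neg_of_pos_of_neg (by positivity) hdd
    rcases lt_or_gt_of_ne hc with hc | hc <;> rcases mul_neg_iff.1 hdd' with ⟨h1, h3⟩ | ⟨h1, h3⟩
    · refine mk _ (Equiv.swap 0 2) (fun i => by fin_cases i <;> norm_num) fun i => ?_
      fin_cases i <;> simp [Equiv.swap_apply_def, h1, h3, half hc]
    · refine mk _ (Equiv.swap 0 2 * Equiv.swap 1 3) (fun i => by fin_cases i <;> norm_num)
        fun i => ?_
      fin_cases i <;> simp [Equiv.swap_apply_def, h1, h3, half hc]
    · refine mk _ 1 (fun i => by fin_cases i <;> norm_num) fun i => ?_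
      fin_cases i <;> simp [h1, h3, hc]
    · refine mk _ (Equiv.swap 1 3) (fun i => by fin_cases i <;> norm_num) fun i => ?_
      fin_cases i <;> simp [Equiv.swap_apply_def, h1, h3, hc]
  · intro hneg
    have hdd : 0 < d₁ * d₃ := by
      by_contra! hn
      exact absurd hd (not_lt.2 (mul_nonneg_of_nonpos_of_nonpos hn hneg.le))
    have hdd' : 0 < (c * d₁) * (c * d₃) := by
      have : (c * d₁) * (c * d₃) = c ^ 2 * (d₁ * d₃) := by ring
      rw [this]
      exact mul_pos (by positivity) hdd
    rcases lt_or_gt_of_ne hc with hc | hc <;> rcases mul_pos_iff.1 hdd' with ⟨h1, h3⟩ | ⟨h1, h3⟩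
    · refine .inl (mk _ (Equiv.swap 0 3) (fun i => by fin_cases i <;> norm_num) fun i => ?_)
      fin_cases i <;> simp [Equiv.swap_apply_def, h1, h3, half hc]
    · refine .inr (mk _ (Equiv.swap 2 3) (fun i => by fin_cases i <;> norm_num) fun i => ?_)
      fin_cases i <;> simp [Equiv.swap_apply_def, h1, h3, half hc]
    · refine .inl (mk _ (Equiv.swap 2 3) (fun i => by fin_cases i <;> norm_num) fun i => ?_)
      fin_cases i <;> simp [Equiv.swap_apply_def, h1, h3, hc]
    · refine .inr (mk _ (Equiv.swap 0 3) (fun i => by fin_cases i <;> norm_num) fun i => ?_)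
      fin_cases i <;> simp [Equiv.swap_apply_def, h1, h3, hc]

end GeneralSolution

/-! ### Forms for which the variation of the solutions is null -/

/-- The inverse form of a nondegenerate symmetric form. -/
theorem exists_inverse_form {B : Bil Param} (hs : ∀ v w, B v w = B w v)
    (hB : ∀ v, (∀ w, B v w = 0) → v = 0) :
    ∃ N : Matrix (Fin 4) (Fin 4) ℝ, N.IsSymm ∧
      ∀ θ v : Param, B (N.mulVec θ) v = ∑ i, θ i * v i := by
  set M : Matrix (Fin 4) (Fin 4) ℝ := Matrix.of fun i j => B (Pi.single i 1) (Pi.single j 1) with hM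
  have hMs : M.IsSymm := Matrix.IsSymm.ext fun i j => hs _ _
  have hv : ∀ v : Param, v = ∑ i, v i • Pi.single i (1 : ℝ) := by
    intro v
    conv_lhs => rw [← Finset.univ_sum_single v]
    refine Finset.sum_congr rfl fun i _ => ?_
    rw [← Pi.single_smul]
    simp
  have hMv : ∀ v i, M.mulVec v i = B v (Pi.single i 1) := by
    intro v i
    rw [hs, Matrix.mulVec, dotProduct]
    conv_rhs => rw [hv v, map_sum]
    refine Finset.sum_congr rfl fun j _ => ?_
    rw [map_smul]
    exact mul_comm _ _
  have hBv : ∀ v w, B v w = ∑ i, M.mulVec v i * w i := by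
    intro v w
    conv_lhs => rw [hv w, map_sum]
    refine Finset.sum_congr rfl fun i _ => ?_
    rw [hMv, map_smul]
    exact mul_comm _ _
  have hu : IsUnit M := by
    rw [← Matrix.mulVec_injective_iff_isUnit]
    intro v w hvw
    refine sub_eq_zero.1 (hB (v - w) fun x => ?_)
    have hvw' : M.mulVec v = M.mulVec w := hvw
    rw [hBv, Matrix.mulVec_sub, hvw', sub_self]
    simp
  refine ⟨M⁻¹, ?_, fun θ v => ?_⟩
  · rw [Matrix.IsSymm, Matrix.transpose_nonsing_inv, hMs]
  · rw [hBv, Matrix.mulVec_mulVec, Matrix.mul_nonsing_inv _ ((Matrix.isUnit_iff_isUnit_det _).1 hu),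
      Matrix.one_mulVec]

/-- The differential of the solution with respect to the parameters is null for `B`. -/
def IsNullFor (B : Bil Param) (ψ : Plane × Param → ℝ) (w : Plane × Param) : Prop :=
  ∃ e, (∀ v, B e v = variation ψ w v 0) ∧ variation ψ w e 0 = 0

namespace IsFamily

variable {E : PDEPair} {W : Set (Plane × Param)} {ψ : Plane × Param → ℝ} {a : Param}
  {U : Opens Plane}

theorem pairing_apply (N : Matrix (Fin 4) (Fin 4) ℝ) (u v : Fin 4 → smoothOn U) (t : U) :
    ((JetAlgebra.pairing N u v : smoothOn U) : U → ℝ) t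
      = ∑ i, (u i : U → ℝ) t * N.mulVec (fun j => (v j : U → ℝ) t) i := by
  set ev : smoothOn U →ₗ[ℝ] ℝ :=
    (LinearMap.proj (R := ℝ) (φ := fun _ : U => ℝ) t).comp (smoothOn U).val.toLinearMap with hev
  change ev (JetAlgebra.pairing N u v) = _
  simp only [JetAlgebra.pairing, map_sum, map_smul]
  refine Finset.sum_congr rfl fun i _ => ?_
  rw [Matrix.mulVec, dotProduct, Finset.mul_sum]
  refine Finset.sum_congr rfl fun j _ => ?_
  change N i j * ((u i : U → ℝ) t * (v j : U → ℝ) t) = _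
  ring

variable (h : IsFamily E W ψ) (hE : E.Admissible) (hU : MapsTo (fun t => (t, a)) U W)

/-- The components of the inverse form. -/
def pairingVar (N : Matrix (Fin 4) (Fin 4) ℝ) (k l : Fin 4) : smoothOn U :=
  JetAlgebra.pairing N (fun i => h.sliceVar hU (Pi.single i 1) k)
    (fun i => h.sliceVar hU (Pi.single i 1) l)

theorem variation_eq_sum (ψ : Plane × Param → ℝ) (w : Plane × Param) (v : Param) (k : Fin 4) :
    variation ψ w v k = ∑ i, variation ψ w (Pi.single i 1) k * v i := by
  obtain ⟨L, hL⟩ := exists_variation_linear ψ w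
  simp only [← hL]
  conv_lhs => rw [← Finset.univ_sum_single v, map_sum, Finset.sum_apply]
  refine Finset.sum_congr rfl fun i _ => ?_
  have : (Pi.single i (v i) : Param) = v i • (Pi.single i (1 : ℝ) : Param) := by
    rw [← Pi.single_smul]; simp
  rw [this, map_smul, mul_comm]
  rfl

/-- The vector dual to the `l`-th component of the variation. -/
def dualVec (ψ : Plane × Param → ℝ) (w : Plane × Param) (N : Matrix (Fin 4) (Fin 4) ℝ)
    (l : Fin 4) : Param :=
  N.mulVec fun i => variation ψ w (Pi.single i 1) l

theorem pairingVar_apply (N : Matrix (Fin 4) (Fin 4) ℝ) (k l : Fin 4) (t : U) :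
    (h.pairingVar hU N k l : U → ℝ) t = variation ψ (t, a) (dualVec ψ (t, a) N l) k := by
  rw [pairingVar, pairing_apply, variation_eq_sum]
  rfl

include h in
theorem eq_zero_of_variation {w : Plane × Param} (hw : w ∈ W) {v : Param}
    (hv : ∀ k, variation ψ w v k = 0) : v = 0 := by
  obtain ⟨L, hL⟩ := exists_variation_linear ψ w
  refine h.variation_injective hw ((funext hv).trans ?_)
  rw [← hL, map_zero]
  rfl

/-- The inverse of a fixed form pairs the covectors λ, ν₁, ν₂, ν₃ on the parameters by a constant
matrix, and `IsNullFor` says that λ is null for it. So the algebra of null pairings applies on the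
slice. -/
theorem nullPairing_pairingVar {B : Bil Param} {N : Matrix (Fin 4) (Fin 4) ℝ} (hN : N.IsSymm)
    (hB : ∀ v, (∀ w, B v w = 0) → v = 0)
    (hBN : ∀ θ v : Param, B (N.mulVec θ) v = ∑ i, θ i * v i)
    (hnull : ∀ t ∈ U, IsNullFor B ψ (t, a)) :
    (h.slice hE hU).NullPairing (h.pairingVar hU N) ∧ IsUnit (h.pairingVar hU N 0 3) := by
  have hdual : ∀ w l v, B (dualVec ψ w N l) v = variation ψ w v l := fun w l v => by
    rw [dualVec, hBN, ← variation_eq_sum]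
  have hnp : (h.slice hE hU).NullPairing (h.pairingVar hU N) := by
    refine JetAlgebra.nullPairing (fun i => h.isVariation_sliceVar hE hU _) hN
      (Subtype.ext (funext fun t => ?_))
    obtain ⟨e, he, he0⟩ := hnull t t.2
    have : dualVec ψ (t, a) N 0 = e := sub_eq_zero.1 (hB _ fun v => by
      rw [map_sub]
      change B _ v - B e v = 0
      rw [hdual, he, sub_self])
    exact (h.pairingVar_apply hU N 0 0 t).trans (by rw [this, he0]; rfl)
  refine ⟨hnp, smoothOn.isUnit_iff.2 fun t h03 => ?_⟩
  -- If `H 0 3` vanished at a point, the vector dual to λ would have zero components in the whole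
  -- coframe and so be zero, while λ itself is not.
  have hz : dualVec ψ (t, a) N 0 = 0 := h.eq_zero_of_variation (hU t.2) fun k => by
    rw [← h.pairingVar_apply hU N k 0 t]
    fin_cases k
    · exact congrFun (congrArg Subtype.val hnp.h00) t
    · exact congrFun (congrArg Subtype.val ((hnp.symm 1 0).trans hnp.h01)) t
    · exact congrFun (congrArg Subtype.val ((hnp.symm 2 0).trans hnp.h02)) t
    · exact (congrFun (congrArg Subtype.val (hnp.symm 3 0)) t).trans h03
  obtain ⟨v, hv⟩ := h.variation_surjective (hU t.2) (Pi.single 0 1)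
  have h1 := hdual (t, a) 0 v
  rw [hz, map_zero, hv] at h1
  simp at h1

include h hE in
/-- If the differentials of the solutions are null for a fixed form, then the relative invariants
vanish. -/
theorem metricity_of_null {B : Bil Param} (hs : ∀ v w, B v w = B w v)
    (hB : ∀ v, (∀ w, B v w = 0) → v = 0) (hU : MapsTo (fun t => (t, a)) U W)
    (hnull : ∀ t ∈ U, IsNullFor B ψ (t, a)) {t : Plane} (ht : t ∈ U) :
    E.J1 (jetMap ψ (t, a)) = 0 ∧ E.J2 (jetMap ψ (t, a)) = 0 := by
  obtain ⟨N, hN, hBN⟩ := exists_inverse_form hs hB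
  obtain ⟨h1, h2⟩ := h.nullPairing_pairingVar hE hU hN hB hBN hnull
  obtain ⟨i1, i2⟩ := h1.inv_eq_zero h2
  rw [← h.inv1_apply hE hU ⟨t, ht⟩, ← h.inv2_apply hE hU ⟨t, ht⟩, i1, i2]
  exact ⟨rfl, rfl⟩

include h hE in
/-- A form for which the differentials of the solutions are null is unique up to scale. -/
theorem proportional_of_null {B B' : Bil Param} (hs : ∀ v w, B v w = B w v)
    (hB : ∀ v, (∀ w, B v w = 0) → v = 0) (hs' : ∀ v w, B' v w = B' w v)
    (hB' : ∀ v, (∀ w, B' v w = 0) → v = 0) (hU : MapsTo (fun t => (t, a)) U W)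
    (h4 : ∀ t ∈ U, E.Rs (jetMap ψ (t, a)) * E.Ts (jetMap ψ (t, a)) ≠ 4)
    (hnull : ∀ t ∈ U, IsNullFor B ψ (t, a)) (hnull' : ∀ t ∈ U, IsNullFor B' ψ (t, a))
    {t : Plane} (ht : t ∈ U) : ∃ c : ℝ, B' = c • B := by
  obtain ⟨N, hN, hBN⟩ := exists_inverse_form hs hB
  obtain ⟨N', hN', hBN'⟩ := exists_inverse_form hs' hB'
  obtain ⟨h1, h2⟩ := h.nullPairing_pairingVar hE hU hN hB hBN hnull
  obtain ⟨h1', h2'⟩ := h.nullPairing_pairingVar hE hU hN' hB' hBN' hnull'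
  obtain ⟨P, hP⟩ := JetAlgebra.exists_nullPairing_eq (h.slice hE hU) (h.isUnit_disc hE hU)
    (smoothOn.isUnit_iff.2 fun t => sub_ne_zero.2 (h4 t t.2))
  set x : ℝ := (h.pairingVar hU N 0 3 : U → ℝ) ⟨t, ht⟩ with hx
  set y : ℝ := (h.pairingVar hU N' 0 3 : U → ℝ) ⟨t, ht⟩ with hy
  have hx0 : x ≠ 0 := smoothOn.isUnit_iff.1 h2 _
  have hy0 : y ≠ 0 := smoothOn.isUnit_iff.1 h2' _
  have hval : ∀ k l, variation ψ (t, a) (dualVec ψ (t, a) N l) k = x * (P k l : U → ℝ) ⟨t, ht⟩ :=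
    fun k l => (h.pairingVar_apply hU N k l ⟨t, ht⟩).symm.trans
      (congrFun (congrArg Subtype.val (hP _ h1 k l)) ⟨t, ht⟩)
  have hval' : ∀ k l, variation ψ (t, a) (dualVec ψ (t, a) N' l) k
      = y * (P k l : U → ℝ) ⟨t, ht⟩ :=
    fun k l => (h.pairingVar_apply hU N' k l ⟨t, ht⟩).symm.trans
      (congrFun (congrArg Subtype.val (hP _ h1' k l)) ⟨t, ht⟩)
  obtain ⟨L, hL⟩ := exists_variation_linear ψ (t, a)
  -- Both inverse matrices are multiples, by x and y, of the same values `P`, so the vectors dual to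
  -- the coframe are proportional.
  have hdd : ∀ l, x • dualVec ψ (t, a) N' l = y • dualVec ψ (t, a) N l := by
    intro l
    refine sub_eq_zero.1 (h.eq_zero_of_variation (hU ht) fun k => ?_)
    rw [← hL, map_sub, map_smul, map_smul, hL, hL]
    change x * variation ψ (t, a) (dualVec ψ (t, a) N' l) k
      - y * variation ψ (t, a) (dualVec ψ (t, a) N l) k = 0
    rw [hval, hval']
    ring
  have hdual : ∀ l v, B v (dualVec ψ (t, a) N l) = variation ψ (t, a) v l := fun l v => by
    rw [hs, dualVec, hBN, ← variation_eq_sum]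
  have hdual' : ∀ l v, B' v (dualVec ψ (t, a) N' l) = variation ψ (t, a) v l := fun l v => by
    rw [hs', dualVec, hBN', ← variation_eq_sum]
  have key : ∀ v w, y * B' v w = x * B v w := by
    intro v w
    -- The vector representing the covector y B'(v, ·) - x B(v, ·) through B. Its components in the
    -- coframe are obtained by pairing with the dual vectors, and they vanish.
    set z : Param := N.mulVec fun i => y * B' v (Pi.single i 1) - x * B v (Pi.single i 1) with hz
    have hzw : ∀ w, B z w = y * B' v w - x * B v w := by
      intro w
      have hw : w = ∑ i, w i • Pi.single i (1 : ℝ) := by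
        conv_lhs => rw [← Finset.univ_sum_single w]
        refine Finset.sum_congr rfl fun i _ => ?_
        rw [← Pi.single_smul]
        simp
      rw [hz, hBN]
      conv_rhs => rw [hw, map_sum, map_sum, Finset.mul_sum, Finset.mul_sum,
        ← Finset.sum_sub_distrib]
      refine Finset.sum_congr rfl fun i _ => ?_
      simp only [map_smul, smul_eq_mul]
      ring
    have hz0 : z = 0 := h.eq_zero_of_variation (hU ht) fun l => by
      rw [← hdual, hzw, hdual]
      have e1 : y * B' v (dualVec ψ (t, a) N l) = B' v (y • dualVec ψ (t, a) N l) := by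
        rw [map_smul]; rfl
      rw [e1, ← hdd, map_smul, smul_eq_mul, hdual', sub_self]
    have := hzw w
    rw [hz0, map_zero] at this
    exact (sub_eq_zero.1 this.symm)
  refine ⟨y⁻¹ * x, ContinuousLinearMap.ext fun v => ContinuousLinearMap.ext fun w => ?_⟩
  change B' v w = y⁻¹ * x * B v w
  rw [mul_assoc, ← key, inv_mul_cancel_left₀ hy0]

end IsFamily

/-- The differentials of the solutions are null for the metrics of the conformal class. -/
theorem GeneralSolution.isNullFor {E : PDEPair} (S : GeneralSolution E) (hE : E.Admissible)
    {h : Param → Bil Param} (hh : h ∈ S.conformalClass) {w : Plane × Param} (hw : w ∈ S.source) :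
    IsNullFor (h w.2) S.ψ w := by
  obtain ⟨c, hc, hval⟩ := S.eq_smul_canonForm hE hh hw
  have hd : 1 - E.Rs (jetMap S.ψ w) * E.Ts (jetMap S.ψ w) ≠ 0 :=
    hE.nondegenerate _ (S.mapsTo w hw)
  -- The ν₃ direction is paired only with λ, by the coefficient c(1 - R_sT_s). The suitably scaled
  -- vector along it is therefore dual to λ, and λ vanishes on it.
  obtain ⟨e, he⟩ := S.isFamily.variation_surjective hw
    ![0, 0, 0, (c * (1 - E.Rs (jetMap S.ψ w) * E.Ts (jetMap S.ψ w)))⁻¹]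
  refine ⟨e, fun v => ?_, by rw [he]; rfl⟩
  rw [hval]
  change c * canonForm E S.ψ w e v = _
  rw [S.isFamily.canonForm_apply hE hw, he]
  simp only [PDEPair.formVal, Matrix.cons_val]
  field_simp
  ring

/-! ### Transformation of families of solutions by contact transformations. -/

/-- The inverse function theorem for smooth maps. -/
theorem exists_openPartialHomeomorph_of_equiv {V V' : Type*} [NormedAddCommGroup V]
    [NormedSpace ℝ V] [CompleteSpace V] [NormedAddCommGroup V'] [NormedSpace ℝ V'] {f : V → V'}
    {W : Set V} (hW : IsOpen W) (hf : ContDiffOn ℝ ∞ f W) {w : V} (hw : w ∈ W) (L : V ≃L[ℝ] V')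
    (hL : HasFDerivAt f (L : V →L[ℝ] V') w) :
    ∃ e : OpenPartialHomeomorph V V', w ∈ e.source ∧ e.source ⊆ W ∧ (∀ x, e x = f x) ∧
      ContDiffOn ℝ ∞ e.symm e.target ∧ ∀ x ∈ e.source, Function.Injective (fderiv ℝ f x) := by
  have hfw := hf.contDiffAt (hW.mem_nhds hw)
  -- Restricting to the points where the derivative is invertible makes the inverse smooth on all of
  -- its domain.
  have hW' : IsOpen (W ∩ fderiv ℝ f ⁻¹' range ((↑) : (V ≃L[ℝ] V') → V →L[ℝ] V')) :=
    (hf.continuousOn_fderiv_of_isOpen hW (by simp)).isOpen_inter_preimage hW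
      ContinuousLinearEquiv.isOpen
  set e := (hfw.toOpenPartialHomeomorph f hL (by simp)).restrOpen _ hW' with he
  have hes : ∀ x ∈ e.source, x ∈ W ∧ ∃ L' : V ≃L[ℝ] V', (L' : V →L[ℝ] V') = fderiv ℝ f x :=
    fun x hx => hx.2
  refine ⟨e, ⟨hfw.mem_toOpenPartialHomeomorph_source hL (by simp), hw, L, hL.fderiv.symm⟩,
    fun x hx => (hes x hx).1, fun x => rfl, fun y hy => ?_, fun x hx => ?_⟩
  · obtain ⟨hx, L', hL'⟩ := hes _ (e.map_target hy)
    refine (e.contDiffAt_symm hy (f₀' := L') ?_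
      (hf.contDiffAt (hW.mem_nhds hx))).contDiffWithinAt
    rw [hL']
    exact hasFDerivAt_of_contDiffOn hW hf hx
  · obtain ⟨-, L', hL'⟩ := hes x hx
    rw [← hL']
    exact L'.injective

theorem exists_openPartialHomeomorph {V V' : Type*} [NormedAddCommGroup V] [NormedSpace ℝ V]
    [FiniteDimensional ℝ V] [NormedAddCommGroup V'] [NormedSpace ℝ V'] [FiniteDimensional ℝ V']
    (hdim : Module.finrank ℝ V = Module.finrank ℝ V') {f : V → V'} {W : Set V} (hW : IsOpen W)
    (hf : ContDiffOn ℝ ∞ f W) {w : V} (hw : w ∈ W) (hinj : Function.Injective (fderiv ℝ f w)) :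
    ∃ e : OpenPartialHomeomorph V V', w ∈ e.source ∧ e.source ⊆ W ∧ (∀ x, e x = f x) ∧
      ContDiffOn ℝ ∞ e.symm e.target ∧ ∀ x ∈ e.source, Function.Injective (fderiv ℝ f x) := by
  have : CompleteSpace V := FiniteDimensional.complete ℝ V
  exact exists_openPartialHomeomorph_of_equiv hW hf hw
    (LinearEquiv.ofInjectiveOfFinrankEq (fderiv ℝ f w).toLinearMap hinj hdim).toContinuousLinearEquiv
    (hasFDerivAt_of_contDiffOn hW hf hw)

/-- A smooth map into the space of jets whose derivatives in the directions of the plane are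
tangent to the distribution is the jet of a family of solutions. -/
theorem isFamily_of_integral {E : PDEPair} {W : Set (Plane × Param)} (hW : IsOpen W)
    {Ξ : Plane × Param → Jet} (hΞ : ContDiffOn ℝ ∞ Ξ W) (hmaps : ∀ w ∈ W, Ξ w ∈ E.domain)
    (h0 : ∀ w ∈ W, Ξ w 0 = w.1 0) (h1 : ∀ w ∈ W, Ξ w 1 = w.1 1)
    (hx : ∀ w ∈ W, fderiv ℝ Ξ w (planeVec 0) 2 = Ξ w 3 ∧
      fderiv ℝ Ξ w (planeVec 0) 3 = E.R (Ξ w) ∧ fderiv ℝ Ξ w (planeVec 0) 4 = Ξ w 5)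
    (hy : ∀ w ∈ W, fderiv ℝ Ξ w (planeVec 1) 2 = Ξ w 4 ∧
      fderiv ℝ Ξ w (planeVec 1) 3 = Ξ w 5 ∧ fderiv ℝ Ξ w (planeVec 1) 4 = E.T (Ξ w))
    (himm : ∀ w ∈ W, Function.Injective (fderiv ℝ Ξ w)) :
    IsFamily E W (fun w => Ξ w 2) ∧ ∀ w ∈ W, jetMap (fun w => Ξ w 2) w = Ξ w := by
  have hcomp : ∀ w ∈ W, ∀ (e : Plane × Param) (i : Fin 6),
      fderiv ℝ (fun w => Ξ w i) w e = fderiv ℝ Ξ w e i := by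
    intro w hw e i
    rw [(hasFDerivAt_pi'.1 (hasFDerivAt_of_contDiffOn hW hΞ hw) i).fderiv]
    rfl
  have hcongr : ∀ {g g' : Plane × Param → ℝ}, (∀ w ∈ W, g w = g' w) → ∀ w ∈ W,
      fderiv ℝ g w = fderiv ℝ g' w := fun hg w hw =>
    Filter.EventuallyEq.fderiv_eq (Filter.eventuallyEq_of_mem (hW.mem_nhds hw) hg)
  have hp : ∀ w ∈ W, pdPlane 0 (fun w => Ξ w 2) w = Ξ w 3 := fun w hw =>
    (hcomp w hw _ 2).trans (hx w hw).1
  have hq : ∀ w ∈ W, pdPlane 1 (fun w => Ξ w 2) w = Ξ w 4 := fun w hw =>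
    (hcomp w hw _ 2).trans (hy w hw).1
  have hjet : ∀ w ∈ W, jetMap (fun w => Ξ w 2) w = Ξ w := by
    intro w hw
    funext i
    fin_cases i
    · exact (h0 w hw).symm
    · exact (h1 w hw).symm
    · rfl
    · exact hp w hw
    · exact hq w hw
    · change fderiv ℝ (pdPlane 0 fun w => Ξ w 2) w (planeVec 1) = Ξ w 5
      rw [hcongr hp w hw]
      exact (hcomp w hw _ 3).trans (hy w hw).2.1
  refine ⟨⟨hW, contDiffOn_pi.1 hΞ 2, fun w hw => ?_, fun w hw => ?_, fun w hw => ?_,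
    fun w hw => ?_⟩, hjet⟩
  · rw [hjet w hw]
    exact hmaps w hw
  · rw [hjet w hw]
    change fderiv ℝ (pdPlane 0 fun w => Ξ w 2) w (planeVec 0) = _
    rw [hcongr hp w hw]
    exact (hcomp w hw _ 3).trans (hx w hw).2.1
  · rw [hjet w hw]
    change fderiv ℝ (pdPlane 1 fun w => Ξ w 2) w (planeVec 1) = _
    rw [hcongr hq w hw]
    exact (hcomp w hw _ 4).trans (hy w hw).2.2
  · rw [Filter.EventuallyEq.fderiv_eq (Filter.eventuallyEq_of_mem (hW.mem_nhds hw) hjet)]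
    exact himm w hw

/-- The projection to first jets as a linear map. -/
def toFirstL : Jet →L[ℝ] Jet₁ :=
  ContinuousLinearMap.pi fun i : Fin 5 => ContinuousLinearMap.proj (R := ℝ)
    (φ := fun _ : Fin 6 => ℝ) (Fin.castLE (by norm_num) i)

theorem toFirstL_apply (u : Jet) : toFirstL u = toFirst u := by
  funext i
  fin_cases i <;> rfl

namespace ContactEquivalence

variable {E E' : PDEPair} (Φ : ContactEquivalence E E')

section

variable (hE : E.Admissible) {u : Jet} (hu : u ∈ E.domain)
include hE hu

omit hE in
theorem hasFDerivAt_lift : HasFDerivAt Φ.lift (fderiv ℝ Φ.lift u) u :=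
  hasFDerivAt_of_contDiffOn Φ.lift.open_source Φ.lift_smooth (Φ.lift_source ▸ hu)

omit hE in
theorem lift_mem : Φ.lift u ∈ E'.domain :=
  Φ.lift_target ▸ Φ.lift.map_source (Φ.lift_source ▸ hu)

theorem toFirst_fderiv_lift (v : Jet) :
    toFirst (fderiv ℝ Φ.lift u v) = fderiv ℝ Φ.base (toFirst u) (toFirst v) := by
  have h1 : HasFDerivAt (fun u => toFirst (Φ.lift u)) (toFirstL.comp (fderiv ℝ Φ.lift u)) u := by
    have := toFirstL.hasFDerivAt.comp u (Φ.hasFDerivAt_lift hu)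
    exact this.congr_of_eventuallyEq (.of_forall fun x => (toFirstL_apply _).symm)
  have h2 : HasFDerivAt (fun u => Φ.base (toFirst u))
      ((fderiv ℝ Φ.base (toFirst u)).comp toFirstL) u := by
    have hb := hasFDerivAt_of_contDiffOn Φ.base.open_source Φ.base_smooth (Φ.mem_base u hu)
    have hf : HasFDerivAt toFirst toFirstL u := by
      have : toFirst = fun u => toFirstL u := funext fun u => (toFirstL_apply u).symm
      rw [this]
      exact toFirstL.hasFDerivAt
    exact hb.comp u hf
  have h3 := h1.congr_of_eventuallyEq (Filter.eventuallyEq_of_mem (hE.isOpen.mem_nhds hu)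
    fun x hx => (Φ.covers x hx).symm)
  have := congrArg (fun L : Jet →L[ℝ] Jet₁ => L v) (h3.unique h2)
  change toFirstL (fderiv ℝ Φ.lift u v) = fderiv ℝ Φ.base (toFirst u) (toFirstL v) at this
  rwa [toFirstL_apply, toFirstL_apply] at this

omit hE in
theorem fderiv_lift_injective : Function.Injective (fderiv ℝ Φ.lift u) := by
  have hs : u ∈ Φ.lift.source := Φ.lift_source ▸ hu
  have h1 := hasFDerivAt_of_contDiffOn Φ.lift.open_target Φ.lift_symm_smooth
    (Φ.lift.map_source hs)
  have h2 := (h1.comp u (Φ.hasFDerivAt_lift hu)).congr_of_eventuallyEq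
    (f₁ := id) (Filter.eventuallyEq_of_mem (Φ.lift.open_source.mem_nhds hs)
      fun x hx => (Φ.lift.left_inv hx).symm)
  have h3 := h2.unique (hasFDerivAt_id u)
  exact Function.LeftInverse.injective fun v => congrArg (fun L : Jet →L[ℝ] Jet => L v) h3

omit hE in
theorem fderiv_base_injective : Function.Injective (fderiv ℝ Φ.base (toFirst u)) := by
  have hs := Φ.mem_base u hu
  have h1 := hasFDerivAt_of_contDiffOn Φ.base.open_target Φ.base_symm_smooth
    (Φ.base.map_source hs)
  have h0 := hasFDerivAt_of_contDiffOn Φ.base.open_source Φ.base_smooth hs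
  have h2 := (h1.comp _ h0).congr_of_eventuallyEq
    (f₁ := id) (Filter.eventuallyEq_of_mem (Φ.base.open_source.mem_nhds hs)
      fun x hx => (Φ.base.left_inv hx).symm)
  have h3 := h2.unique (hasFDerivAt_id _)
  exact Function.LeftInverse.injective fun v => congrArg (fun L : Jet₁ →L[ℝ] Jet₁ => L v) h3

/-- The lift preserves the form `λ` up to a factor. -/
theorem exists_lam_lift : ∃ ρ : ℝ, ρ ≠ 0 ∧
    ∀ v, PDEPair.lam (Φ.lift u) (fderiv ℝ Φ.lift u v) = ρ * PDEPair.lam u v := by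
  obtain ⟨ρ, hρ, h⟩ := Φ.contact _ (Φ.mem_base u hu)
  refine ⟨ρ, hρ, fun v => ?_⟩
  have hl : ∀ u v, PDEPair.lam u v = contactForm (toFirst u) (toFirst v) := fun u v => rfl
  rw [hl, hl, Φ.covers u hu, Φ.toFirst_fderiv_lift hE hu, h]

/-- The lift maps the vectors tangent to the solutions to such vectors. -/
theorem toFirst_fderiv_lift_mem (a b : ℝ) :
    toFirst (fderiv ℝ Φ.lift u (a • E.fieldX u + b • E.fieldY u)) ∈ jetPlane E' (Φ.lift u) := by
  rw [Φ.toFirst_fderiv_lift hE hu, ← Φ.prolongs u hu]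
  refine ⟨_, ?_, rfl⟩
  refine ⟨?_, ?_, ?_⟩ <;>
    simp [toFirst, PDEPair.fieldX, PDEPair.fieldY] <;> ring

/-- In the plane `jetPlane` dx and dy determine the whole vector, so an image vector with dx = dy =
0 vanishes on first jets, and the base map is a diffeomorphism. This is what makes the transformed
graph of a solution locally a graph again. -/
theorem eq_zero_of_fderiv_lift {a b : ℝ}
    (h0 : fderiv ℝ Φ.lift u (a • E.fieldX u + b • E.fieldY u) 0 = 0)
    (h1 : fderiv ℝ Φ.lift u (a • E.fieldX u + b • E.fieldY u) 1 = 0) : a = 0 ∧ b = 0 := by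
  have hm := Φ.toFirst_fderiv_lift_mem hE hu a b
  set v := a • E.fieldX u + b • E.fieldY u with hv
  have hz : toFirst (fderiv ℝ Φ.lift u v) = 0 := by
    obtain ⟨e2, e3, e4⟩ := hm
    have k0 : toFirst (fderiv ℝ Φ.lift u v) 0 = 0 := h0
    have k1 : toFirst (fderiv ℝ Φ.lift u v) 1 = 0 := h1
    rw [k0, k1] at e2 e3 e4
    funext i
    fin_cases i
    · exact k0
    · exact k1
    · simpa using e2
    · simpa using e3
    · simpa using e4
  rw [Φ.toFirst_fderiv_lift hE hu] at hz
  have hz' : toFirst v = 0 := Φ.fderiv_base_injective hu (hz.trans (map_zero _).symm)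
  have z0 := congrFun hz' 0
  have z1 := congrFun hz' 1
  simp [toFirst, hv, PDEPair.fieldX, PDEPair.fieldY] at z0 z1
  exact ⟨z0, z1⟩

end

end ContactEquivalence

theorem planeVec_combination (e : Plane × Param) (he : e.2 = 0) :
    e = e.1 0 • planeVec 0 + e.1 1 • planeVec 1 := by
  refine Prod.ext ?_ ?_
  · funext i
    fin_cases i <;> simp [planeVec]
  · simp [planeVec, he]

/-- A contact transformation takes a family of solutions to a family of solutions with the same
parameters, and multiplies the differential with respect to the parameters by a factor. -/
theorem IsFamily.exists_transform {E E' : PDEPair} {W : Set (Plane × Param)}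
    {ψ : Plane × Param → ℝ} (h : IsFamily E W ψ) (hE : E.Admissible)
    (Φ : ContactEquivalence E E') {w : Plane × Param} (hw : w ∈ W) :
    ∃ (W' : Set (Plane × Param)) (ψ' : Plane × Param → ℝ), IsFamily E' W' ψ' ∧
      (∃ y ∈ W', jetMap ψ' y = Φ.lift (jetMap ψ w)) ∧
      ∀ y ∈ W', ∃ x ∈ W, x.2 = y.2 ∧ ∃ ρ : ℝ, ρ ≠ 0 ∧
        ∀ v, variation ψ' y v 0 = ρ * variation ψ x v 0 := by
  set Ψ : Plane × Param → Jet := fun w => Φ.lift (jetMap ψ w) with hΨ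
  have hΨs : ContDiffOn ℝ ∞ Ψ W :=
    (Φ.lift_source ▸ Φ.lift_smooth : ContDiffOn ℝ ∞ Φ.lift E.domain).comp h.smooth_jet h.mapsTo
  have hΨd : ∀ w ∈ W, ∀ e, fderiv ℝ Ψ w e = fderiv ℝ Φ.lift (jetMap ψ w)
      (fderiv ℝ (jetMap ψ) w e) := fun w hw e =>
    congrArg (fun L : Plane × Param →L[ℝ] Jet => L e)
      ((Φ.hasFDerivAt_lift (h.mapsTo w hw)).comp w (h.hasFDerivAt_jet hw)).fderiv
  set P : Jet →L[ℝ] Plane := ContinuousLinearMap.pi fun i : Fin 2 => ContinuousLinearMap.proj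
    (R := ℝ) (φ := fun _ : Fin 6 => ℝ) (Fin.castLE (by norm_num) i) with hP
  -- The transformed independent variables together with the unchanged parameters. Reparametrizing
  -- the transformed jets by the inverse of this map exhibits them as jets of a new family.
  set Θ : Plane × Param → Plane × Param := fun w => (P (Ψ w), w.2) with hΘ
  have hΘs : ContDiffOn ℝ ∞ Θ W := (P.contDiff.comp_contDiffOn hΨs).prodMk contDiffOn_snd
  have hΘd : ∀ w ∈ W, ∀ e, fderiv ℝ Θ w e = (P (fderiv ℝ Ψ w e), e.2) := by
    intro w hw e
    have h1 := (P.hasFDerivAt.comp w (hasFDerivAt_of_contDiffOn h.isOpen hΨs hw)).prodMk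
      (hasFDerivAt_snd (𝕜 := ℝ) (p := w))
    exact congrArg (fun L : Plane × Param →L[ℝ] Plane × Param => L e) h1.fderiv
  have hvert : ∀ w ∈ W, ∀ e : Plane × Param, e.2 = 0 → fderiv ℝ Ψ w e
      = fderiv ℝ Φ.lift (jetMap ψ w) (e.1 0 • E.fieldX (jetMap ψ w)
        + e.1 1 • E.fieldY (jetMap ψ w)) := by
    intro w hw e he
    rw [hΨd w hw]
    conv_lhs => rw [planeVec_combination e he]
    rw [map_add, map_smul, map_smul, h.fderiv_jet_x hE hw, h.fderiv_jet_y hE hw]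
  have hΘi : ∀ w ∈ W, Function.Injective (fderiv ℝ Θ w) := by
    intro w hw
    refine (injective_iff_map_eq_zero (fderiv ℝ Θ w)).2 fun e he => ?_
    rw [hΘd w hw] at he
    have he2 : e.2 = 0 := congrArg Prod.snd he
    have he1 : P (fderiv ℝ Ψ w e) = 0 := congrArg Prod.fst he
    rw [hvert w hw e he2] at he1
    obtain ⟨z0, z1⟩ := Φ.eq_zero_of_fderiv_lift hE (h.mapsTo w hw) (congrFun he1 0)
      (congrFun he1 1)
    rw [planeVec_combination e he2, z0, z1, zero_smul, zero_smul, add_zero]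
  obtain ⟨e, hwe, hes, heΘ, hesm, -⟩ := exists_openPartialHomeomorph rfl h.isOpen hΘs hw (hΘi w hw)
  have hsW : ∀ y ∈ e.target, e.symm y ∈ W := fun y hy => hes (e.map_target hy)
  have hΘe : ∀ y ∈ e.target, Θ (e.symm y) = y := fun y hy =>
    (heΘ _).symm.trans (e.right_inv hy)
  set Ξ : Plane × Param → Jet := fun y => Ψ (e.symm y) with hΞ
  have hΞs : ContDiffOn ℝ ∞ Ξ e.target := hΨs.comp hesm hsW
  have hesd : ∀ y ∈ e.target, HasFDerivAt e.symm (fderiv ℝ e.symm y) y := fun y hy =>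
    hasFDerivAt_of_contDiffOn e.open_target hesm hy
  have hΞd : ∀ y ∈ e.target, ∀ d, fderiv ℝ Ξ y d
      = fderiv ℝ Ψ (e.symm y) (fderiv ℝ e.symm y d) := fun y hy d =>
    congrArg (fun L : Plane × Param →L[ℝ] Jet => L d)
      ((hasFDerivAt_of_contDiffOn h.isOpen hΨs (hsW y hy)).comp y (hesd y hy)).fderiv
  have hinv : ∀ y ∈ e.target, ∀ d, fderiv ℝ Θ (e.symm y) (fderiv ℝ e.symm y d) = d := by
    intro y hy d
    have h1 := (hasFDerivAt_of_contDiffOn h.isOpen hΘs (hsW y hy)).comp y (hesd y hy)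
    have h2 := h1.congr_of_eventuallyEq (f₁ := id)
      (Filter.eventuallyEq_of_mem (e.open_target.mem_nhds hy) fun x hx => (hΘe x hx).symm)
    exact congrArg (fun L : Plane × Param →L[ℝ] Plane × Param => L d)
      (h2.unique (hasFDerivAt_id y))
  have hinv2 : ∀ y ∈ e.target, ∀ d, (fderiv ℝ e.symm y d).2 = d.2 := fun y hy d => by
    have := hinv y hy d
    rw [hΘd _ (hsW y hy)] at this
    exact (Prod.ext_iff.1 this).2
  have hinv1 : ∀ y ∈ e.target, ∀ d, P (fderiv ℝ Ξ y d) = d.1 := fun y hy d => by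
    have := hinv y hy d
    rw [hΘd _ (hsW y hy), ← hΞd y hy] at this
    exact congrArg Prod.fst this
  have hΞ1 : ∀ y ∈ e.target, P (Ξ y) = y.1 := fun y hy => congrArg Prod.fst (hΘe y hy)
  have hmem : ∀ y ∈ e.target, ∀ i, toFirst (fderiv ℝ Ξ y (planeVec i)) ∈ jetPlane E' (Ξ y) := by
    intro y hy i
    rw [hΞd y hy, hvert _ (hsW y hy) _ (hinv2 y hy _)]
    exact Φ.toFirst_fderiv_lift_mem hE (h.mapsTo _ (hsW y hy)) _ _
  obtain ⟨hfam, hjet⟩ := isFamily_of_integral (E := E') e.open_target hΞs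
    (fun y hy => Φ.lift_mem (h.mapsTo _ (hsW y hy)))
    (fun y hy => congrFun (hΞ1 y hy) 0) (fun y hy => congrFun (hΞ1 y hy) 1)
    (fun y hy => by
      obtain ⟨e2, e3, e4⟩ := hmem y hy 0
      have k0 : toFirst (fderiv ℝ Ξ y (planeVec 0)) 0 = 1 :=
        (congrFun (hinv1 y hy (planeVec 0)) 0).trans (by simp [planeVec])
      have k1 : toFirst (fderiv ℝ Ξ y (planeVec 0)) 1 = 0 :=
        (congrFun (hinv1 y hy (planeVec 0)) 1).trans (by simp [planeVec])
      rw [k0, k1, mul_one, mul_zero, add_zero] at e2 e3 e4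
      exact ⟨e2, e3, e4⟩)
    (fun y hy => by
      obtain ⟨e2, e3, e4⟩ := hmem y hy 1
      have k0 : toFirst (fderiv ℝ Ξ y (planeVec 1)) 0 = 0 :=
        (congrFun (hinv1 y hy (planeVec 1)) 0).trans (by simp [planeVec])
      have k1 : toFirst (fderiv ℝ Ξ y (planeVec 1)) 1 = 1 :=
        (congrFun (hinv1 y hy (planeVec 1)) 1).trans (by simp [planeVec])
      rw [k0, k1, mul_one, mul_zero, zero_add] at e2 e3 e4
      exact ⟨e2, e3, e4⟩)
    (fun y hy => by
      refine (injective_iff_map_eq_zero (fderiv ℝ Ξ y)).2 fun d hd => ?_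
      rw [hΞd y hy, hΨd _ (hsW y hy)] at hd
      have h1 := Φ.fderiv_lift_injective (h.mapsTo _ (hsW y hy)) (hd.trans (map_zero _).symm)
      have h2 := h.immersion _ (hsW y hy) (h1.trans (map_zero _).symm)
      have h3 := hinv y hy d
      rw [h2, map_zero] at h3
      exact h3.symm)
  have hwt : e w ∈ e.target := e.map_source hwe
  refine ⟨e.target, fun y => Ξ y 2, hfam, ⟨e w, hwt, ?_⟩, fun y hy =>
    ⟨e.symm y, hsW y hy, (Prod.ext_iff.1 (hΘe y hy)).2, ?_⟩⟩
  · rw [hjet _ hwt]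
    simp only [hΞ, hΨ, e.left_inv hwe]
  -- A parameter direction at fixed new (x, y) has dx = dy = 0, so λ evaluates to the variation of
  -- the new solution. The lift rescales λ by ρ, and the old λ sees only the parameter part of the
  -- vector.
  · obtain ⟨ρ, hρ, hlam⟩ := Φ.exists_lam_lift hE (h.mapsTo _ (hsW y hy))
    refine ⟨ρ, hρ, fun v => ?_⟩
    have hfd : fderiv ℝ (jetMap fun y => Ξ y 2) y = fderiv ℝ Ξ y :=
      Filter.EventuallyEq.fderiv_eq (Filter.eventuallyEq_of_mem (e.open_target.mem_nhds hy) hjet)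
    have h1 := hlam (fderiv ℝ (jetMap ψ) (e.symm y) (fderiv ℝ e.symm y (0, v)))
    rw [← hΨd _ (hsW y hy), ← hΞd y hy] at h1
    have h2 : PDEPair.lam (jetMap ψ (e.symm y)) (fderiv ℝ (jetMap ψ) (e.symm y)
        (fderiv ℝ e.symm y (0, v))) = variation ψ (e.symm y) v 0 := by
      have h3 := congrFun (h.coframe_jet hE (hsW y hy) (fderiv ℝ e.symm y (0, v))) 0
      rw [hinv2 y hy] at h3
      exact h3
    rw [h2] at h1
    rw [← h1]
    have k0 : fderiv ℝ Ξ y (0, v) 0 = 0 := congrFun (hinv1 y hy (0, v)) 0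
    have k1 : fderiv ℝ Ξ y (0, v) 1 = 0 := congrFun (hinv1 y hy (0, v)) 1
    change fderiv ℝ (jetMap fun y => Ξ y 2) y (0, v) 2 = fderiv ℝ Ξ y (0, v) 2
      - _ * fderiv ℝ Ξ y (0, v) 0 - _ * fderiv ℝ Ξ y (0, v) 1
    rw [hfd, k0, k1, mul_zero, mul_zero, sub_zero, sub_zero]

/-- A multiple of a null covector is null; this lets the same form serve for the transformed
solutions. -/
theorem IsNullFor.of_smul {B : Bil Param} {ψ ψ' : Plane × Param → ℝ} {w w' : Plane × Param}
    (h : IsNullFor B ψ w) {ρ : ℝ} (hρ : ∀ v, variation ψ' w' v 0 = ρ * variation ψ w v 0) :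
    IsNullFor B ψ' w' := by
  obtain ⟨e, he, he0⟩ := h
  obtain ⟨L, hL⟩ := exists_variation_linear ψ w
  refine ⟨ρ • e, fun v => ?_, ?_⟩
  · rw [map_smul, hρ, ← he]
    rfl
  · rw [hρ, ← hL, map_smul, hL]
    change ρ * (ρ * variation ψ w e 0) = 0
    rw [he0, mul_zero, mul_zero]

/-- The vanishing of the relative invariants is preserved at the image of a general solution. -/
theorem GeneralSolution.metricity_lift {E E' : PDEPair} (S : GeneralSolution E)
    (hE : E.Admissible) (hgen : E.Generic) (hJ : E.Metricity) (hE' : E'.Admissible)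
    (Φ : ContactEquivalence E E') {w : Plane × Param} (hw : w ∈ S.source) :
    E'.J1 (Φ.lift (S.jet w)) = 0 ∧ E'.J2 (Φ.lift (S.jet w)) = 0 := by
  obtain ⟨h, hh⟩ := S.conformalClass_nonempty hE hJ hgen
  obtain ⟨W', ψ', hfam, ⟨⟨t, a⟩, hy, hjet⟩, hnull⟩ := S.isFamily.exists_transform hE Φ hw
  have hS : ∀ {y}, y ∈ W' → y.2 ∈ S.params := fun hy => by
    obtain ⟨x, hx, hxy, -⟩ := hnull _ hy
    exact ⟨x, hx, hxy⟩
  have := hfam.metricity_of_null hE' (hh.1.symm a (hS hy)) (hh.1.nondegenerate a (hS hy))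
    (hfam.mapsTo_sliceOpens a) (fun t ht => by
      obtain ⟨x, hx, hxy, ρ, hρ, hv⟩ := hnull _ ht
      have hx' := S.isNullFor hE hh hx
      rw [hxy] at hx'
      exact hx'.of_smul hv) hy
  rwa [hjet] at this

/-! ### The induced map between solution spaces. -/

namespace Induces

variable {E E' : PDEPair} {Φ : ContactEquivalence E E'} {S : GeneralSolution E}
  {S' : GeneralSolution E'} {χ : Param → Param}

/-- The induced map between the parametrized jet spaces. -/
theorem exists_smooth_lift (hχ : Induces Φ S S' χ) :
    ∃ F : Plane × Param → Plane × Param, ContDiffOn ℝ ∞ F S.source ∧ MapsTo F S.source S'.source ∧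
      ∀ w ∈ S.source, S'.jet (F w) = Φ.lift (S.jet w) ∧ (F w).2 = χ w.2 := by
  choose! t ht using hχ
  refine ⟨fun w => (t w, χ w.2), fun w hw => ?_, fun w hw => (ht w hw).1,
    fun w hw => ⟨(ht w hw).2.symm, rfl⟩⟩
  -- The points t are merely chosen. By injectivity of the second jet map, however, the lifted map
  -- coincides nearby with a smooth local inverse applied to the transformed jet, and is smooth for
  -- that reason.
  obtain ⟨e, hwe, hes, hej, hesm, -⟩ := exists_openPartialHomeomorph (by simp) S'.isOpen
    S'.isFamily.smooth_jet (ht w hw).1 (S'.immersion _ (ht w hw).1)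
  have hΨ : ContDiffOn ℝ ∞ (fun w => Φ.lift (S.jet w)) S.source :=
    (Φ.lift_source ▸ Φ.lift_smooth : ContDiffOn ℝ ∞ Φ.lift E.domain).comp S.isFamily.smooth_jet
      S.mapsTo
  have hjet : ∀ w ∈ S.source, Φ.lift (S.jet w) = S'.jet (t w, χ w.2) := fun w hw => (ht w hw).2
  have hmem : Φ.lift (S.jet w) ∈ e.target := by
    rw [hjet w hw]
    have := e.map_source hwe
    rwa [hej] at this
  have hnhds : ∀ᶠ x in 𝓝 w, x ∈ S.source ∧ Φ.lift (S.jet x) ∈ e.target :=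
    (S.isOpen.eventually_mem hw).and ((hΨ.continuousOn.continuousAt (S.isOpen.mem_nhds hw)).eventually
      (e.open_target.mem_nhds hmem))
  have hsm : ContDiffAt ℝ ∞ (fun w => e.symm (Φ.lift (S.jet w))) w :=
    (hesm.contDiffAt (e.open_target.mem_nhds hmem)).comp w
      (hΨ.contDiffAt (S.isOpen.mem_nhds hw))
  refine (hsm.congr_of_eventuallyEq (hnhds.mono fun x hx => ?_)).contDiffWithinAt
  refine S'.injOn (ht x hx.1).1 (hes (e.map_target hx.2)) ?_
  refine (hjet x hx.1).symm.trans ?_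
  rw [← e.right_inv hx.2, hej]

theorem contDiffOn (hχ : Induces Φ S S' χ) : ContDiffOn ℝ ∞ χ S.params := by
  obtain ⟨F, hF, hmaps, hFχ⟩ := hχ.exists_smooth_lift
  rintro a ⟨⟨t, a⟩, hw, rfl⟩
  have hop : IsOpen {a | (t, a) ∈ S.source} := S.isOpen.preimage (by fun_prop)
  have hs : ContDiffOn ℝ ∞ (fun a => (F (t, a)).2) {a | (t, a) ∈ S.source} :=
    contDiff_snd.comp_contDiffOn (hF.comp (contDiff_const.prodMk contDiff_id).contDiffOn
      fun a ha => ha)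
  exact ((hs.congr fun a ha => (hFχ (t, a) ha).2.symm).contDiffAt
    (hop.mem_nhds hw)).contDiffWithinAt

theorem mapsTo (hχ : Induces Φ S S' χ) : MapsTo χ S.params S'.params := by
  rintro a ⟨w, hw, rfl⟩
  obtain ⟨t, ht, -⟩ := hχ w hw
  exact ⟨_, ht, rfl⟩

/-- The induced map is a local diffeomorphism and transforms the differentials of the solutions up
to a factor. -/
theorem fderiv_spec (hχ : Induces Φ S S' χ) (hE : E.Admissible) (hE' : E'.Admissible)
    {w : Plane × Param} (hw : w ∈ S.source) :
    Function.Bijective (fderiv ℝ χ w.2) ∧ ∃ w' ∈ S'.source, w'.2 = χ w.2 ∧ ∃ ρ : ℝ, ρ ≠ 0 ∧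
      ∀ v, variation S'.ψ w' (fderiv ℝ χ w.2 v) 0 = ρ * variation S.ψ w v 0 := by
  obtain ⟨F, hF, hmaps, hFχ⟩ := hχ.exists_smooth_lift
  have hFd := hasFDerivAt_of_contDiffOn S.isOpen hF hw
  have hχd := hasFDerivAt_of_contDiffOn S.isOpen_params hχ.contDiffOn
    (show w.2 ∈ S.params from ⟨w, hw, rfl⟩)
  have h2 : ∀ ε, (fderiv ℝ F w ε).2 = fderiv ℝ χ w.2 ε.2 := by
    intro ε
    have h1 := (hasFDerivAt_snd (𝕜 := ℝ) (p := F w)).comp w hFd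
    have h2 := (hχd.comp w (hasFDerivAt_snd (𝕜 := ℝ) (p := w))).congr_of_eventuallyEq
      (Filter.eventuallyEq_of_mem (S.isOpen.mem_nhds hw) fun x hx => (hFχ x hx).2)
    exact congrArg (fun L : Plane × Param →L[ℝ] Param => L ε) (h1.unique h2)
  have hjd : ∀ ε, fderiv ℝ S'.jet (F w) (fderiv ℝ F w ε)
      = fderiv ℝ Φ.lift (S.jet w) (fderiv ℝ S.jet w ε) := by
    intro ε
    have h1 := (S'.isFamily.hasFDerivAt_jet (hmaps hw)).comp w hFd
    have h2 := ((Φ.hasFDerivAt_lift (S.mapsTo w hw)).comp w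
      (S.isFamily.hasFDerivAt_jet hw)).congr_of_eventuallyEq
      (Filter.eventuallyEq_of_mem (S.isOpen.mem_nhds hw) fun x hx => (hFχ x hx).1)
    exact congrArg (fun L : Plane × Param →L[ℝ] Jet => L ε) (h1.unique h2)
  have hFi : Function.Injective (fderiv ℝ F w) := by
    refine (injective_iff_map_eq_zero (fderiv ℝ F w)).2 fun ε hε => ?_
    have h1 := hjd ε
    rw [hε, map_zero] at h1
    have h3 := Φ.fderiv_lift_injective (S.mapsTo w hw) (h1.symm.trans (map_zero _).symm)
    exact S.immersion w hw (h3.trans (map_zero _).symm)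
  have hFs : Function.Surjective (fderiv ℝ F w) :=
    (LinearMap.injective_iff_surjective (f := (fderiv ℝ F w).toLinearMap)).1 hFi
  have hχs : Function.Surjective (fderiv ℝ χ w.2) := by
    intro v
    obtain ⟨ε, hε⟩ := hFs (0, v)
    exact ⟨ε.2, by rw [← h2, hε]⟩
  refine ⟨⟨(LinearMap.injective_iff_surjective (f := (fderiv ℝ χ w.2).toLinearMap)).2 hχs, hχs⟩,
    F w, hmaps hw, (hFχ w hw).2, ?_⟩
  obtain ⟨ρ, hρ, hlam⟩ := Φ.exists_lam_lift hE (S.mapsTo w hw)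
  refine ⟨ρ, hρ, fun v => ?_⟩
  have h3 := hlam (fderiv ℝ S.jet w (0, v))
  have h4 := congrFun (S.isFamily.coframe_jet hE hw (0, v)) 0
  have h5 := congrFun (S'.isFamily.coframe_jet hE' (hmaps hw) (fderiv ℝ F w (0, v))) 0
  rw [h2] at h5
  change PDEPair.lam (S.jet w) (fderiv ℝ S.jet w (0, v)) = _ at h4
  change PDEPair.lam (S'.jet (F w)) (fderiv ℝ S'.jet (F w) (fderiv ℝ F w (0, v))) = _ at h5
  rw [← h5, ← h4, hjd, (hFχ w hw).1]
  exact h3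

theorem pullback_apply (h : Param → Bil Param) (a v v' : Param) :
    pullback χ h a v v' = h (χ a) (fderiv ℝ χ a v) (fderiv ℝ χ a v') := rfl

theorem isMetricOn_pullback (hχ : Induces Φ S S' χ) (hE : E.Admissible) (hE' : E'.Admissible)
    {h' : Param → Bil Param} (hh' : IsMetricOn S'.params h') :
    IsMetricOn S.params (pullback χ h') := by
  refine ⟨contDiffOn_bil.2 fun v v' => ?_, fun a ha v v' => hh'.symm _ (hχ.mapsTo ha) _ _, ?_⟩
  · exact ((hh'.smooth.comp hχ.contDiffOn hχ.mapsTo).clm_apply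
      (contDiffOn_fderiv_apply S.isOpen_params hχ.contDiffOn v)).clm_apply
      (contDiffOn_fderiv_apply S.isOpen_params hχ.contDiffOn v')
  · rintro a ⟨w, hw, rfl⟩ v hv
    obtain ⟨hb, -⟩ := hχ.fderiv_spec hE hE' hw
    refine hb.1 (Eq.trans ?_ (map_zero _).symm)
    refine hh'.nondegenerate _ (hχ.mapsTo ⟨w, hw, rfl⟩) _ fun x => ?_
    obtain ⟨v', rfl⟩ := hb.2 x
    exact hv v'

/-- The derivative of χ carries the differential of one solution to a nonzero multiple of that of
the other. Nullity therefore pulls back; the dual vector is rescaled by ρ⁻¹. -/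
theorem isNullFor_pullback (hχ : Induces Φ S S' χ) (hE : E.Admissible) (hE' : E'.Admissible)
    {h' : Param → Bil Param} (hh' : h' ∈ S'.conformalClass) {w : Plane × Param}
    (hw : w ∈ S.source) : IsNullFor (pullback χ h' w.2) S.ψ w := by
  obtain ⟨hb, w', hw', hw2, ρ, hρ, hvar⟩ := hχ.fderiv_spec hE hE' hw
  obtain ⟨e', he', he0⟩ := S'.isNullFor hE' hh' hw'
  rw [hw2] at he'
  obtain ⟨e, rfl⟩ := hb.2 e'
  obtain ⟨L, hL⟩ := exists_variation_linear S.ψ w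
  refine ⟨ρ⁻¹ • e, fun v => ?_, ?_⟩
  · rw [map_smul]
    change ρ⁻¹ * pullback χ h' w.2 e v = _
    rw [pullback_apply, he', hvar, inv_mul_cancel_left₀ hρ]
  · rw [← hL, map_smul, hL]
    change ρ⁻¹ * variation S.ψ w e 0 = 0
    rw [hvar] at he0
    rw [(mul_eq_zero.1 he0).resolve_left hρ, mul_zero]

/-- On a given solution both the metric and the pulled-back metric are constant forms for which its
differential is null. Uniqueness of such forms makes them proportional where R_sT_s ≠ 4, and
genericity with continuity gives the rest. -/
theorem conformalOn (hχ : Induces Φ S S' χ) (hE : E.Admissible) (hgen : E.Generic)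
    (hE' : E'.Admissible) {h h' : Param → Bil Param} (hh : h ∈ S.conformalClass)
    (hh' : h' ∈ S'.conformalClass) : ConformalOn S.params (pullback χ h') h := by
  set k := pullback χ h' with hk
  have hkm : IsMetricOn S.params k := hχ.isMetricOn_pullback hE hE' hh'.1
  have hpar : ∀ w ∈ S.source, w.2 ∈ S.params := fun w hw => ⟨w, hw, rfl⟩
  have hprop : ∀ w ∈ S.source, E.Rs (S.jet w) * E.Ts (S.jet w) ≠ 4 → ∃ c : ℝ, k w.2 = c • h w.2 := by
    rintro ⟨t, a⟩ hw h4
    have hF := S.isFamily.mono (S.isFamily.isOpen_mul_ne hE 4) fun w hw => hw.1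
    have ha := hpar _ hw
    exact hF.proportional_of_null hE (hh.1.symm a ha) (hh.1.nondegenerate a ha)
      (hkm.symm a ha) (hkm.nondegenerate a ha) (hF.mapsTo_sliceOpens a) (fun t ht => ht.2)
      (fun t ht => S.isNullFor hE hh ht.1) (fun t ht => hχ.isNullFor_pullback hE hE' hh' ht.1)
      (t := t) ⟨hw, h4⟩
  refine conformalOn_of_proportional hh.1 hkm.smooth (fun a ha => hkm.ne_zero ha) ?_
  rintro a ⟨w, hw, rfl⟩
  -- Proportionality written without division is a closed condition, so it extends to parameters met
  -- only where R_sT_s = 4.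
  have key : ∀ v₁ v₂ v₃ v₄, k w.2 v₁ v₂ * h w.2 v₃ v₄ = k w.2 v₃ v₄ * h w.2 v₁ v₂ := by
    intro v₁ v₂ v₃ v₄
    by_contra hne
    have hc : ∀ {g : Param → Bil Param}, IsMetricOn S.params g → ∀ v v',
        ContinuousAt (fun w : Plane × Param => g w.2 v v') w := fun hg v v' =>
      ((contDiffOn_bil.1 hg.smooth v v').continuousOn.continuousAt
        (S.isOpen_params.mem_nhds (hpar w hw))).comp (f := Prod.snd) continuousAt_snd
    have h1 := ((((hc hkm v₁ v₂).mul (hc hh.1 v₃ v₄)).sub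
      ((hc hkm v₃ v₄).mul (hc hh.1 v₁ v₂))).eventually_ne (sub_ne_zero.2 hne))
    obtain ⟨x, hx4, hx, hxs⟩ := ((S.isFamily.frequently_ne_four hgen hw).and_eventually
      (h1.and (S.isOpen.mem_nhds hw))).exists
    obtain ⟨c, hc⟩ := hprop x hxs hx4
    refine hx ?_
    have hv : ∀ v v', k x.2 v v' = c * h x.2 v v' := fun v v' => by rw [hc]; rfl
    change k x.2 v₁ v₂ * h x.2 v₃ v₄ - k x.2 v₃ v₄ * h x.2 v₁ v₂ = 0
    rw [hv, hv]
    ring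
  have hne : ∃ v v', h w.2 v v' ≠ 0 := by
    by_contra! hz
    exact hh.1.ne_zero (hpar w hw) (ContinuousLinearMap.ext fun v =>
      ContinuousLinearMap.ext fun v' => hz v v')
  obtain ⟨v, v', hv⟩ := hne
  refine ⟨k w.2 v v' / h w.2 v v', ContinuousLinearMap.ext fun x => ContinuousLinearMap.ext
    fun x' => ?_⟩
  change k w.2 x x' = k w.2 v v' / h w.2 v v' * h w.2 x x'
  rw [div_mul_eq_mul_div, eq_div_iff hv]
  exact key _ _ _ _

end Induces

/-! ### Composition operators on spaces of continuous maps -/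

universe u

section Composition

variable {K : Type*} [TopologicalSpace K] [CompactSpace K]
  {V V' W : Type u} [NormedAddCommGroup V] [NormedSpace ℝ V] [NormedAddCommGroup V']
  [NormedSpace ℝ V'] [NormedAddCommGroup W] [NormedSpace ℝ W]

theorem norm_pointwise_le (b : W →L[ℝ] V →L[ℝ] V') (A : C(K, W)) (h : C(K, V)) (t : K) :
    ‖b (A t) (h t)‖ ≤ ‖b‖ * ‖A‖ * ‖h‖ :=
  (b.le_opNorm₂ _ _).trans (by
    gcongr
    exacts [A.norm_coe_le_norm t, h.norm_coe_le_norm t])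

/-- The pointwise product. -/
def pointwiseL (b : W →L[ℝ] V →L[ℝ] V') : C(K, W) →L[ℝ] C(K, V) →L[ℝ] C(K, V') :=
  LinearMap.mkContinuous₂
    (LinearMap.mk₂ ℝ (fun (A : C(K, W)) (h : C(K, V)) =>
      (⟨fun t => b (A t) (h t), (b.continuous.comp A.continuous).clm_apply h.continuous⟩ :
        C(K, V')))
      (fun A A' h => ContinuousMap.ext fun t => b.map_add₂ (A t) (A' t) (h t))
      (fun c A h => ContinuousMap.ext fun t => b.map_smul₂ c (A t) (h t))
      (fun A h h' => ContinuousMap.ext fun t => map_add (b (A t)) (h t) (h' t))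
      (fun c A h => ContinuousMap.ext fun t => map_smul (b (A t)) c (h t))) ‖b‖
    (fun A h => (ContinuousMap.norm_le _ (by positivity)).2 (norm_pointwise_le b A h))

@[simp] theorem pointwiseL_apply (b : W →L[ℝ] V →L[ℝ] V') (A : C(K, W)) (h : C(K, V)) (t : K) :
    pointwiseL b A h t = b (A t) (h t) := rfl

theorem norm_pointwiseL_le (b : W →L[ℝ] V →L[ℝ] V') (A : C(K, W)) (h : C(K, V)) :
    ‖pointwiseL b A h‖ ≤ ‖b‖ * ‖A‖ * ‖h‖ :=
  (ContinuousMap.norm_le _ (by positivity)).2 (norm_pointwise_le b A h)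

/-- The constant maps. -/
def constL : V →L[ℝ] C(K, V) :=
  LinearMap.mkContinuous
    { toFun := ContinuousMap.const K
      map_add' := fun _ _ => rfl
      map_smul' := fun _ _ => rfl } 1
    (fun v => (ContinuousMap.norm_le _ (by positivity)).2 fun t => (one_mul ‖v‖).ge)

/-- The composition operator. -/
def nemytskii (f : C(V, V')) (α : C(K, V)) : C(K, V') := f.comp α

omit [CompactSpace K] [NormedSpace ℝ V] [NormedSpace ℝ V'] in
@[simp] theorem nemytskii_apply (f : C(V, V')) (α : C(K, V)) (t : K) :
    nemytskii f α t = f (α t) := rfl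

/-- The mean value inequality at each t, made uniform in t by the continuity of composition with
`f'` in the sup norm. -/
theorem hasFDerivAt_nemytskii {b : W →L[ℝ] V →L[ℝ] V'} {f : C(V, V')} {f' : C(V, W)}
    (hf : ∀ x, HasFDerivAt f (b (f' x)) x) (α : C(K, V)) :
    HasFDerivAt (nemytskii f) (pointwiseL b (nemytskii f' α)) α := by
  rw [hasFDerivAt_iff_isLittleO, Asymptotics.isLittleO_iff]
  intro c hc
  have hcont : ContinuousAt (fun β : C(K, V) => ‖b‖ * ‖nemytskii f' β - nemytskii f' α‖) α :=
    continuousAt_const.mul (f'.continuous_postcomp.continuousAt.sub continuousAt_const).norm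
  have hlt : ‖b‖ * ‖nemytskii f' α - nemytskii f' α‖ < c := by simpa using hc
  obtain ⟨r, hr, hball⟩ := Metric.eventually_nhds_iff_ball.1 (hcont.eventually (gt_mem_nhds hlt))
  filter_upwards [Metric.ball_mem_nhds α hr] with β hβ
  refine (ContinuousMap.norm_le _ (by positivity)).2 fun t => ?_
  have key := (convex_segment (𝕜 := ℝ) (α t) (β t)).norm_image_sub_le_of_norm_hasFDerivWithin_le'
    (f := f) (f' := fun x => b (f' x)) (φ := b (f' (α t))) (C := c)
    (fun x _ => (hf x).hasFDerivWithinAt)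
    (fun x hx => by
      obtain ⟨a, d, ha, hd, had, rfl⟩ := hx
      -- A point of the segment from α(t) to β(t) is the value at t of a curve on the segment from α
      -- to β, so the estimate on a ball of curves covers all t at once.
      have hm : a • α + d • β ∈ Metric.ball α r :=
        (convex_ball α r) (Metric.mem_ball_self hr) hβ ha hd had
      rw [← map_sub]
      refine (b.le_opNorm _).trans (le_trans ?_ (hball _ hm).le)
      exact mul_le_mul_of_nonneg_left
        ((nemytskii f' (a • α + d • β) - nemytskii f' α).norm_coe_le_norm t) (norm_nonneg b))
    (left_mem_segment ℝ _ _) (right_mem_segment ℝ _ _)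
  exact key.trans (mul_le_mul_of_nonneg_left ((β - α).norm_coe_le_norm t) hc.le)

end Composition

theorem contDiff_bilinear {A B C : Type*} [NormedAddCommGroup A] [NormedSpace ℝ A]
    [NormedAddCommGroup B] [NormedSpace ℝ B] [NormedAddCommGroup C] [NormedSpace ℝ C]
    (f : A →L[ℝ] B →L[ℝ] C) {n : WithTop ℕ∞} : ContDiff ℝ n fun x => f x := f.contDiff

/-- The derivative is pointwise multiplication by the composition operator of `f'`, so regularity
follows by induction. The target space must vary in the induction, as `f'` takes values in another
space. -/
theorem contDiff_nemytskii {K : Type*} [TopologicalSpace K] [CompactSpace K]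
    {V V' : Type u} [NormedAddCommGroup V] [NormedSpace ℝ V] [NormedAddCommGroup V']
    [NormedSpace ℝ V'] {f : C(V, V')} (hf : ContDiff ℝ ∞ f) :
    ContDiff ℝ ∞ (nemytskii f : C(K, V) → C(K, V')) := by
  have key : ∀ (n : ℕ) (V' : Type u) [NormedAddCommGroup V'] [NormedSpace ℝ V'] (f : C(V, V')),
      ContDiff ℝ ∞ f → ContDiff ℝ n (nemytskii f : C(K, V) → C(K, V')) := by
    intro n
    induction n with
    | zero => exact fun V' _ _ f hf => contDiff_zero.2 f.continuous_postcomp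
    | succ n ih =>
      intro V' _ _ f hf
      have step : ∀ (W : Type u) [NormedAddCommGroup W] [NormedSpace ℝ W]
          (b : W →L[ℝ] V →L[ℝ] V') (f' : C(V, W)), ContDiff ℝ ∞ f' →
          (∀ x, HasFDerivAt f (b (f' x)) x) →
          ContDiff ℝ (n + 1 : ℕ) (nemytskii f : C(K, V) → C(K, V')) := by
        intro W _ _ b f' hf' hd
        rw [Nat.cast_add, Nat.cast_one, contDiff_succ_iff_hasFDerivAt]
        have h1 : ContDiff ℝ n fun A : C(K, W) => (pointwiseL b A : C(K, V) →L[ℝ] C(K, V')) :=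
          @contDiff_bilinear C(K, W) C(K, V) C(K, V') _ _ _ _ _ _ (pointwiseL b) n
        exact ⟨fun α => pointwiseL b (nemytskii f' α), h1.comp (ih W f' hf'),
          hasFDerivAt_nemytskii hd⟩
      have hf' := (contDiff_infty_iff_fderiv (𝕜 := ℝ) (f := f)).1 hf
      exact step (V →L[ℝ] V') (ContinuousLinearMap.id ℝ _) ⟨fderiv ℝ f, hf'.2.continuous⟩ hf'.2
        fun x => (hf'.1 x).hasFDerivAt
  exact contDiff_infty.2 fun n => key n V' f hf

/-! ### Integration of continuous maps on the unit interval -/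

section Integration

variable {V : Type u} [NormedAddCommGroup V]

/-- The extension of a continuous map on the unit interval. -/
def extendI (β : C(unitInterval, V)) (s : ℝ) : V := β (projIcc 0 1 zero_le_one s)

theorem continuous_extendI (β : C(unitInterval, V)) : Continuous (extendI β) :=
  β.continuous.comp continuous_projIcc

theorem extendI_coe (β : C(unitInterval, V)) (t : unitInterval) : extendI β t = β t := by
  rw [extendI, projIcc_val]

variable {P W : Type u} [NormedSpace ℝ V] [NormedAddCommGroup P] [NormedSpace ℝ P]
  [NormedAddCommGroup W] [NormedSpace ℝ W]

theorem continuous_volterra (b : W →L[ℝ] P →L[ℝ] V) (A : C(unitInterval, W)) (p : P) :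
    Continuous fun s => b (extendI A s) p :=
  (b.continuous.comp (continuous_extendI A)).clm_apply continuous_const

theorem norm_volterra_le (b : W →L[ℝ] P →L[ℝ] V) (A : C(unitInterval, W)) (p : P)
    (t : unitInterval) : ‖∫ s in (0 : ℝ)..t, b (extendI A s) p‖ ≤ ‖b‖ * ‖A‖ * ‖p‖ := by
  have h1 := intervalIntegral.norm_integral_le_of_norm_le_const (a := 0) (b := (t : ℝ))
    (f := fun s => b (extendI A s) p) (C := ‖b‖ * ‖A‖ * ‖p‖) fun s _ => by
      refine (b.le_opNorm₂ _ _).trans ?_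
      gcongr
      exact A.norm_coe_le_norm _
  refine h1.trans ?_
  rw [sub_zero, abs_of_nonneg t.2.1]
  exact mul_le_of_le_one_right (by positivity) t.2.2

/-- The primitive of the pairing with a vector. -/
def volterraL (b : W →L[ℝ] P →L[ℝ] V) : C(unitInterval, W) →L[ℝ] P →L[ℝ] C(unitInterval, V) :=
  LinearMap.mkContinuous₂
    (LinearMap.mk₂ ℝ (fun (A : C(unitInterval, W)) (p : P) =>
      (⟨fun t => ∫ s in (0 : ℝ)..t, b (extendI A s) p,
        (intervalIntegral.continuous_primitive
          (fun _ _ => (continuous_volterra b A p).intervalIntegrable _ _) 0).comp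
            continuous_subtype_val⟩ : C(unitInterval, V)))
      (fun A A' p => ContinuousMap.ext fun t => by
        refine Eq.trans ?_ (intervalIntegral.integral_add
          ((continuous_volterra b A p).intervalIntegrable _ _)
          ((continuous_volterra b A' p).intervalIntegrable _ _))
        exact congrArg (fun f : ℝ → V => ∫ s in (0 : ℝ)..t, f s)
          (funext fun s => b.map_add₂ (extendI A s) (extendI A' s) p))
      (fun c A p => ContinuousMap.ext fun t => by
        refine Eq.trans ?_ (intervalIntegral.integral_smul c _)
        exact congrArg (fun f : ℝ → V => ∫ s in (0 : ℝ)..t, f s)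
          (funext fun s => b.map_smul₂ c (extendI A s) p))
      (fun A p p' => ContinuousMap.ext fun t => by
        refine Eq.trans ?_ (intervalIntegral.integral_add
          ((continuous_volterra b A p).intervalIntegrable _ _)
          ((continuous_volterra b A p').intervalIntegrable _ _))
        exact congrArg (fun f : ℝ → V => ∫ s in (0 : ℝ)..t, f s)
          (funext fun s => map_add (b (extendI A s)) p p'))
      (fun c A p => ContinuousMap.ext fun t => by
        refine Eq.trans ?_ (intervalIntegral.integral_smul c _)
        exact congrArg (fun f : ℝ → V => ∫ s in (0 : ℝ)..t, f s)
          (funext fun s => map_smul (b (extendI A s)) c p))) ‖b‖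
    (fun A p => (ContinuousMap.norm_le _ (by positivity)).2 (norm_volterra_le b A p))

theorem norm_volterraL_le (b : W →L[ℝ] P →L[ℝ] V) (A : C(unitInterval, W)) (p : P) :
    ‖volterraL b A p‖ ≤ ‖b‖ * ‖A‖ * ‖p‖ :=
  (ContinuousMap.norm_le _ (by positivity)).2 (norm_volterra_le b A p)

end Integration

/-! ### Integral manifolds of commuting vector fields -/

section FixedPoint

variable {P V C : Type*} [NormedAddCommGroup P] [NormedSpace ℝ P] [CompleteSpace P]
  [NormedAddCommGroup V] [NormedSpace ℝ V] [CompleteSpace V] [NormedAddCommGroup C]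
  [NormedSpace ℝ C] [CompleteSpace C]

/-- The solution `G p v` of the equation `G = k v + T G p`, for small `p`. -/
theorem exists_smooth_fixedPoint {T : C → P →L[ℝ] C} (hT : ContDiff ℝ ∞ T) (k : V →L[ℝ] C) (v : V) :
    ∃ (U : Set (P × V)) (G : P × V → C), IsOpen U ∧ (0, v) ∈ U ∧ ContDiffOn ℝ ∞ G U ∧
      G (0, v) = k v ∧ ∀ q ∈ U, G q = k q.2 + T (G q) q.1 := by
  set Φ : (P × V) × C → C := fun x => x.2 - k x.1.2 - T x.2 x.1.1 with hΦ
  have hΦs : ContDiff ℝ ∞ Φ :=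
    (contDiff_snd.sub (k.contDiff.comp (contDiff_snd.comp contDiff_fst))).sub
      ((hT.comp contDiff_snd).clm_apply (contDiff_fst.comp contDiff_fst))
  set H : (P × V) × C → (P × V) × C := fun x => (x.1, Φ x) with hH
  have hHs : ContDiff ℝ ∞ H := contDiff_fst.prodMk hΦs
  set x₀ : (P × V) × C := ((0, v), k v) with hx₀
  have hd : HasFDerivAt Φ (fderiv ℝ Φ x₀) x₀ := (hΦs.differentiable (by simp) x₀).hasFDerivAt
  -- At p = 0 the term `T α p` vanishes for every α, so the derivative of Φ in α is the identity.
  -- Hence the derivative of H is block triangular and invertible.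
  have hvert : ∀ β, fderiv ℝ Φ x₀ (0, β) = β := by
    intro β
    have h1 : HasFDerivAt (fun α : C => ((0, v), α)) (ContinuousLinearMap.inr ℝ (P × V) C) (k v) :=
      (hasFDerivAt_const _ _).prodMk (hasFDerivAt_id _)
    have h2 := HasFDerivAt.comp (k v) hd h1
    have h3 : HasFDerivAt (Φ ∘ fun α : C => ((0, v), α)) (ContinuousLinearMap.id ℝ C) (k v) := by
      have : (Φ ∘ fun α : C => ((0, v), α)) = fun α => α - k v := by
        funext α
        simp [hΦ]
      rw [this]
      exact (hasFDerivAt_id _).sub_const _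
    exact congrArg (fun L : C →L[ℝ] C => L β) (h2.unique h3)
  set M : (P × V) →L[ℝ] C := (fderiv ℝ Φ x₀).comp (ContinuousLinearMap.inl ℝ (P × V) C) with hM
  have hsplit : ∀ δ β, fderiv ℝ Φ x₀ (δ, β) = M δ + β := by
    intro δ β
    have : ((δ, β) : (P × V) × C) = (δ, 0) + (0, β) := by simp
    rw [this, map_add, hvert]
    rfl
  set L : ((P × V) × C) ≃L[ℝ] ((P × V) × C) := ContinuousLinearEquiv.equivOfInverse
    ((ContinuousLinearMap.fst ℝ (P × V) C).prod
      (M.comp (ContinuousLinearMap.fst ℝ (P × V) C) + ContinuousLinearMap.snd ℝ (P × V) C))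
    ((ContinuousLinearMap.fst ℝ (P × V) C).prod
      (ContinuousLinearMap.snd ℝ (P × V) C - M.comp (ContinuousLinearMap.fst ℝ (P × V) C)))
    (fun x => by simp) (fun x => by simp) with hL
  have hHd : HasFDerivAt H (L : ((P × V) × C) →L[ℝ] ((P × V) × C)) x₀ := by
    have h1 := (hasFDerivAt_fst (𝕜 := ℝ) (p := x₀)).prodMk hd
    refine h1.congr_fderiv (ContinuousLinearMap.ext fun x => ?_)
    exact Prod.ext rfl (hsplit x.1 x.2)
  obtain ⟨e, hxe, -, heH, hes, -⟩ := exists_openPartialHomeomorph_of_equiv isOpen_univ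
    hHs.contDiffOn (mem_univ x₀) L hHd
  have hι : Continuous fun q : P × V => ((q, 0) : (P × V) × C) := by fun_prop
  have hx0 : e x₀ = ((0, v), 0) := by
    rw [heH]
    simp [hH, hΦ, hx₀]
  have hU : ((0, v), (0 : C)) ∈ e.target := hx0 ▸ e.map_source hxe
  refine ⟨(fun q => (q, 0)) ⁻¹' e.target, fun q => (e.symm (q, 0)).2, e.open_target.preimage hι, hU,
    contDiff_snd.comp_contDiffOn (hes.comp (contDiff_id.prodMk contDiff_const).contDiffOn
      fun q hq => hq), ?_, fun q hq => ?_⟩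
  · change (e.symm ((0, v), 0)).2 = k v
    rw [← hx0, e.left_inv hxe]
  · have h1 := e.right_inv hq
    rw [heH] at h1
    have h2 : (e.symm (q, 0)).1 = q := congrArg Prod.fst h1
    have h3 : Φ (e.symm (q, 0)) = 0 := congrArg Prod.snd h1
    simp only [hΦ, h2] at h3
    rw [sub_sub, sub_eq_zero] at h3
    exact h3

omit [CompleteSpace P] [CompleteSpace V] [CompleteSpace C] in
theorem fderiv_fixedPoint {T : C → P →L[ℝ] C} {k : V →L[ℝ] C} {U : Set (P × V)} {G : P × V → C}
    (hU : IsOpen U) (hG : ContDiffOn ℝ ∞ G U) (heq : ∀ q ∈ U, G q = k q.2 + T (G q) q.1)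
    {q : P × V} (hq : q ∈ U) {T' : C →L[ℝ] P →L[ℝ] C} (hT : HasFDerivAt T T' (G q)) (δ : P) :
    fderiv ℝ G q (δ, 0) = T (G q) δ + T' (fderiv ℝ G q (δ, 0)) q.1 := by
  have h1 := hasFDerivAt_of_contDiffOn hU hG hq
  have h2 := (k.hasFDerivAt.comp q (hasFDerivAt_snd (𝕜 := ℝ) (p := q))).add
    ((hT.comp q h1).clm_apply (hasFDerivAt_fst (𝕜 := ℝ) (p := q)))
  have h3 := h2.congr_of_eventuallyEq (Filter.eventuallyEq_of_mem (hU.mem_nhds hq) heq)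
  have h4 := congrArg (fun L : P × V →L[ℝ] C => L (δ, 0)) (h1.unique h3)
  refine h4.trans ?_
  simp

omit [CompleteSpace P] [CompleteSpace V] [CompleteSpace C] in
theorem hasFDerivAt_clm_comp {A : Type*} [NormedAddCommGroup A] [NormedSpace ℝ A]
    (L : A →L[ℝ] P →L[ℝ] C) {f : V → A} {f' : V →L[ℝ] A} {x : V} (hf : HasFDerivAt f f' x) :
    HasFDerivAt (fun x => L (f x)) (L.comp f') x := L.hasFDerivAt.comp x hf

end FixedPoint

variable {P V W W' : Type u} [NormedAddCommGroup P] [NormedSpace ℝ P] [CompleteSpace P]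
  [NormedAddCommGroup V] [NormedSpace ℝ V] [CompleteSpace V] [NormedAddCommGroup W]
  [NormedSpace ℝ W] [NormedAddCommGroup W'] [NormedSpace ℝ W']

omit [CompleteSpace P] in
/-- The derivative of the solution with respect to the parameters of the family of fields. -/
theorem linearized_volterra {b : W →L[ℝ] P →L[ℝ] V} {b' : W' →L[ℝ] V →L[ℝ] W} {Z : C(V, W)}
    {Z' : C(V, W')} (hZ' : ∀ x, HasFDerivAt Z (b' (Z' x)) x) {N : Set V}
    (hcomm : ∀ x ∈ N, ∀ p δ, b (b' (Z' x) (b (Z x) p)) δ = b (b' (Z' x) (b (Z x) δ)) p)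
    {α γ : C(unitInterval, V)} {p δ : P} {v : V} (hα : ∀ t, α t ∈ N)
    (heq : α = constL v + volterraL b (nemytskii Z α) p)
    (hγ : ∀ t, γ t = (t : ℝ) • b (Z (α t)) δ) :
    γ = volterraL b (nemytskii Z α) δ + volterraL b (pointwiseL b' (nemytskii Z' α) γ) p := by
  set g : ℝ → V := fun s => v + ∫ τ in (0 : ℝ)..s, b (extendI (nemytskii Z α) τ) p with hg
  have hgd : ∀ s, HasDerivAt g (b (extendI (nemytskii Z α) s) p) s := fun s =>
    ((continuous_volterra b (nemytskii Z α) p).integral_hasStrictDerivAt 0 s).hasDerivAt.const_add v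
  have hgα : ∀ t : unitInterval, g t = α t := fun t => (congrFun (congrArg DFunLike.coe heq) t).symm
  have hext : ∀ {s : ℝ} (hs : s ∈ Icc (0 : ℝ) 1) {X : Type u} [NormedAddCommGroup X]
      (β : C(unitInterval, X)), extendI β s = β ⟨s, hs⟩ := fun hs X _ β => extendI_coe β ⟨_, hs⟩
  refine ContinuousMap.ext fun t => ?_
  have hc1 := continuous_volterra b (nemytskii Z α) δ
  have hc2 := continuous_volterra b (pointwiseL b' (nemytskii Z' α) γ) p
  -- Differentiates s ↦ s X_δ(α(s)) along the integral curve of X_p. The product rule yields X_δ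
  -- plus s times the derivative of X_δ along X_p, and the commutation hypothesis replaces the
  -- latter by the derivative of X_p along X_δ.
  have hF : ∀ s ∈ uIcc (0 : ℝ) t, HasDerivAt (fun s : ℝ => s • b (Z (g s)) δ)
      (b (extendI (nemytskii Z α) s) δ
        + b (extendI (pointwiseL b' (nemytskii Z' α) γ) s) p) s := by
    intro s hs
    rw [uIcc_of_le t.2.1] at hs
    have hs' : s ∈ Icc (0 : ℝ) 1 := ⟨hs.1, hs.2.trans t.2.2⟩
    have hgs : g s = α ⟨s, hs'⟩ := hgα ⟨s, hs'⟩
    have h1 : HasDerivAt (fun s => Z (g s)) (b' (Z' (g s)) (b (extendI (nemytskii Z α) s) p)) s :=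
      (hZ' (g s)).comp_hasDerivAt s (hgd s)
    have h2 := (b.hasFDerivAt.comp_hasDerivAt s h1).clm_apply (hasDerivAt_const s δ)
    have h3 := (hasDerivAt_id s).smul h2
    refine h3.congr_deriv ?_
    simp only [map_zero, add_zero, id, one_smul]
    rw [hext hs', hext hs', hgs, add_comm]
    simp only [nemytskii_apply, pointwiseL_apply, hγ, map_smul]
    rw [hcomm _ (hα _), Function.comp_apply, hgs]
    rfl
  have h1 := intervalIntegral.integral_eq_sub_of_hasDerivAt hF
    ((hc1.add hc2).intervalIntegrable _ _)
  rw [intervalIntegral.integral_add (hc1.intervalIntegrable _ _) (hc2.intervalIntegrable _ _),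
    zero_smul, sub_zero, hgα] at h1
  rw [hγ]
  exact h1.symm

/-- The solutions of the integral equation for a smooth family of vector fields which commute on an
open set depend on the parameters of the family as they do on time. -/
theorem exists_smooth_integral {b : W →L[ℝ] P →L[ℝ] V} {b' : W' →L[ℝ] V →L[ℝ] W} {Z : C(V, W)}
    {Z' : C(V, W')} (hZ : ContDiff ℝ ∞ Z) (hZ' : ∀ x, HasFDerivAt Z (b' (Z' x)) x) {N : Set V}
    (hN : IsOpen N) (hcomm : ∀ x ∈ N, ∀ p δ,
      b (b' (Z' x) (b (Z x) p)) δ = b (b' (Z' x) (b (Z x) δ)) p) {v : V} (hv : v ∈ N) :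
    ∃ (U : Set (P × V)) (u : P × V → V), IsOpen U ∧ (0, v) ∈ U ∧ ContDiffOn ℝ ∞ u U ∧
      MapsTo u U N ∧ (∀ q ∈ U, ∀ δ, fderiv ℝ u q (δ, 0) = b (Z (u q)) δ) ∧
      (∀ q ∈ U, q.1 = 0 → u q = q.2) ∧
      ∀ ℓ : V →L[ℝ] P, (∀ x ∈ N, ∀ δ, ℓ (b (Z x) δ) = δ) → ∀ q ∈ U, ℓ (u q) = ℓ q.2 + q.1 := by
  -- The fixed point of α = v + T α p is the integral curve of the field X_p from v, and the joint
  -- flow is its value at time 1.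
  set T : C(unitInterval, V) → P →L[ℝ] C(unitInterval, V) :=
    fun α => volterraL b (nemytskii Z α) with hT
  have hTs : ContDiff ℝ ∞ T := by
    have h1 : ContDiff ℝ ∞ fun A : C(unitInterval, W) =>
        (volterraL b A : P →L[ℝ] C(unitInterval, V)) :=
      @contDiff_bilinear C(unitInterval, W) P C(unitInterval, V) _ _ _ _ _ _ (volterraL b) ∞
    exact h1.comp (contDiff_nemytskii hZ)
  obtain ⟨U₀, G, hU₀, hv₀, hG, hGv, heq⟩ := exists_smooth_fixedPoint hTs constL v
  -- A bound for the linearized integral operator. Where it is below 1 the linearized equation has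
  -- at most one solution.
  set κ : P × V → ℝ := fun q => ‖b‖ * (‖b'‖ * ‖nemytskii Z' (G q)‖) * ‖q.1‖ with hκ
  have hκc : ContinuousOn κ U₀ :=
    (continuousOn_const.mul (continuousOn_const.mul
      (Z'.continuous_postcomp.comp_continuousOn hG.continuousOn).norm)).mul
      continuous_fst.continuousOn.norm
  set U : Set (P × V) := (U₀ ∩ G ⁻¹' {α | MapsTo α univ N}) ∩ (U₀ ∩ κ ⁻¹' Iio 1) with hU
  have hUo : IsOpen U := (hG.continuousOn.isOpen_inter_preimage hU₀
    (ContinuousMap.isOpen_setOfPred_mapsTo isCompact_univ hN)).inter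
      (hκc.isOpen_inter_preimage hU₀ isOpen_Iio)
  have hUs : U ⊆ U₀ := fun q hq => hq.1.1
  have hGN : ∀ q ∈ U, ∀ t, G q t ∈ N := fun q hq t => hq.1.2 (mem_univ t)
  -- For commuting fields, varying the field X_p in the direction δ moves the curve at time t by t
  -- X_δ. Both this candidate and the true derivative solve the linearized equation, so they agree.
  have hderiv : ∀ q ∈ U, ∀ δ, ∀ t : unitInterval,
      fderiv ℝ G q (δ, 0) t = (t : ℝ) • b (Z (G q t)) δ := by
    intro q hq δ
    set γ : C(unitInterval, V) := ⟨fun t => (t : ℝ) • b (Z (G q t)) δ,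
      continuous_subtype_val.smul ((b.continuous.comp (Z.continuous.comp
        (G q).continuous)).clm_apply continuous_const)⟩ with hγ
    have h1 := linearized_volterra hZ' hcomm (γ := γ) (δ := δ) (hGN q hq) (heq q (hUs hq))
      fun t => rfl
    have hTd : HasFDerivAt T ((volterraL b).comp (pointwiseL b' (nemytskii Z' (G q)))) (G q) :=
      @hasFDerivAt_clm_comp P C(unitInterval, V) C(unitInterval, V) _ _ _ _ _ _
        C(unitInterval, W) _ _ (volterraL b) _ _ _ (hasFDerivAt_nemytskii hZ' (G q))
    have h2 := fderiv_fixedPoint hU₀ hG heq (hUs hq) hTd δ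
    have h3 : fderiv ℝ G q (δ, 0) - γ = volterraL b (pointwiseL b' (nemytskii Z' (G q))
        (fderiv ℝ G q (δ, 0) - γ)) q.1 := by
      rw [map_sub, map_sub]
      conv_lhs => rw [h2, h1]
      exact add_sub_add_left_eq_sub _ _ _
    have h4 : ‖fderiv ℝ G q (δ, 0) - γ‖ ≤ κ q * ‖fderiv ℝ G q (δ, 0) - γ‖ := by
      conv_lhs => rw [h3]
      refine (norm_volterraL_le _ _ _).trans ?_
      have h5 := norm_pointwiseL_le b' (nemytskii Z' (G q)) (fderiv ℝ G q (δ, 0) - γ)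
      calc _ ≤ ‖b‖ * (‖b'‖ * ‖nemytskii Z' (G q)‖ * ‖fderiv ℝ G q (δ, 0) - γ‖) * ‖q.1‖ := by
            gcongr
        _ = _ := by rw [hκ]; ring
    have h6 : ‖fderiv ℝ G q (δ, 0) - γ‖ = 0 := by
      by_contra hne
      have hpos := (norm_nonneg (fderiv ℝ G q (δ, 0) - γ)).lt_of_ne' hne
      exact absurd h4 (not_le.2 (mul_lt_of_lt_one_left hpos hq.2.2))
    intro t
    rw [sub_eq_zero.1 (norm_eq_zero.1 h6)]
    rfl
  have hval : ∀ q ∈ U, G q 1 = q.2 + ∫ s in (0 : ℝ)..1, b (extendI (nemytskii Z (G q)) s) q.1 :=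
    fun q hq => congrFun (congrArg DFunLike.coe (heq q (hUs hq))) 1
  refine ⟨U, fun q => G q 1, hUo, ⟨⟨hv₀, fun t _ => ?_⟩, hv₀, ?_⟩, ?_, fun q hq => hGN q hq 1,
    fun q hq δ => ?_, fun q hq h0 => ?_, fun ℓ hℓ q hq => ?_⟩
  · rw [hGv]
    exact hv
  · simp [hκ]
  · exact (ContinuousMap.evalCLM ℝ (1 : unitInterval)).contDiff.comp_contDiffOn (hG.mono hUs)
  · have h1 := ((ContinuousMap.evalCLM ℝ (1 : unitInterval)).hasFDerivAt.comp q
      (hasFDerivAt_of_contDiffOn hU₀ hG (hUs hq))).fderiv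
    refine (congrArg (fun L : P × V →L[ℝ] V => L (δ, 0)) h1).trans ?_
    refine (hderiv q hq δ 1).trans ?_
    simp
  · simp only [hval q hq, h0, map_zero, intervalIntegral.integral_zero, add_zero]
  · have hc := (continuous_volterra b (nemytskii Z (G q)) q.1).intervalIntegrable
      (μ := MeasureTheory.volume) 0 1
    change ℓ (G q 1) = ℓ q.2 + q.1
    rw [hval q hq, map_add, ← ℓ.intervalIntegral_comp_comm hc]
    congr 1
    have : ∀ s, ℓ (b (extendI (nemytskii Z (G q)) s) q.1) = q.1 := fun s => hℓ _ (hGN q hq _) _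
    simp [this]

/-- A bump function extends the fields to the whole space without changing them near the point, as
composition operators on curves need globally defined maps. -/
theorem exists_contDiff_eqOn {V F : Type*} [NormedAddCommGroup V] [NormedSpace ℝ V]
    [FiniteDimensional ℝ V] [NormedAddCommGroup F] [NormedSpace ℝ F] {f : V → F} {D : Set V}
    (hD : IsOpen D) (hf : ContDiffOn ℝ ∞ f D) {v : V} (hv : v ∈ D) :
    ∃ (g : V → F) (N : Set V), ContDiff ℝ ∞ g ∧ IsOpen N ∧ v ∈ N ∧ N ⊆ D ∧ EqOn g f N := by
  obtain ⟨ε, hε, hεD⟩ := Metric.isOpen_iff.1 hD v hv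
  set φ : ContDiffBump v := ⟨ε / 3, ε / 2, by positivity, by linarith⟩ with hφ
  have hsub : Metric.ball v (ε / 3) ⊆ D := (Metric.ball_subset_ball (by linarith)).trans hεD
  refine ⟨fun x => φ x • f x, Metric.ball v (ε / 3), ?_, Metric.isOpen_ball,
    Metric.mem_ball_self (by positivity), hsub, fun x hx => ?_⟩
  · rw [contDiff_iff_contDiffAt]
    intro x
    by_cases hx : x ∈ tsupport fun x => φ x • f x
    swap
    · exact contDiffAt_const.congr_of_eventuallyEq (notMem_tsupport_iff_eventuallyEq.1 hx)
    have h1 : x ∈ tsupport φ := tsupport_smul_subset_left φ f hx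
    rw [φ.tsupport_eq] at h1
    have h2 : x ∈ D := hεD (Metric.closedBall_subset_ball (by change ε / 2 < ε; linarith) h1)
    exact φ.contDiff.contDiffAt.smul (hf.contDiffAt (hD.mem_nhds h2))
  · change φ x • f x = f x
    rw [φ.one_of_mem_closedBall (Metric.ball_subset_closedBall hx), one_smul]

/-- The plane spanned by two vectors, as a map. -/
def span₂ (V : Type*) [NormedAddCommGroup V] [NormedSpace ℝ V] : V × V →L[ℝ] Plane →L[ℝ] V :=
  (ContinuousLinearMap.smulRightL ℝ Plane V (ContinuousLinearMap.proj 0)).comp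
      (ContinuousLinearMap.fst ℝ V V) +
    (ContinuousLinearMap.smulRightL ℝ Plane V (ContinuousLinearMap.proj 1)).comp
      (ContinuousLinearMap.snd ℝ V V)

theorem span₂_apply {V : Type*} [NormedAddCommGroup V] [NormedSpace ℝ V] (x : V × V) (δ : Plane) :
    span₂ V x δ = δ 0 • x.1 + δ 1 • x.2 := rfl

/-- The local action of the plane generated by two commuting vector fields. -/
theorem exists_local_action {V : Type} [NormedAddCommGroup V] [NormedSpace ℝ V]
    [FiniteDimensional ℝ V] {X Y : V → V} {D : Set V} (hD : IsOpen D) (hX : ContDiffOn ℝ ∞ X D)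
    (hY : ContDiffOn ℝ ∞ Y D) (hXY : ∀ x ∈ D, fderiv ℝ X x (Y x) = fderiv ℝ Y x (X x)) {v : V}
    (hv : v ∈ D) :
    ∃ (U : Set (Plane × V)) (u : Plane × V → V), IsOpen U ∧ (0, v) ∈ U ∧ ContDiffOn ℝ ∞ u U ∧
      MapsTo u U D ∧ (∀ q ∈ U, ∀ δ : Plane, fderiv ℝ u q (δ, 0) = δ 0 • X (u q) + δ 1 • Y (u q)) ∧
      (∀ q ∈ U, q.1 = 0 → u q = q.2) ∧ ∀ ℓ : V →L[ℝ] Plane,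
        (∀ x ∈ D, ∀ δ : Plane, ℓ (δ 0 • X x + δ 1 • Y x) = δ) → ∀ q ∈ U, ℓ (u q) = ℓ q.2 + q.1 := by
  have : CompleteSpace V := FiniteDimensional.complete ℝ V
  obtain ⟨g, N, hg, hN, hvN, hND, hgf⟩ := exists_contDiff_eqOn hD (hX.prodMk hY) hv
  have hgd : ∀ x ∈ N, ∀ e, fderiv ℝ g x e = (fderiv ℝ X x e, fderiv ℝ Y x e) := by
    intro x hx e
    have h1 := (hasFDerivAt_of_contDiffOn hD hX (hND hx)).prodMk
      (hasFDerivAt_of_contDiffOn hD hY (hND hx))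
    rw [Filter.EventuallyEq.fderiv_eq (eventuallyEq_of_mem (hN.mem_nhds hx) hgf), h1.fderiv]
    rfl
  have hval : ∀ x ∈ N, ∀ δ : Plane, span₂ V (g x) δ = δ 0 • X x + δ 1 • Y x := fun x hx δ => by
    rw [hgf hx]; rfl
  obtain ⟨U, u, hU, h0, hu, hmaps, hd, hinit, hℓ⟩ := exists_smooth_integral (P := Plane) (V := V)
    (W := V × V) (W' := V →L[ℝ] V × V) (b := span₂ V)
    (b' := ContinuousLinearMap.id ℝ (V →L[ℝ] V × V)) (Z := ⟨g, hg.continuous⟩)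
    (Z' := ⟨fderiv ℝ g, hg.continuous_fderiv (by simp)⟩) hg
    (fun x => (hg.differentiable (by simp) x).hasFDerivAt) hN (fun x hx p δ => by
      change span₂ V (fderiv ℝ g x (span₂ V (g x) p)) δ
        = span₂ V (fderiv ℝ g x (span₂ V (g x) δ)) p
      rw [hval x hx, hval x hx, hgd x hx, hgd x hx, span₂_apply, span₂_apply]
      simp only [map_add, map_smul, hXY x (hND hx)]
      module) hvN
  refine ⟨U, u, hU, h0, hu, fun q hq => hND (hmaps hq), fun q hq δ => ?_, hinit,
    fun ℓ h => hℓ ℓ fun x hx δ => ?_⟩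
  · rw [hd q hq]
    exact hval _ (hmaps hq) δ
  · change ℓ (span₂ V (g x) δ) = δ
    rw [hval x hx, h x (hND hx)]

/-! ### Existence of local general solutions. -/

variable {E : PDEPair}

/-- The integrability condition says that the vector fields `D_x` and `D_y` commute. -/
theorem PDEPair.Admissible.fields_commute (hE : E.Admissible) {u : Jet} (hu : u ∈ E.domain) :
    fderiv ℝ E.fieldX u (E.fieldY u) = fderiv ℝ E.fieldY u (E.fieldX u) := by
  have hcomp : ∀ {F : Jet → Jet}, ContDiffOn ℝ ∞ F E.domain → ∀ e i,
      fderiv ℝ F u e i = fderiv ℝ (fun x => F x i) u e := by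
    intro F hF e i
    rw [(hasFDerivAt_pi'.1 (hasFDerivAt_of_contDiffOn hE.isOpen hF hu) i).fderiv]
    rfl
  have hc : ∀ {f g : Jet → ℝ}, (∀ x ∈ E.domain, f x = g x) → fderiv ℝ f u = fderiv ℝ g u :=
    fun h => EventuallyEq.fderiv_eq (eventuallyEq_of_mem (hE.isOpen.mem_nhds hu) h)
  have hproj : ∀ (i : Fin 6) (e : Jet), fderiv ℝ (fun x : Jet => x i) u e = e i := fun i e => by
    rw [(hasFDerivAt_apply i u).fderiv]; rfl
  have hDyR := E.Dy_R (hE.nondegenerate u hu)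
  have hDxT := E.Dx_T (hE.nondegenerate u hu)
  -- The last component of the commutator is the integrability condition; the others vanish by the
  -- definition of the fields.
  have hDy : fderiv ℝ E.coeffDyR u (E.fieldY u) = fderiv ℝ E.coeffDxT u (E.fieldX u) := by
    rw [hc fun x hx => (E.Dy_R (hE.nondegenerate x hx)).symm,
      hc fun x hx => (E.Dx_T (hE.nondegenerate x hx)).symm]
    exact (hE.integrable u hu).symm
  funext i
  rw [hcomp (hE.smooth_fieldX), hcomp (hE.smooth_fieldY)]
  fin_cases i
  · change fderiv ℝ (fun _ : Jet => (1 : ℝ)) u _ = fderiv ℝ (fun _ : Jet => (0 : ℝ)) u _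
    simp
  · change fderiv ℝ (fun _ : Jet => (0 : ℝ)) u _ = fderiv ℝ (fun _ : Jet => (1 : ℝ)) u _
    simp
  · exact (hproj 3 (E.fieldY u)).trans (hproj 4 (E.fieldX u)).symm
  · exact hDyR.trans (hproj 5 (E.fieldX u)).symm
  · exact (hproj 5 _).trans hDxT.symm
  · exact hDy

/-- The initial data `(x₀, y₀, a)` of a family of solutions. -/
def initial (t : Plane) (a : Param) : Jet := ![t 0, t 1, a 0, a 1, a 2, a 3]

theorem contDiff_initial (t : Plane) : ContDiff ℝ ∞ (initial t) := by
  refine contDiff_pi.2 fun i => ?_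
  fin_cases i
  · exact contDiff_const
  · exact contDiff_const
  · exact contDiff_apply ℝ ℝ (0 : Fin 4)
  · exact contDiff_apply ℝ ℝ (1 : Fin 4)
  · exact contDiff_apply ℝ ℝ (2 : Fin 4)
  · exact contDiff_apply ℝ ℝ (3 : Fin 4)

theorem fderiv_initial (t : Plane) (a v : Param) (i : Fin 4) :
    fderiv ℝ (initial t) a v (i.natAdd 2) = v i := by
  have h := ((contDiff_initial t).differentiable (by simp) a).hasFDerivAt
  have h1 : HasFDerivAt (fun a => initial t a (i.natAdd 2)) (ContinuousLinearMap.proj i) a :=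
    (hasFDerivAt_apply (𝕜 := ℝ) (F' := fun _ => ℝ) i a).congr_of_eventuallyEq (Eventually.of_forall fun x => by
      fin_cases i <;> rfl)
  exact congrArg (fun L : Param →L[ℝ] ℝ => L v) ((hasFDerivAt_pi'.1 h (i.natAdd 2)).unique h1)

/-- A smooth family of integral surfaces of the fields `D_x`, `D_y` around a jet. -/
theorem PDEPair.Admissible.exists_integral (hE : E.Admissible) {u₀ : Jet} (hu₀ : u₀ ∈ E.domain) :
    ∃ (W : Set (Plane × Param)) (w : Plane × Param) (Ξ : Plane × Param → Jet), IsOpen W ∧ w ∈ W ∧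
      Ξ w = u₀ ∧ ContDiffOn ℝ ∞ Ξ W ∧ MapsTo Ξ W E.domain ∧
      (∀ w ∈ W, Ξ w 0 = w.1 0 ∧ Ξ w 1 = w.1 1) ∧
      (∀ w ∈ W, fderiv ℝ Ξ w (planeVec 0) = E.fieldX (Ξ w) ∧
        fderiv ℝ Ξ w (planeVec 1) = E.fieldY (Ξ w)) ∧
      Function.Injective (fderiv ℝ Ξ w) := by
  obtain ⟨U, u, hU, h0, hu, hmaps, hd, hinit, hℓ⟩ := exists_local_action hE.isOpen
    hE.smooth_fieldX hE.smooth_fieldY (fun x hx => hE.fields_commute hx) hu₀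
  set t₀ : Plane := ![u₀ 0, u₀ 1] with ht₀
  set a₀ : Param := ![u₀ 2, u₀ 3, u₀ 4, u₀ 5] with ha₀
  have hi₀ : initial t₀ a₀ = u₀ := by
    funext i
    fin_cases i <;> rfl
  -- The parameters are the values of z, p, q, s at the fixed base point t₀, and the flow is run for
  -- the time that moves (x, y) from t₀ to the required point.
  set κ : Plane × Param → Plane × Jet := fun w => (w.1 - t₀, initial t₀ w.2) with hκ
  have hκs : ContDiff ℝ ∞ κ :=
    (contDiff_fst.sub contDiff_const).prodMk ((contDiff_initial t₀).comp contDiff_snd)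
  have hκd : ∀ w e, fderiv ℝ κ w e = (e.1, fderiv ℝ (initial t₀) w.2 e.2) := by
    intro w e
    have h1 := ((hasFDerivAt_fst (𝕜 := ℝ) (p := w)).sub_const t₀).prodMk
      ((((contDiff_initial t₀).differentiable (by simp) w.2).hasFDerivAt).comp w hasFDerivAt_snd)
    exact congrArg (fun L : Plane × Param →L[ℝ] Plane × Jet => L e) h1.fderiv
  set W := κ ⁻¹' U with hW
  have hWo : IsOpen W := hU.preimage hκs.continuous
  set Ξ : Plane × Param → Jet := fun w => u (κ w) with hΞ
  have hΞs : ContDiffOn ℝ ∞ Ξ W := hu.comp hκs.contDiffOn fun w hw => hw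
  have hκ₀ : κ (t₀, a₀) = (0, u₀) := by rw [hκ]; simp [hi₀]
  have hw₀ : (t₀, a₀) ∈ W := by
    change κ (t₀, a₀) ∈ U
    rwa [hκ₀]
  have hΞd : ∀ w ∈ W, ∀ e, fderiv ℝ Ξ w e
      = fderiv ℝ u (κ w) (e.1, fderiv ℝ (initial t₀) w.2 e.2) := by
    intro w hw e
    rw [← hκd]
    exact congrArg (fun L : Plane × Param →L[ℝ] Jet => L e)
      ((hasFDerivAt_of_contDiffOn hU hu hw).comp w
        (hκs.differentiable (by simp) w).hasFDerivAt).fderiv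
  have hpl : ∀ w ∈ W, ∀ i, fderiv ℝ Ξ w (planeVec i)
      = (Pi.single i 1 : Plane) 0 • E.fieldX (Ξ w) + (Pi.single i 1 : Plane) 1 • E.fieldY (Ξ w) :=
    fun w hw i => by
      rw [hΞd w hw, ← hd _ hw]
      simp [planeVec]
  have h01 : ∀ w ∈ W, Ξ w 0 = w.1 0 ∧ Ξ w 1 = w.1 1 := by
    intro w hw
    -- The fields project to ∂_x and ∂_y, so the flow translates (x, y) exactly by its time.
    have h1 := hℓ ((ContinuousLinearMap.pi fun i : Fin 2 =>
      ContinuousLinearMap.proj (R := ℝ) (φ := fun _ : Fin 6 => ℝ) (i.castAdd 4)) : Jet →L[ℝ] Plane)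
      (fun x hx δ => by
        funext i
        fin_cases i <;> simp [PDEPair.fieldX, PDEPair.fieldY]) _ hw
    constructor
    · exact (congrFun h1 0).trans (by simp [hκ, initial])
    · exact (congrFun h1 1).trans (by simp [hκ, initial])
  refine ⟨W, (t₀, a₀), Ξ, hWo, hw₀, ?_, hΞs, fun w hw => hmaps hw, h01, fun w hw => ⟨?_, ?_⟩, ?_⟩
  · change u (κ (t₀, a₀)) = u₀
    rw [hκ₀, hinit _ h0 rfl]
  · rw [hpl w hw]; simp
  · rw [hpl w hw]; simp
  · rw [injective_iff_map_eq_zero]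
    rintro ⟨e, v⟩ he
    have hcomp : ∀ (i : Fin 6) (d : Plane × Param),
        fderiv ℝ Ξ (t₀, a₀) d i = fderiv ℝ (fun w => Ξ w i) (t₀, a₀) d := fun i d => by
      rw [(hasFDerivAt_pi'.1 (hasFDerivAt_of_contDiffOn hWo hΞs hw₀) i).fderiv]
      rfl
    have he0 : e = 0 := by
      funext i
      have hpr : ∀ (i : Fin 2) (j : Fin 6), (∀ w ∈ W, Ξ w j = w.1 i) → e i = 0 := by
        intro i j hij
        have h1 : HasFDerivAt (fun w : Plane × Param => w.1 i)
            ((ContinuousLinearMap.proj i).comp (ContinuousLinearMap.fst ℝ Plane Param)) (t₀, a₀) :=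
          ((ContinuousLinearMap.proj i).comp (ContinuousLinearMap.fst ℝ Plane Param)).hasFDerivAt
        have h2 := hcomp j (e, v)
        rw [he, EventuallyEq.fderiv_eq (eventuallyEq_of_mem (hWo.mem_nhds hw₀) hij), h1.fderiv] at h2
        exact h2.symm
      fin_cases i
      · exact hpr 0 0 fun w hw => (h01 w hw).1
      · exact hpr 1 1 fun w hw => (h01 w hw).2
    subst he0
    -- At t₀ the flow time is 0, so the derivative in the parameters there is that of the initial
    -- data.
    have hv : ∀ a : Param, (t₀, a) ∈ W → Ξ (t₀, a) = initial t₀ a := fun a ha =>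
      hinit _ ha (by simp [hκ])
    have hcont : Tendsto (fun a : Param => (t₀, a)) (𝓝 a₀) (𝓝 (t₀, a₀)) :=
      (Continuous.prodMk_right t₀).tendsto a₀
    have h1 : HasFDerivAt (fun a : Param => Ξ (t₀, a))
        ((fderiv ℝ Ξ (t₀, a₀)).comp (ContinuousLinearMap.inr ℝ Plane Param)) a₀ :=
      (hasFDerivAt_of_contDiffOn hWo hΞs hw₀).comp a₀ (hasFDerivAt_prodMk_right t₀ a₀)
    have h2 : fderiv ℝ (initial t₀) a₀ v = 0 := by
      have h3 : fderiv ℝ (fun a : Param => Ξ (t₀, a)) a₀ = fderiv ℝ (initial t₀) a₀ :=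
        EventuallyEq.fderiv_eq
        (eventuallyEq_of_mem (hcont (hWo.mem_nhds hw₀)) fun a ha => hv a ha)
      rw [← h3, h1.fderiv]
      exact he
    refine Prod.ext rfl (funext fun i => ?_)
    change v i = 0
    rw [← fderiv_initial t₀ a₀ v i, h2]
    rfl

/-- Through every jet there passes a local general solution. -/
theorem PDEPair.Admissible.exists_generalSolution (hE : E.Admissible) {u₀ : Jet}
    (hu₀ : u₀ ∈ E.domain) : ∃ S : GeneralSolution E, ∃ w ∈ S.source, S.jet w = u₀ := by
  obtain ⟨W, w, Ξ, hW, hw, hΞw, hΞ, hmaps, h01, hd, hinj⟩ := hE.exists_integral hu₀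
  obtain ⟨e, hwe, heW, heΞ, -, himm⟩ := exists_openPartialHomeomorph (by simp) hW hΞ hw hinj
  -- A ball on which the jet map is injective; its slices are convex, hence connected.
  obtain ⟨ε, hε, hball⟩ := Metric.isOpen_iff.1 e.open_source w hwe
  set B := Metric.ball w ε with hB
  have hBW : B ⊆ W := hball.trans heW
  obtain ⟨hfam, hjet⟩ := isFamily_of_integral (E := E) Metric.isOpen_ball (hΞ.mono hBW)
    (fun x hx => hmaps (hBW hx)) (fun x hx => (h01 x (hBW hx)).1) (fun x hx => (h01 x (hBW hx)).2)
    (fun x hx => by rw [(hd x (hBW hx)).1]; exact ⟨rfl, rfl, rfl⟩)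
    (fun x hx => by rw [(hd x (hBW hx)).2]; exact ⟨rfl, rfl, rfl⟩) (fun x hx => himm x (hball hx))
  have hslice : ∀ a : Param, IsPreconnected {t : Plane | (t, a) ∈ B} := fun a => by
    refine Convex.isPreconnected fun x hx y hy p q hp hq hpq => ?_
    have h1 := convex_ball w ε hx hy hp hq hpq
    have h2 : p • (x, a) + q • (y, a) = (p • x + q • y, a) :=
      Prod.ext rfl (by change p • a + q • a = a; rw [← add_smul, hpq, one_smul])
    rwa [h2] at h1
  refine ⟨⟨B, fun w => Ξ w 2, hfam.isOpen, hfam.smooth, hslice, hfam.mapsTo, hfam.eq_xx, hfam.eq_yy,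
    fun x hx y hy hxy => ?_, hfam.immersion⟩, w, Metric.mem_ball_self hε, ?_⟩
  · rw [hjet x hx, hjet y hy, ← heΞ, ← heΞ] at hxy
    exact e.injOn (hball hx) (hball hy) hxy
  · exact (hjet w (Metric.mem_ball_self hε)).trans hΞw

end PDEPairs

end

theorem mainTheorem9 (E : PDEPairs.PDEPair) (hE : E.Admissible) (hgen : E.Generic) :
    (∀ E' : PDEPairs.PDEPair, E'.Admissible → PDEPairs.ContactEquivalence E E' →
      E.Metricity → E'.Metricity) ∧
    (∀ u ∈ E.domain, ∃ S : PDEPairs.GeneralSolution E, u ∈ S.jet '' S.source) ∧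
    (E.Metricity → ∀ S : PDEPairs.GeneralSolution E,
      S.conformalClass.Nonempty ∧
      (∀ h ∈ S.conformalClass, ∀ h' : PDEPairs.Param → PDEPairs.Bil PDEPairs.Param,
        h' ∈ S.conformalClass ↔ PDEPairs.ConformalOn S.params h' h) ∧
      (∀ h ∈ S.conformalClass, ∀ w ∈ S.source,
        (0 < 1 - E.Rs (S.jet w) * E.Ts (S.jet w) → PDEPairs.IsSplit (h w.2)) ∧
        (1 - E.Rs (S.jet w) * E.Ts (S.jet w) < 0 → PDEPairs.IsLorentzian (h w.2))) ∧
      (∀ E' : PDEPairs.PDEPair, E'.Admissible → E'.Generic →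
        ∀ (Φ : PDEPairs.ContactEquivalence E E') (S' : PDEPairs.GeneralSolution E')
          (χ : PDEPairs.Param → PDEPairs.Param), PDEPairs.Induces Φ S S' χ →
          ContDiffOn ℝ ∞ χ S.params ∧
          ∀ h ∈ S.conformalClass, ∀ h' ∈ S'.conformalClass,
            PDEPairs.ConformalOn S.params (PDEPairs.pullback χ h') h))
    := by
  refine ⟨fun E' hE' Φ hJ u' hu' => ?_, fun u hu => ?_, fun hJ S => ⟨S.conformalClass_nonempty hE hJ
    hgen, fun h hh h' => S.mem_conformalClass_iff hE hh, fun h hh w hw => S.signature hE hh hw,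
    fun E' hE' hgen' Φ S' χ hχ => ⟨hχ.contDiffOn,
      fun h hh h' hh' => hχ.conformalOn hE hgen hE' hh hh'⟩⟩⟩
  -- Every jet of the second pair is the lift of a jet of the first, and a general solution passes
  -- through that one.
  · have hu : u' ∈ Φ.lift.target := Φ.lift_target ▸ hu'
    have hs : Φ.lift.symm u' ∈ E.domain := Φ.lift_source ▸ Φ.lift.map_target hu
    obtain ⟨S, w, hw, hSw⟩ := hE.exists_generalSolution hs
    have h := S.metricity_lift hE hgen hJ hE' Φ hw
    rwa [hSw, Φ.lift.right_inv hu] at h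
  · obtain ⟨S, w, hw, hSw⟩ := hE.exists_generalSolution hu
    exact ⟨S, w, hw, hSw⟩
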